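/- Let $X$ be an orbifold line of signature $(p_0,\ldots,p_n)$: a compact connected one-dimensional complex orbifold whose underlying Riemann surface is isomorphic to $\mathbb{P}^1(\mathbb{C})$, and whose points with non-trivial stabilizer are exactly the $n+1\ge 1$ distinct points $P_0,\ldots,P_n$, with stabilizers of orders $p_0,\ldots,p_n$. Let $\mathrm{Pic}(X)$ be the group, under tensor product (written additively), of isomorphism classes of holomorphic line bundles on $X$. For a nonzero rational (that is, meromorphic) section $s$ of a line bundle and $x\in X$, let $\mathrm{ord}_x(s)\in\mathbb{Z}$ be the order of $s$ at $x$ in an orbifold chart, and put $\deg(s)=\sum_{x\in X}\mathrm{ord}_x(s)/|\mathrm{Stab}(x)|$. Every line bundle has a nonzero rational section, each nonzero rational section has nonzero order at only finitely many points, and there is a group homomorphism $\deg:\mathrm{Pic}(X)\to\mathbb{Q}$ with $\deg[L]=\deg(s)$ for every nonzero rational section $s$ of $L$. Moreover: (a) $\mathrm{Pic}(X)$ is an abelian group of rank one, generated by $n+1$ elements $x_0,\ldots,x_n$ with defining relations $p_0x_0=p_1x_1=\cdots=p_nx_n$. Here $x_i$ may be taken to be the class of $\mathcal{O}_X(P_i)$,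 that is, of a line bundle having a rational section with order $1$ at $P_i$ and order $0$ at all other points. (b) Let $m=\mathrm{lcm}(p_0,\ldots,p_n)$ and $\mathrm{Pic}_0(X)=\ker(\deg)$. The image of $\deg$ is $\frac1m\mathbb{Z}$, so that there is an exact sequence $$0\to \mathrm{Pic}_0(X)\to \mathrm{Pic}(X)\xrightarrow{\ \deg\ }\tfrac1m\mathbb{Z}\to 0,$$ and $\mathrm{Pic}_0(X)$ is the torsion subgroup of $\mathrm{Pic}(X)$. (c) There is an isomorphism $$\mathrm{Pic}_0(X)\;\cong\;\Bigl(\prod_{j=0}^n\mathbb{Z}/p_j\mathbb{Z}\Bigr)\Big/\langle(1,1,\ldots,1)\rangle.$$ -/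

import Mathlib

open Filter Topology

/-- `f` is, near `z`, a holomorphic open embedding of the orbifold chart `φ : U → X` into the
orbifold chart `ψ : V → X`: it is holomorphic at `z` with nonzero derivative and `ψ ∘ f = φ` near
`z`. Such local embeddings are the change-of-chart maps of an orbifold. In particular the elements
of the group of a chart are local embeddings of this chart into itself. -/
structure IsLocalEmbedding {X : Type*} (U V : Set ℂ) (φ ψ : ℂ → X) (f : ℂ → ℂ) (z : ℂ) : Prop where
  mem_source : z ∈ U
  mem_target : f z ∈ V
  analyticAt : AnalyticAt ℂ f z
  deriv_ne_zero : deriv f z ≠ 0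
  comm : ∀ᶠ w in 𝓝 z, ψ (f w) = φ w

/-- A one-dimensional complex (effective) orbifold structure on the topological space `X`, in the
sense of Satake: an atlas of orbifold charts `φ i : U i → X`, where `U i ⊆ ℂ` is open and
connected, and a finite group `G i` of holomorphic automorphisms of `U i` such that `φ i` induces a
homeomorphism of `U i / G i` onto an open subset of `X`. Only the values of `φ i` on `U i`
matter. -/
structure OrbifoldAtlas (X : Type*) [TopologicalSpace X] where
  /-- index type of the charts -/
  ι : Type*
  /-- the chart domains -/
  U : ι → Set ℂ
  isOpen_U : ∀ i, IsOpen (U i)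
  isConnected_U : ∀ i, IsConnected (U i)
  /-- the local groups -/
  G : ∀ i, Subgroup (Equiv.Perm (U i))
  finite_G : ∀ i, Finite (G i)
  holomorphic_G : ∀ i, ∀ g ∈ G i, ∃ f : ℂ → ℂ, DifferentiableOn ℂ f (U i) ∧ ∀ u : U i, f u = g u
  /-- the chart maps -/
  φ : ι → ℂ → X
  continuousOn_φ : ∀ i, ContinuousOn (φ i) (U i)
  isOpen_image : ∀ i, ∀ V ⊆ U i, IsOpen V → IsOpen (φ i '' V)
  φ_eq_iff : ∀ i, ∀ u v : U i, φ i u = φ i v ↔ ∃ g ∈ G i, g u = v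
  covers : ∀ x : X, ∃ i, ∃ u : U i, φ i u = x
  compatible : ∀ i j, ∀ (u : U i) (v : U j), φ i u = φ j v →
    ∃ f : ℂ → ℂ, IsLocalEmbedding (U i) (U j) (φ i) (φ j) f u ∧ f u = v

namespace OrbifoldAtlas

variable {X : Type*} [TopologicalSpace X] (A : OrbifoldAtlas X)

/-- The points of the charts. -/
abbrev Pt := Σ i, A.U i

/-- `f` is a local embedding of the chart `i` into the chart `j` at `z`. -/
abbrev IsArrow (i j : A.ι) (f : ℂ → ℂ) (z : ℂ) : Prop :=
  IsLocalEmbedding (A.U i) (A.U j) (A.φ i) (A.φ j) f z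

/-- A chosen point over `x` in some chart. -/
noncomputable def lift (x : X) : A.Pt :=
  ⟨(A.covers x).choose, (A.covers x).choose_spec.choose⟩

/-- The order of the stabilizer of a point `x` of the orbifold, that is, of the stabilizer, in the
group of a chart, of a point over `x`. -/
noncomputable def stabOrder (x : X) : ℕ :=
  Nat.card (MulAction.stabilizer (A.G (A.lift x).1) (A.lift x).2)

open scoped Classical in
/-- The map `f` to the Riemann sphere `ℙ¹(ℂ) = ℂ ∪ {∞}` is holomorphic at `z`: near `z` it is a
holomorphic function `g`, or `1 / g` for a holomorphic function `g`. -/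
def _root_.HolomorphicToSphereAt (f : ℂ → OnePoint ℂ) (z : ℂ) : Prop :=
  (∃ g : ℂ → ℂ, AnalyticAt ℂ g z ∧ ∀ᶠ w in 𝓝 z, f w = (g w : OnePoint ℂ)) ∨
  (∃ g : ℂ → ℂ, AnalyticAt ℂ g z ∧
    ∀ᶠ w in 𝓝 z, f w = if g w = 0 then OnePoint.infty else (((g w)⁻¹ : ℂ) : OnePoint ℂ))

/-- A compact connected complex orbifold of dimension one whose underlying Riemann surface has
genus zero, that is, is isomorphic to `ℙ¹(ℂ)`. The functions on the underlying Riemann surface which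
are holomorphic are those with holomorphic pull-back to the charts; so an isomorphism is a
homeomorphism whose composition with every chart is holomorphic. -/
structure IsOrbifoldLine : Prop where
  t2 : T2Space X
  compact : CompactSpace X
  connected : ConnectedSpace X
  genus_zero : ∃ h : X ≃ₜ OnePoint ℂ,
    ∀ i, ∀ u ∈ A.U i, HolomorphicToSphereAt (fun z => h (A.φ i z)) u

/-- The orbifold points (those with non-trivial stabilizer) are the distinct points
`P 0, …, P n`, with stabilizers of orders `p 0, …, p n`. -/
structure HasSignature {n : ℕ} (P : Fin (n + 1) → X) (p : Fin (n + 1) → ℕ) : Prop where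
  injective : Function.Injective P
  order_eq : ∀ k, A.stabOrder (P k) = p k
  nontrivial : ∀ k, p k ≠ 1
  order_eq_one : ∀ x, x ∉ Set.range P → A.stabOrder x = 1

/-- A holomorphic line bundle on the orbifold, given by local frames and transition functions.
There is a frame `e a` on a neighbourhood `N a` of every point `a` of every chart (every covering
of the charts is refined by such a covering). For a local embedding `f` of charts at `z ∈ N a`,
with `f z ∈ N b`, the bundle has an isomorphism of its fibres at `z` and `f z`; it sends the frame
`e a` to `g a b f z • e b`. These numbers depend only on the germ of `f`, vary holomorphically with
`z`, and are multiplicative under composition of embeddings. Since the elements of the groups of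
the charts are local embeddings, this includes the equivariance under these groups. -/
structure LineBundle where
  /-- the domains of the frames -/
  N : A.Pt → Set ℂ
  isOpen_N : ∀ a, IsOpen (N a)
  mem_N : ∀ a, (a.2 : ℂ) ∈ N a
  N_subset : ∀ a, N a ⊆ A.U a.1
  /-- the transition functions; only the values at local embeddings `f` with `z ∈ N a` and
  `f z ∈ N b` matter -/
  g : A.Pt → A.Pt → (ℂ → ℂ) → ℂ → ℂ
  g_ne_zero : ∀ a b f z, A.IsArrow a.1 b.1 f z → z ∈ N a → f z ∈ N b → g a b f z ≠ 0
  g_congr : ∀ a b f f' z, A.IsArrow a.1 b.1 f z → z ∈ N a → f z ∈ N b → f =ᶠ[𝓝 z] f' →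
    g a b f z = g a b f' z
  g_analytic : ∀ a b f z, A.IsArrow a.1 b.1 f z → z ∈ N a → f z ∈ N b →
    AnalyticAt ℂ (g a b f) z
  g_comp : ∀ a b c f f' z, A.IsArrow a.1 b.1 f z → A.IsArrow b.1 c.1 f' (f z) →
    z ∈ N a → f z ∈ N b → f' (f z) ∈ N c → g a c (f' ∘ f) z = g b c f' (f z) * g a b f z

namespace LineBundle

variable {A}

/-- Isomorphism of line bundles: over smaller neighbourhoods `M a` of the points, it is the
multiplication by a nowhere vanishing holomorphic function `h a` (with respect to the frames of
the two bundles), compatibly with the transition functions. -/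
def Iso (L L' : A.LineBundle) : Prop :=
  ∃ (M : A.Pt → Set ℂ) (h : A.Pt → ℂ → ℂ),
    (∀ a, IsOpen (M a)) ∧ (∀ a, (a.2 : ℂ) ∈ M a) ∧ (∀ a, M a ⊆ L.N a ∩ L'.N a) ∧
    (∀ a, ∀ z ∈ M a, AnalyticAt ℂ (h a) z ∧ h a z ≠ 0) ∧
    ∀ a b f z, A.IsArrow a.1 b.1 f z → z ∈ M a → f z ∈ M b →
      h b (f z) * L.g a b f z = L'.g a b f z * h a z

/-- The trivial line bundle. -/
def trivial (A : OrbifoldAtlas X) : A.LineBundle where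
  N a := A.U a.1
  isOpen_N a := A.isOpen_U a.1
  mem_N a := a.2.2
  N_subset _ := subset_rfl
  g _ _ _ _ := 1
  g_ne_zero _ _ _ _ _ _ _ := one_ne_zero
  g_congr _ _ _ _ _ _ _ _ _ := rfl
  g_analytic _ _ _ _ _ _ _ := analyticAt_const
  g_comp _ _ _ _ _ _ _ _ _ _ _ := by simp

/-- The tensor product of line bundles. -/
def tensor (L L' : A.LineBundle) : A.LineBundle where
  N a := L.N a ∩ L'.N a
  isOpen_N a := (L.isOpen_N a).inter (L'.isOpen_N a)
  mem_N a := ⟨L.mem_N a, L'.mem_N a⟩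
  N_subset a := fun _ hz => L.N_subset a hz.1
  g a b f z := L.g a b f z * L'.g a b f z
  g_ne_zero a b f z h hz hf :=
    mul_ne_zero (L.g_ne_zero a b f z h hz.1 hf.1) (L'.g_ne_zero a b f z h hz.2 hf.2)
  g_congr a b f f' z h hz hf e := by
    rw [L.g_congr a b f f' z h hz.1 hf.1 e, L'.g_congr a b f f' z h hz.2 hf.2 e]
  g_analytic a b f z h hz hf :=
    (L.g_analytic a b f z h hz.1 hf.1).mul (L'.g_analytic a b f z h hz.2 hf.2)
  g_comp a b c f f' z h h' hz hf hf' := by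
    rw [L.g_comp a b c f f' z h h' hz.1 hf.1 hf'.1, L'.g_comp a b c f f' z h h' hz.2 hf.2 hf'.2]
    ring

/-- The dual line bundle. -/
noncomputable def dual (L : A.LineBundle) : A.LineBundle where
  N := L.N
  isOpen_N := L.isOpen_N
  mem_N := L.mem_N
  N_subset := L.N_subset
  g a b f z := (L.g a b f z)⁻¹
  g_ne_zero a b f z h hz hf := inv_ne_zero (L.g_ne_zero a b f z h hz hf)
  g_congr a b f f' z h hz hf e := by rw [L.g_congr a b f f' z h hz hf e]
  g_analytic a b f z h hz hf :=
    (L.g_analytic a b f z h hz hf).inv (L.g_ne_zero a b f z h hz hf)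
  g_comp a b c f f' z h h' hz hf hf' := by
    rw [L.g_comp a b c f f' z h h' hz hf hf', mul_inv]

theorem Iso.of_eq {L L' : A.LineBundle}
    (H : ∀ a b f z, A.IsArrow a.1 b.1 f z → z ∈ L.N a ∩ L'.N a → f z ∈ L.N b ∩ L'.N b →
      L.g a b f z = L'.g a b f z) : Iso L L' :=
  ⟨fun a => L.N a ∩ L'.N a, fun _ _ => 1, fun a => (L.isOpen_N a).inter (L'.isOpen_N a),
    fun a => ⟨L.mem_N a, L'.mem_N a⟩, fun _ => subset_rfl,
    fun _ _ _ => ⟨analyticAt_const, one_ne_zero⟩,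
    fun a b f z h hz hf => by rw [H a b f z h hz hf]; ring⟩

theorem Iso.refl (L : A.LineBundle) : Iso L L := Iso.of_eq fun _ _ _ _ _ _ _ => rfl

theorem Iso.symm {L L' : A.LineBundle} : Iso L L' → Iso L' L := by
  rintro ⟨M, h, hM, hm, hs, ha, hc⟩
  refine ⟨M, fun a z => (h a z)⁻¹, hM, hm, fun a z hz => ⟨(hs a hz).2, (hs a hz).1⟩,
    fun a z hz => ⟨(ha a z hz).1.inv (ha a z hz).2, inv_ne_zero (ha a z hz).2⟩, ?_⟩
  intro a b f z hf hz hfz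
  have := hc a b f z hf hz hfz
  have h1 := (ha a z hz).2
  have h2 := (ha b _ hfz).2
  field_simp
  linear_combination -this

theorem Iso.trans {L L' L'' : A.LineBundle} : Iso L L' → Iso L' L'' → Iso L L'' := by
  rintro ⟨M, h, hM, hm, hs, ha, hc⟩ ⟨M', h', hM', hm', hs', ha', hc'⟩
  refine ⟨fun a => M a ∩ M' a, fun a z => h' a z * h a z, fun a => (hM a).inter (hM' a),
    fun a => ⟨hm a, hm' a⟩, fun a z hz => ⟨(hs a hz.1).1, (hs' a hz.2).2⟩,
    fun a z hz => ⟨(ha' a z hz.2).1.mul (ha a z hz.1).1,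
      mul_ne_zero (ha' a z hz.2).2 (ha a z hz.1).2⟩, ?_⟩
  intro a b f z hf hz hfz
  linear_combination h' b (f z) * hc a b f z hf hz.1 hfz.1 + h a z * hc' a b f z hf hz.2 hfz.2

theorem Iso.tensor {L₁ L₂ L₁' L₂' : A.LineBundle} :
    Iso L₁ L₁' → Iso L₂ L₂' → Iso (L₁.tensor L₂) (L₁'.tensor L₂') := by
  rintro ⟨M, h, hM, hm, hs, ha, hc⟩ ⟨M', h', hM', hm', hs', ha', hc'⟩
  refine ⟨fun a => M a ∩ M' a, fun a z => h a z * h' a z, fun a => (hM a).inter (hM' a),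
    fun a => ⟨hm a, hm' a⟩,
    fun a z hz => ⟨⟨(hs a hz.1).1, (hs' a hz.2).1⟩, ⟨(hs a hz.1).2, (hs' a hz.2).2⟩⟩,
    fun a z hz => ⟨(ha a z hz.1).1.mul (ha' a z hz.2).1,
      mul_ne_zero (ha a z hz.1).2 (ha' a z hz.2).2⟩, ?_⟩
  intro a b f z hf hz hfz
  change h b (f z) * h' b (f z) * (L₁.g a b f z * L₂.g a b f z)
    = L₁'.g a b f z * L₂'.g a b f z * (h a z * h' a z)
  linear_combination h' b (f z) * L₂.g a b f z * hc a b f z hf hz.1 hfz.1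
    + L₁'.g a b f z * h a z * hc' a b f z hf hz.2 hfz.2

theorem Iso.dual {L L' : A.LineBundle} : Iso L L' → Iso L.dual L'.dual := by
  rintro ⟨M, h, hM, hm, hs, ha, hc⟩
  refine ⟨M, fun a z => (h a z)⁻¹, hM, hm, hs,
    fun a z hz => ⟨(ha a z hz).1.inv (ha a z hz).2, inv_ne_zero (ha a z hz).2⟩, ?_⟩
  intro a b f z hf hz hfz
  change (h b (f z))⁻¹ * (L.g a b f z)⁻¹ = (L'.g a b f z)⁻¹ * (h a z)⁻¹
  rw [← mul_inv, ← mul_inv, hc a b f z hf hz hfz]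

instance setoid (A : OrbifoldAtlas X) : Setoid A.LineBundle where
  r := Iso
  iseqv := ⟨Iso.refl, Iso.symm, Iso.trans⟩

end LineBundle

/-- The Picard group: isomorphism classes of line bundles under the tensor product, written
additively. -/
def Pic : Type _ := Quotient (LineBundle.setoid A)

variable {A}

/-- The class of a line bundle in the Picard group. -/
def LineBundle.toPic (L : A.LineBundle) : A.Pic := Quotient.mk _ L

instance : Zero A.Pic := ⟨(LineBundle.trivial A).toPic⟩

instance : Add A.Pic :=
  ⟨Quotient.map₂ LineBundle.tensor fun _ _ h _ _ h' => LineBundle.Iso.tensor h h'⟩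

noncomputable instance : Neg A.Pic :=
  ⟨Quotient.map LineBundle.dual fun _ _ h => LineBundle.Iso.dual h⟩

noncomputable instance : AddCommGroup A.Pic where
  nsmul := nsmulRec
  zsmul := zsmulRec
  add_assoc := by
    rintro ⟨L⟩ ⟨L'⟩ ⟨L''⟩
    exact Quotient.sound (LineBundle.Iso.of_eq fun a b f z _ _ _ =>
      mul_assoc (L.g a b f z) (L'.g a b f z) (L''.g a b f z))
  zero_add := by
    rintro ⟨L⟩
    exact Quotient.sound (LineBundle.Iso.of_eq fun a b f z _ _ _ => one_mul (L.g a b f z))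
  add_zero := by
    rintro ⟨L⟩
    exact Quotient.sound (LineBundle.Iso.of_eq fun a b f z _ _ _ => mul_one (L.g a b f z))
  neg_add_cancel := by
    rintro ⟨L⟩
    exact Quotient.sound (LineBundle.Iso.of_eq fun a b f z h hz hf =>
      inv_mul_cancel₀ (L.g_ne_zero a b f z h hz.1.1 hf.1.1))
  add_comm := by
    rintro ⟨L⟩ ⟨L'⟩
    exact Quotient.sound (LineBundle.Iso.of_eq fun a b f z _ _ _ =>
      mul_comm (L.g a b f z) (L'.g a b f z))

/-- A rational (that is, meromorphic, and nowhere locally zero) section of a line bundle, through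
its coordinates `s a` with respect to the frames. -/
structure RationalSection (L : A.LineBundle) where
  /-- the coordinates of the section -/
  s : A.Pt → ℂ → ℂ
  meromorphic : ∀ a, ∀ z ∈ L.N a, MeromorphicAt (s a) z
  order_ne_top : ∀ a, ∀ z ∈ L.N a, meromorphicOrderAt (s a) z ≠ ⊤
  compatible : ∀ a b f z, A.IsArrow a.1 b.1 f z → z ∈ L.N a → f z ∈ L.N b →
    ∀ᶠ w in 𝓝[≠] z, s b (f w) = L.g a b f w * s a w

namespace RationalSection

variable {L : A.LineBundle}

/-- The order of vanishing of a rational section at a point of the orbifold, measured in an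
orbifold chart. The divisor of the section is `∑ x, (ord x / |Stab x|) x`. -/
noncomputable def ord (s : RationalSection L) (x : X) : ℤ :=
  (meromorphicOrderAt (s.s (A.lift x)) (A.lift x).2).untop₀

/-- The degree of the divisor of a rational section. -/
noncomputable def degree (s : RationalSection L) : ℚ :=
  ∑ᶠ x : X, (s.ord x : ℚ) / (A.stabOrder x : ℚ)

end RationalSection

end OrbifoldAtlas

/-!
Line bundles on an orbifold line `X` are classified by divisors. Let `h : X ≃ ℙ¹(ℂ)` be the
isomorphism of the underlying Riemann surface, and let `e x` be the order of the stabilizer of `x`.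
Consider the pairs `(q, d)` of a class `q ∈ Pic(X)` and a function `d : X → ℤ` such that `d` gives
the orders of a rational section of a bundle of class `q`. They form a group (`divisorPairs`) with
the following properties.

* Every line bundle has a rational section (`IsSphereIso.nonempty_rationalSection`). Near a point
  of `X`, averaging a multiple of a frame over the stabilizer gives one (`exists_isSectionOn_nhd`).
  The quotient of two such sections is a meromorphic function on an open subset of the sphere
  (`exists_ratio`), and by the multiplicative Cousin theorem on the sphere
  (`multiplicative_cousin`) it can be split into a factor for each section, so that the sections
  can be glued. Cousin's theorem comes from the Cauchy–Pompeiu formula (`cauchy_pompeiu`): it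
  writes a holomorphic function near `K₁ ∩ K₂` as an integral of Cauchy kernels, and the integral
  is split into parts which are holomorphic near `K₁` and near `K₂` (`additive_cousin`). By
  Runge's theorem, a nonzero meromorphic function near a compact set has a logarithm after division
  by a meromorphic function on the plane (`exists_eq_mul_exp`).
* The orders of a section vanish outside of a finite set, by compactness of `X`.
* A section without zeros and poles is an isomorphism with the trivial bundle
  (`RationalSection.iso_trivial`). So `q` is determined by `d`.
* Sections of isomorphic bundles differ by a meromorphic function on `X`, which is a rational
  function on the sphere. The pull-back to a chart multiplies its order at `x` by `e x`, since the
  chart map `φ` is the `e x`-th power in suitable coordinates (`IsLocalCoord.intOrderAt_eq_card`).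
  So `(0, d)` is one of the pairs if and only if `d = e * D` for some `D : X → ℤ` with finite support
  and `∑ x, D x = 0`.
* There is a line bundle `𝒪(x)` with a section of order one at `x` and zero elsewhere
  (`pointBundle`, `ord_pointSection`).

So `Pic(X)` is the group of functions `d` with finite support modulo those of the form `e * D`,
where `∑ x, D x = 0`, and `∑ x, d x / e x` is well defined on it. A point `x` with `e x = 1` is
equivalent to `p 0 • P 0`. Hence the `𝒪(P i)` generate `Pic(X)`, and `∑ i, c i • P i` is trivial if
and only if `c i = k i * p i` with `∑ i, k i = 0`, that is, if `c` is a combination of the stated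
relations. The rest is algebra: a Bézout identity for the numbers `lcm p / p i` gives the image of
the degree, and multiplication by `lcm p` shows that its kernel `T` is torsion. The pairing
`(a, c) ↦ ∑ i, a i * c i / p i` with values in `ℚ / ℤ` identifies `(∏ i, ℤ / p i) / ⟨(1, …, 1)⟩`
with the dual of `T`, and a finite abelian group is isomorphic to its dual
(`nonempty_ker_degree_equiv`).
-/

/-! ### The Cauchy–Pompeiu formula -/

/-- The Cauchy–Riemann operator `∂f/∂z̄ = (∂f/∂x + i ∂f/∂y) / 2`. -/
noncomputable def dbar (f : ℂ → ℂ) (z : ℂ) : ℂ :=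
  (1 / 2) * (fderiv ℝ f z 1 + Complex.I * fderiv ℝ f z Complex.I)

theorem dbar_eq_zero_of_differentiableAt {f : ℂ → ℂ} {z : ℂ} (hf : DifferentiableAt ℂ f z) :
    dbar f z = 0 := by
  have h1 : fderiv ℝ f z = (fderiv ℂ f z).restrictScalars ℝ := hf.fderiv_restrictScalars ℝ
  have h2 : fderiv ℂ f z Complex.I = Complex.I * fderiv ℂ f z 1 := by
    rw [← smul_eq_mul, ← map_smul, smul_eq_mul, mul_one]
  rw [dbar, h1]
  simp only [ContinuousLinearMap.coe_restrictScalars']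
  rw [h2, ← mul_assoc, Complex.I_mul_I]
  ring

/-- The Cauchy–Riemann operator through the derivatives in the orthogonal directions `v` and
`i v`. -/
theorem dbar_mul_eq (f : ℂ → ℂ) (z v : ℂ) :
    fderiv ℝ f z v + Complex.I * fderiv ℝ f z (Complex.I * v)
      = 2 * dbar f z * (starRingEnd ℂ) v := by
  have key : ∀ w : ℂ, fderiv ℝ f z w = w.re * fderiv ℝ f z 1 + w.im * fderiv ℝ f z Complex.I := by
    intro w
    conv_lhs => rw [show w = w.re • (1 : ℂ) + w.im • Complex.I by
      simp [Complex.re_add_im]]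
    rw [map_add, map_smul, map_smul]
    simp
  rw [key v, key (Complex.I * v), dbar, ← Complex.re_add_im ((starRingEnd ℂ) v)]
  simp only [Complex.mul_re, Complex.I_re, Complex.I_im, Complex.mul_im, Complex.conj_re,
    Complex.conj_im]
  push_cast
  linear_combination (fderiv ℝ f z Complex.I * v.im) * Complex.I_mul_I

theorem continuous_dbar {f : ℂ → ℂ} (hf : ContDiff ℝ 1 f) : Continuous (dbar f) := by
  have := hf.continuous_fderiv one_ne_zero
  unfold dbar
  fun_prop

theorem tsupport_dbar_subset (f : ℂ → ℂ) : tsupport (dbar f) ⊆ tsupport f := by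
  refine (closure_minimal (fun z hz => ?_) (isClosed_tsupport _))
  by_contra h
  have h0 : f =ᶠ[𝓝 z] fun _ => (0 : ℂ) := notMem_tsupport_iff_eventuallyEq.1 h
  refine hz ?_
  rw [dbar, h0.fderiv_eq]
  simp

open MeasureTheory Real Set in
theorem integrableOn_polar {g : ℝ × ℝ → ℂ} (hg : Continuous g) {R : ℝ}
    (hR : ∀ p : ℝ × ℝ, R < p.1 → g p = 0) :
    IntegrableOn g (Ioi (0 : ℝ) ×ˢ Ioo (-π) π) := by
  have h1 : IntegrableOn g (Icc 0 R ×ˢ Icc (-π) π) :=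
    hg.continuousOn.integrableOn_compact (isCompact_Icc.prod isCompact_Icc)
  refine h1.of_forall_sdiff_eq_zero (measurableSet_Ioi.prod measurableSet_Ioo) ?_
  rintro ⟨r, t⟩ ⟨⟨h2, h3⟩, h4⟩
  refine hR _ ?_
  by_contra h5
  exact h4 ⟨⟨le_of_lt h2, not_lt.1 h5⟩, Ioo_subset_Icc_self h3⟩

open MeasureTheory Real Set in
/-- The Cauchy–Pompeiu formula at the origin. In polar coordinates the integrand is a sum of a
derivative along the rays and a derivative along the circles about the origin. -/
theorem cauchy_pompeiu_zero {f : ℂ → ℂ} (hf : ContDiff ℝ 1 f) (hc : HasCompactSupport f) :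
    ∫ w, dbar f w / w = -π * f 0 := by
  obtain ⟨R, hR⟩ : ∃ R : ℝ, ∀ z : ℂ, R < ‖z‖ → fderiv ℝ f z = 0 ∧ f z = 0 := by
    obtain ⟨R, hR⟩ := (hc.isCompact.isBounded).subset_closedBall 0
    refine ⟨R, fun z hz => ?_⟩
    have h1 : z ∉ tsupport f := fun h => by
      have := hR h
      simp at this
      linarith
    exact ⟨image_eq_zero_of_notMem_tsupport fun h => h1 (tsupport_fderiv_subset ℝ h),
      image_eq_zero_of_notMem_tsupport h1⟩
  have hcf : Continuous (fderiv ℝ f) := hf.continuous_fderiv one_ne_zero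
  have hd : Differentiable ℝ f := hf.differentiable one_ne_zero
  set e : ℝ → ℂ := fun t => Complex.exp (t * Complex.I) with he
  have hec : Continuous e := by fun_prop
  have hen : ∀ t, ‖e t‖ = 1 := fun t => Complex.norm_exp_ofReal_mul_I t
  have hed : ∀ t, HasDerivAt e (Complex.I * e t) t := by
    intro t
    have h1 : HasDerivAt (fun t : ℝ => (t : ℂ) * Complex.I) (1 * Complex.I) t :=
      (HasDerivAt.ofReal_comp (hasDerivAt_id t)).mul_const _
    convert! h1.cexp using 1
    simp [he, mul_comm]
  set A : ℝ × ℝ → ℂ := fun p => fderiv ℝ f (p.1 * e p.2) (e p.2) with hA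
  set B : ℝ × ℝ → ℂ := fun p => fderiv ℝ f (p.1 * e p.2) (Complex.I * e p.2) with hB
  have hpt : Continuous fun p : ℝ × ℝ => (p.1 : ℂ) * e p.2 := by fun_prop
  have hAc : Continuous A := (hcf.comp hpt).clm_apply (by fun_prop)
  have hBc : Continuous B := (hcf.comp hpt).clm_apply (by fun_prop)
  have hbig : ∀ p : ℝ × ℝ, R < p.1 → R < ‖(p.1 : ℂ) * e p.2‖ := by
    intro p hp
    rw [norm_mul, hen, mul_one, Complex.norm_real]
    exact hp.trans_le (le_abs_self _)
  have hAi := integrableOn_polar hAc (R := R) fun p hp => by simp [hA, (hR _ (hbig p hp)).1]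
  have hBi := integrableOn_polar hBc (R := R) fun p hp => by simp [hB, (hR _ (hbig p hp)).1]
  -- the integrand in polar coordinates
  have hpolar : ∫ w, dbar f w / w
      = ∫ p in Ioi (0 : ℝ) ×ˢ Ioo (-π) π, ((1 / 2) * A p + (1 / 2) * Complex.I * B p) := by
    rw [← Complex.integral_comp_polarCoord_symm, polarCoord_target]
    refine setIntegral_congr_fun (measurableSet_Ioi.prod measurableSet_Ioo) ?_
    rintro ⟨r, t⟩ ⟨hr, -⟩
    have hr' : (r : ℂ) ≠ 0 := by exact_mod_cast (ne_of_gt hr)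
    have hsymm : Complex.polarCoord.symm (r, t) = r * e t := by
      rw [Complex.polarCoord_symm_apply, he]
      simp only [Complex.exp_mul_I, Complex.ofReal_cos, Complex.ofReal_sin]
    have h0 : e t ≠ 0 := Complex.exp_ne_zero _
    have h2 : (starRingEnd ℂ) (e t) * e t = 1 := by
      rw [mul_comm, Complex.mul_conj, Complex.normSq_eq_norm_sq, hen]; simp
    have h1 := dbar_mul_eq f (r * e t) (e t)
    simp only [hsymm, hA, hB, Complex.real_smul]
    have h3 : dbar f (r * e t) / e t = dbar f (r * e t) * (starRingEnd ℂ) (e t) := by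
      rw [div_eq_iff h0, mul_assoc, h2, mul_one]
    have h4 : (r : ℂ) * (dbar f (r * e t) / (r * e t)) = dbar f (r * e t) / e t := by
      field_simp
    rw [h4, h3]
    linear_combination (-1 / 2) * h1
  have hvol : (volume : Measure (ℝ × ℝ)).restrict (Ioi (0 : ℝ) ×ˢ Ioo (-π) π)
      = (volume.restrict (Ioi 0)).prod (volume.restrict (Ioo (-π) π)) := by
    rw [Measure.prod_restrict]; rfl
  -- the radial part
  have hAint : ∫ p in Ioi (0 : ℝ) ×ˢ Ioo (-π) π, A p = -(2 * π) * f 0 := by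
    have hAi' : Integrable A ((volume.restrict (Ioi 0)).prod (volume.restrict (Ioo (-π) π))) := by
      rw [← hvol]; exact hAi
    rw [hvol, integral_prod_symm _ hAi']
    have hin : ∀ t : ℝ, ∫ r in Ioi (0 : ℝ), A (r, t) = 0 - f 0 := by
      intro t
      have hder : ∀ r ∈ Ici (0 : ℝ), HasDerivAt (fun r : ℝ => f (r * e t)) (A (r, t)) r := by
        intro r _
        have h1 : HasDerivAt (fun r : ℝ => (r : ℂ) * e t) (1 * e t) r :=
          (HasDerivAt.ofReal_comp (hasDerivAt_id r)).mul_const _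
        have := (hd (r * e t)).hasFDerivAt.comp_hasDerivAt r h1
        simpa [hA] using! this
      have hint : IntegrableOn (fun r => A (r, t)) (Ioi (0 : ℝ)) := by
        have h1 : IntegrableOn (fun r => A (r, t)) (Icc 0 R) :=
          (hAc.comp (by fun_prop)).continuousOn.integrableOn_compact isCompact_Icc
        refine h1.of_forall_sdiff_eq_zero measurableSet_Ioi ?_
        rintro r ⟨h2, h4⟩
        have h5 : R < r := by
          by_contra h5
          exact h4 ⟨le_of_lt h2, not_lt.1 h5⟩
        simp [hA, (hR _ (hbig (r, t) h5)).1]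
      have htend : Tendsto (fun r : ℝ => f (r * e t)) atTop (𝓝 0) := by
        refine tendsto_const_nhds.congr' ?_
        filter_upwards [eventually_gt_atTop R] with r hr
        exact ((hR _ (hbig (r, t) hr)).2).symm
      have := integral_Ioi_of_hasDerivAt_of_tendsto' hder hint htend
      simpa using this
    simp only [hin]
    rw [setIntegral_const]
    simp only [Measure.real, Real.volume_Ioo, Complex.real_smul]
    rw [ENNReal.toReal_ofReal (by linarith [pi_pos])]
    push_cast
    ring
  -- the angular part
  have hBint : ∫ p in Ioi (0 : ℝ) ×ˢ Ioo (-π) π, B p = 0 := by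
    rw [hvol, integral_prod _ (by rw [← hvol]; exact hBi)]
    have hin : ∀ r ∈ Ioi (0 : ℝ), ∫ t in Ioo (-π) π, B (r, t) = 0 := by
      intro r hr
      have hr' : (r : ℂ) ≠ 0 := by exact_mod_cast (ne_of_gt hr)
      have hder : ∀ t ∈ uIcc (-π) π, HasDerivAt (fun t : ℝ => f (r * e t)) (r * B (r, t)) t := by
        intro t _
        have h1 : HasDerivAt (fun t : ℝ => (r : ℂ) * e t) (r * (Complex.I * e t)) t :=
          (hed t).const_mul _
        have h2 := (hd (r * e t)).hasFDerivAt.comp_hasDerivAt t h1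
        convert! h2 using 1
        rw [← Complex.real_smul (z := Complex.I * e t), (fderiv ℝ f _).map_smul,
          Complex.real_smul]
      have h3 := intervalIntegral.integral_eq_sub_of_hasDerivAt hder
        (((hBc.comp (by fun_prop)).const_smul (r : ℂ)).intervalIntegrable _ _)
      have h4 : e π = e (-π) := by
        simp only [he]
        push_cast
        rw [Complex.exp_pi_mul_I, neg_mul, Complex.exp_neg, Complex.exp_pi_mul_I]
        norm_num
      rw [h4, sub_self, intervalIntegral.integral_const_mul] at h3
      have h5 := (mul_eq_zero.1 h3).resolve_left hr'
      rwa [intervalIntegral.integral_of_le (by linarith [pi_pos]),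
        integral_Ioc_eq_integral_Ioo] at h5
    rw [setIntegral_congr_fun measurableSet_Ioi hin]
    simp
  rw [hpolar, integral_add (hAi.const_mul _) (hBi.const_mul _), integral_const_mul,
    integral_const_mul, hAint, hBint]
  ring

open MeasureTheory Real in
/-- The **Cauchy–Pompeiu formula** for a compactly supported function of class `C¹`. -/
theorem cauchy_pompeiu {f : ℂ → ℂ} (hf : ContDiff ℝ 1 f) (hc : HasCompactSupport f) (z : ℂ) :
    ∫ w, dbar f w / (w - z) = -π * f z := by
  have h1 := cauchy_pompeiu_zero (f := fun w => f (w + z))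
    (hf.comp (contDiff_id.add contDiff_const)) (hc.comp_homeomorph (Homeomorph.addRight z))
  rw [zero_add] at h1
  rw [← h1, ← integral_add_right_eq_self _ z]
  refine integral_congr_ae (Eventually.of_forall fun w => ?_)
  simp [dbar, fderiv_comp_add_right]

/-! ### The Cauchy transform of a compactly supported function -/

/-- The Cauchy transform of `c`. -/
noncomputable def cauchyTransform (c : ℂ → ℂ) (z : ℂ) : ℂ := ∫ w, c w / (w - z)

open MeasureTheory in
theorem aestronglyMeasurable_div {c d : ℂ → ℂ} (hc : Integrable c) (hd : Measurable d) :
    AEStronglyMeasurable (fun w => c w / d w) volume := by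
  simp_rw [div_eq_mul_inv]
  exact hc.aestronglyMeasurable.mul hd.inv.aestronglyMeasurable

open MeasureTheory Set in
theorem cauchyTransform_differentiableAt {c : ℂ → ℂ} (hc : Integrable c) {S : Set ℂ}
    (hS : IsClosed S) (hcS : ∀ w, w ∉ S → c w = 0) {z : ℂ} (hz : z ∉ S) :
    DifferentiableAt ℂ (cauchyTransform c) z := by
  obtain ⟨ε, hε, hball⟩ := Metric.isOpen_iff.1 hS.isOpen_compl z hz
  have hfar : ∀ x ∈ Metric.ball z (ε / 2), ∀ w ∈ S, ε / 2 ≤ ‖w - x‖ := by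
    intro x hx w hw
    by_contra h
    push Not at h
    refine hball ?_ hw
    rw [Metric.mem_ball, dist_eq_norm] at hx ⊢
    calc ‖w - z‖ = ‖(w - x) + (x - z)‖ := by ring_nf
      _ ≤ ‖w - x‖ + ‖x - z‖ := norm_add_le _ _
      _ < ε := by linarith
  have hmeas : ∀ x : ℂ, AEStronglyMeasurable (fun w => c w / (w - x)) volume := fun x =>
    aestronglyMeasurable_div hc (by fun_prop)
  have hbd : ∀ x ∈ Metric.ball z (ε / 2), ∀ w, ‖c w / (w - x)‖ ≤ ‖c w‖ * (ε / 2)⁻¹ := by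
    intro x hx w
    by_cases hw : w ∈ S
    · rw [norm_div, div_eq_mul_inv]
      have := hfar x hx w hw
      gcongr
    · simp [hcS w hw]
  have hzb : z ∈ Metric.ball z (ε / 2) := Metric.mem_ball_self (by positivity)
  refine (hasDerivAt_integral_of_dominated_loc_of_deriv_le (μ := volume)
    (F' := fun x w => c w / (w - x) ^ 2) (bound := fun w => ‖c w‖ * ((ε / 2) ^ 2)⁻¹)
    (Metric.ball_mem_nhds z (half_pos hε)) ?_ ?_ ?_ ?_ ?_ ?_).2.differentiableAt
  · exact Eventually.of_forall hmeas
  · exact (hc.norm.mul_const _).mono' (hmeas z) (Eventually.of_forall (hbd z hzb))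
  · exact aestronglyMeasurable_div hc (by fun_prop)
  · refine Eventually.of_forall fun w x hx => ?_
    by_cases hw : w ∈ S
    · rw [norm_div, div_eq_mul_inv, norm_pow]
      have := hfar x hx w hw
      gcongr
    · simp [hcS w hw]
  · exact hc.norm.mul_const _
  · refine Eventually.of_forall fun w x hx => ?_
    by_cases hw : w ∈ S
    · have h0 : w - x ≠ 0 := by
        rw [← norm_pos_iff]
        exact lt_of_lt_of_le (by positivity) (hfar x hx w hw)
      have h1 : HasDerivAt (fun x : ℂ => w - x) (-1) x := by
        simpa using (hasDerivAt_id x).const_sub w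
      convert! (h1.inv h0).const_mul (c w) using 1
      ring
    · simpa [hcS w hw] using hasDerivAt_const x (0 : ℂ)

open MeasureTheory Set in
theorem cauchyTransform_analyticAt {c : ℂ → ℂ} (hc : Integrable c) {S : Set ℂ}
    (hS : IsClosed S) (hcS : ∀ w, w ∉ S → c w = 0) {z : ℂ} (hz : z ∉ S) :
    AnalyticAt ℂ (cauchyTransform c) z :=
  Complex.analyticAt_iff_eventually_differentiableAt.2 <| by
    filter_upwards [hS.isOpen_compl.mem_nhds hz] with w hw
    exact cauchyTransform_differentiableAt hc hS hcS hw

open MeasureTheory Set in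
/-- The Cauchy transform of a compactly supported function is holomorphic at infinity. -/
theorem exists_analyticAt_cauchyTransform_inv {c : ℂ → ℂ} (hc : Integrable c) {S : Set ℂ}
    (hS : IsCompact S) (hcS : ∀ w, w ∉ S → c w = 0) :
    ∃ u : ℂ → ℂ, AnalyticAt ℂ u 0 ∧ ∀ w, w ≠ 0 → u w = cauchyTransform c w⁻¹ := by
  classical
  obtain ⟨R, hR⟩ := hS.isBounded.subset_closedBall 0
  set u : ℂ → ℂ := Function.update (fun w => cauchyTransform c w⁻¹) 0 0 with hu
  have hval : ∀ w, w ≠ 0 → u w = cauchyTransform c w⁻¹ := fun w hw => by simp [hu, hw]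
  have htend : Tendsto (fun w : ℂ => ‖w⁻¹‖) (𝓝[≠] 0) atTop := by
    simpa using tendsto_norm_inv_nhdsNE_zero_atTop (α := ℂ)
  refine ⟨u, Complex.analyticAt_of_differentiable_on_punctured_nhds_of_continuousAt ?_ ?_, hval⟩
  · filter_upwards [htend.eventually_gt_atTop R, self_mem_nhdsWithin] with w hw hw0
    have hw0' : w ≠ 0 := hw0
    have h1 : w⁻¹ ∉ S := fun h => by
      have := hR h
      rw [mem_closedBall_zero_iff] at this
      linarith
    have h2 := (cauchyTransform_differentiableAt hc hS.isClosed hcS h1).comp w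
      (differentiableAt_inv hw0')
    refine h2.congr_of_eventuallyEq ?_
    filter_upwards [isOpen_ne.mem_nhds hw0'] with v hv using hval v hv
  · have h0 : u 0 = 0 := by simp [hu]
    rw [continuousAt_iff_punctured_nhds, h0]
    have hb : ∀ᶠ w in 𝓝[≠] (0 : ℂ), ‖u w‖ ≤ (∫ v, ‖c v‖) * (‖w⁻¹‖ - R)⁻¹ := by
      filter_upwards [htend.eventually_gt_atTop R, self_mem_nhdsWithin] with w hw hw0
      rw [hval w hw0, ← integral_mul_const]
      refine norm_integral_le_of_norm_le (hc.norm.mul_const _) (Eventually.of_forall fun v => ?_)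
      by_cases hv : v ∈ S
      · have h1 : ‖v‖ ≤ R := by simpa using hR hv
        have h2 : ‖w⁻¹‖ - R ≤ ‖v - w⁻¹‖ := by
          have := norm_sub_norm_le w⁻¹ v
          rw [norm_sub_rev] at this
          linarith
        have h3 : 0 < ‖w⁻¹‖ - R := by linarith
        rw [norm_div, div_eq_mul_inv]
        gcongr
      · simp [hcS v hv]
    refine squeeze_zero_norm' hb ?_
    have h1 : Tendsto (fun w : ℂ => ‖w⁻¹‖ - R) (𝓝[≠] 0) atTop :=
      tendsto_atTop_add_const_right _ (-R) htend
    simpa using h1.inv_tendsto_atTop.const_mul (∫ v, ‖c v‖)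

open MeasureTheory Set in
/-- A holomorphic function near a compact set `K` is, near `K`, the Cauchy transform of a
continuous function with compact support away from `K`. -/
theorem exists_eq_cauchyTransform {K V : Set ℂ} (hK : IsCompact K) (hV : IsOpen V) (hKV : K ⊆ V)
    {u : ℂ → ℂ} (hu : ∀ z ∈ V, AnalyticAt ℂ u z) :
    ∃ (c : ℂ → ℂ) (W : Set ℂ), Continuous c ∧ HasCompactSupport c ∧ IsOpen W ∧ K ⊆ W ∧ W ⊆ V ∧
      (∀ z ∈ W, c z = 0) ∧ ∀ z ∈ W, u z = cauchyTransform c z := by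
  obtain ⟨L, hL, hKL, hLV⟩ := exists_compact_between hK hV hKV
  obtain ⟨χ, hχ0, hχ1, -⟩ := exists_contMDiffMap_zero_one_nhds_of_isClosed (n := 1)
    (modelWithCornersSelf ℝ ℂ) (s := (interior L)ᶜ) (t := K) isOpen_interior.isClosed_compl
    hK.isClosed (disjoint_compl_left_iff_subset.2 hKL)
  have hχd : ContDiff ℝ 1 χ := χ.contMDiff.contDiff
  obtain ⟨W₁, hW₁, hKW₁, hW₁χ⟩ := mem_nhdsSet_iff_exists.1 hχ1
  have hsuppχ : tsupport χ ⊆ L := by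
    refine closure_minimal (fun z hz => ?_) hL.isClosed
    by_contra h
    have h1 : z ∈ (interior L)ᶜ := fun h' => h (interior_subset h')
    exact hz (hχ0.self_of_nhdsSet z h1)
  set f : ℂ → ℂ := fun z => χ z * u z with hf
  have hsupp : tsupport f ⊆ tsupport χ := by
    refine closure_mono fun z hz => ?_
    rw [Function.mem_support] at hz ⊢
    intro h
    exact hz (by simp [hf, h])
  have hfc : HasCompactSupport f := hL.of_isClosed_subset (isClosed_tsupport f)
    (hsupp.trans hsuppχ)
  have hfd : ContDiff ℝ 1 f := by
    rw [contDiff_iff_contDiffAt]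
    intro z
    by_cases hz : z ∈ V
    · exact (Complex.ofRealCLM.contDiff.comp hχd).contDiffAt.mul
        ((hu z hz).contDiffAt.restrict_scalars ℝ)
    · have h1 : z ∉ tsupport f := fun h => hz (hLV (hsuppχ (hsupp h)))
      exact contDiffAt_const.congr_of_eventuallyEq (notMem_tsupport_iff_eventuallyEq.1 h1)
  have hpi : (Real.pi : ℂ) ≠ 0 := by exact_mod_cast Real.pi_ne_zero
  refine ⟨fun z => -(Real.pi : ℂ)⁻¹ * dbar f z, W₁ ∩ V, continuous_const.mul (continuous_dbar hfd),
    ?_, hW₁.inter hV, subset_inter hKW₁ hKV, inter_subset_right, ?_, ?_⟩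
  · refine HasCompactSupport.mul_left (hfc.of_isClosed_subset (isClosed_tsupport _)
      (tsupport_dbar_subset f))
  · intro z hz
    have h1 : f =ᶠ[𝓝 z] u := by
      filter_upwards [hW₁.mem_nhds hz.1] with w hw
      have : χ w = 1 := hW₁χ hw
      simp [hf, this]
    have h2 : DifferentiableAt ℂ f z :=
      (hu z hz.2).differentiableAt.congr_of_eventuallyEq h1
    simp [dbar_eq_zero_of_differentiableAt h2]
  · intro z hz
    have h1 : χ z = 1 := hW₁χ hz.1
    have h2 := cauchy_pompeiu hfd hfc z
    have h3 : f z = u z := by simp [hf, h1]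
    rw [cauchyTransform]
    simp_rw [mul_div_assoc]
    rw [integral_const_mul, h2, h3]
    field_simp

open MeasureTheory Set in
/-- The additive Cousin problem for a compact and a closed set in the plane, with a solution which
is holomorphic at infinity. The function is the Cauchy transform of some `c` whose support `E` is
disjoint from `K₁ ∩ K₂`, and `c` is the sum of a function that vanishes near `K₁` and one that
vanishes near `K₂`. -/
theorem additive_cousin {K₁ K₂ V : Set ℂ} (hK₁ : IsCompact K₁) (hK₂ : IsClosed K₂) (hV : IsOpen V)
    (hKV : K₁ ∩ K₂ ⊆ V) {u : ℂ → ℂ} (hu : ∀ z ∈ V, AnalyticAt ℂ u z) :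
    ∃ (V₁ V₂ W : Set ℂ) (u₁ u₂ : ℂ → ℂ), IsOpen V₁ ∧ IsOpen V₂ ∧ IsOpen W ∧ K₁ ⊆ V₁ ∧ K₂ ⊆ V₂ ∧
      K₁ ∩ K₂ ⊆ W ∧ W ⊆ V ∧ (∀ z ∈ V₁, AnalyticAt ℂ u₁ z) ∧ (∀ z ∈ V₂, AnalyticAt ℂ u₂ z) ∧
      (∃ v : ℂ → ℂ, AnalyticAt ℂ v 0 ∧ ∀ w, w ≠ 0 → v w = u₂ w⁻¹) ∧
      ∀ z ∈ W, u z = u₁ z + u₂ z := by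
  have hK : IsCompact (K₁ ∩ K₂) := hK₁.inter_right hK₂
  obtain ⟨c, W, hc, hcc, hW, hKW, hWV, hcW, hrep⟩ := exists_eq_cauchyTransform hK hV hKV hu
  set E := tsupport c with hE
  have hEW : E ∩ W = ∅ := by
    ext z
    simp only [mem_inter_iff, mem_empty_iff_false, iff_false, not_and]
    intro h1 h2
    refine notMem_tsupport_iff_eventuallyEq.2 ?_ h1
    filter_upwards [hW.mem_nhds h2] with w hw using hcW w hw
  have hdisj : Disjoint (E ∩ K₁) (E ∩ K₂) := by
    rw [disjoint_iff_inter_eq_empty, eq_empty_iff_forall_notMem]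
    rintro z ⟨⟨h1, h2⟩, -, h3⟩
    have : z ∈ E ∩ W := ⟨h1, hKW ⟨h2, h3⟩⟩
    rwa [hEW] at this
  obtain ⟨O₁, O₂, hO₁, hO₂, hEO₁, hEO₂, hO⟩ := SeparatedNhds.of_isCompact_isCompact
    (hcc.isCompact.inter_right hK₁.isClosed) (hcc.isCompact.inter_right hK₂) hdisj
  have hEc : IsCompact E := hcc.isCompact
  have hci : Integrable c := hc.integrable_of_hasCompactSupport hcc
  have hS₁ : IsClosed (E \ O₁) := hEc.isClosed.sdiff hO₁
  have hS₂ : IsCompact (E \ O₂) := hEc.diff hO₂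
  set c₁ : ℂ → ℂ := (E \ O₁).indicator c with hc₁
  set c₂ : ℂ → ℂ := ((E \ O₁)ᶜ).indicator c with hc₂
  have hc₁i : Integrable c₁ := hci.indicator hS₁.measurableSet
  have hc₂i : Integrable c₂ := hci.indicator hS₁.measurableSet.compl
  have hz₁ : ∀ w, w ∉ E \ O₁ → c₁ w = 0 := fun w hw => indicator_of_notMem hw _
  have hz₂ : ∀ w, w ∉ E \ O₂ → c₂ w = 0 := by
    intro w hw
    by_cases h1 : w ∈ E
    · have h2 : w ∈ O₂ := by
        by_contra h
        exact hw ⟨h1, h⟩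
      exact indicator_of_notMem (not_not.2 ⟨h1, fun h3 => (hO.le_bot ⟨h3, h2⟩ : False)⟩) _
    · have : c w = 0 := image_eq_zero_of_notMem_tsupport h1
      exact indicator_apply_eq_zero.2 fun _ => this
  refine ⟨(E \ O₁)ᶜ, (E \ O₂)ᶜ, W, cauchyTransform c₁, cauchyTransform c₂, hS₁.isOpen_compl,
    hS₂.isClosed.isOpen_compl, hW, ?_, ?_, hKW, hWV, ?_, ?_, ?_, ?_⟩
  · exact fun z hz h => h.2 (hEO₁ ⟨h.1, hz⟩)
  · exact fun z hz h => h.2 (hEO₂ ⟨h.1, hz⟩)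
  · exact fun z hz => cauchyTransform_analyticAt hc₁i hS₁ hz₁ hz
  · exact fun z hz => cauchyTransform_analyticAt hc₂i hS₂.isClosed hz₂ hz
  · exact exists_analyticAt_cauchyTransform_inv hc₂i hS₂ hz₂
  · intro z hz
    have hzE : z ∉ E := fun h => by
      have : z ∈ E ∩ W := ⟨h, hz⟩
      rwa [hEW] at this
    have hquot : ∀ c' : ℂ → ℂ, Integrable c' → (∀ w, w ∉ E → c' w = 0) →
        Integrable fun w => c' w / (w - z) := by
      intro c' hc' hc'0
      obtain ⟨ε, hε, hball⟩ := Metric.isOpen_iff.1 hEc.isClosed.isOpen_compl z hzE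
      refine (hc'.norm.mul_const ε⁻¹).mono' (aestronglyMeasurable_div hc' (by fun_prop))
        (Eventually.of_forall fun w => ?_)
      by_cases hw : w ∈ E
      · have : ε ≤ ‖w - z‖ := by
          by_contra h
          exact hball (by rw [Metric.mem_ball, dist_eq_norm]; exact not_le.1 h) hw
        rw [norm_div, div_eq_mul_inv]
        gcongr
      · simp [hc'0 w hw]
    rw [hrep z hz, cauchyTransform, cauchyTransform, cauchyTransform, ← integral_add
      (hquot c₁ hc₁i fun w hw => hz₁ w fun h => hw h.1)
      (hquot c₂ hc₂i fun w hw => hz₂ w fun h => hw h.1)]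
    refine integral_congr_ae (Eventually.of_forall fun w => ?_)
    have := congrFun (indicator_self_add_compl (E \ O₁) c) w
    simp only [Pi.add_apply] at this
    simp only [← add_div, hc₁, hc₂, this]

/-! ### Germs of nonzero meromorphic functions -/

/-- `f` is meromorphic at `z`, and not identically zero near `z`. -/
def MeromorphicNonzeroAt (f : ℂ → ℂ) (z : ℂ) : Prop :=
  MeromorphicAt f z ∧ meromorphicOrderAt f z ≠ ⊤

namespace MeromorphicNonzeroAt

variable {f g : ℂ → ℂ} {z : ℂ}

theorem congr (hf : MeromorphicNonzeroAt f z) (h : f =ᶠ[𝓝[≠] z] g) : MeromorphicNonzeroAt g z :=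
  ⟨hf.1.congr h, by rw [← meromorphicOrderAt_congr h]; exact hf.2⟩

theorem mul (hf : MeromorphicNonzeroAt f z) (hg : MeromorphicNonzeroAt g z) :
    MeromorphicNonzeroAt (fun w => f w * g w) z :=
  ⟨hf.1.mul hg.1, by
    have := meromorphicOrderAt_mul hf.1 hg.1
    rw [show (fun w => f w * g w) = f * g from rfl, this]
    exact WithTop.add_ne_top.2 ⟨hf.2, hg.2⟩⟩

theorem inv (hf : MeromorphicNonzeroAt f z) : MeromorphicNonzeroAt (fun w => (f w)⁻¹) z :=
  ⟨hf.1.inv, by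
    rw [show (fun w => (f w)⁻¹) = f⁻¹ from rfl, meromorphicOrderAt_inv]
    lift meromorphicOrderAt f z to ℤ using hf.2 with n
    exact WithTop.coe_ne_top⟩

theorem eventually_ne_zero (hf : MeromorphicNonzeroAt f z) : ∀ᶠ w in 𝓝[≠] z, f w ≠ 0 :=
  (meromorphicOrderAt_ne_top_iff_eventually_ne_zero hf.1).1 hf.2

theorem of_analyticAt (hf : AnalyticAt ℂ f z) (h0 : f z ≠ 0) : MeromorphicNonzeroAt f z :=
  ⟨hf.meromorphicAt, (meromorphicOrderAt_ne_top_iff_eventually_ne_zero hf.meromorphicAt).2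
    ((hf.continuousAt.eventually_ne h0).filter_mono nhdsWithin_le_nhds)⟩

/-- A meromorphic function vanishing nowhere near `z`, except maybe at `z`. -/
theorem of_eventually_ne_zero (hf : MeromorphicAt f z) (h0 : ∀ᶠ w in 𝓝[≠] z, f w ≠ 0) :
    MeromorphicNonzeroAt f z :=
  ⟨hf, (meromorphicOrderAt_ne_top_iff_eventually_ne_zero hf).2 h0⟩

theorem comp_analyticAt {u : ℂ} (hf : MeromorphicNonzeroAt f (g u)) (hg : AnalyticAt ℂ g u)
    (hnc : ¬ EventuallyConst g (𝓝 u)) : MeromorphicNonzeroAt (f ∘ g) u := by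
  refine of_eventually_ne_zero (hf.1.comp_analyticAt hg) ?_
  exact hg.map_nhdsNE hnc hf.eventually_ne_zero

theorem comp_of_deriv_ne_zero {u : ℂ} (hf : MeromorphicNonzeroAt f (g u)) (hg : AnalyticAt ℂ g u)
    (hg' : deriv g u ≠ 0) : MeromorphicNonzeroAt (f ∘ g) u :=
  ⟨(meromorphicAt_comp_iff_of_deriv_ne_zero hg hg').2 hf.1, by
    rw [meromorphicOrderAt_comp_of_deriv_ne_zero hg hg']; exact hf.2⟩

/-- Near `z`, a nonzero meromorphic function has no zeros and poles, except maybe at `z`. -/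
theorem eventually_analyticAt (hf : MeromorphicNonzeroAt f z) :
    ∀ᶠ w in 𝓝[≠] z, AnalyticAt ℂ f w ∧ f w ≠ 0 :=
  hf.1.eventually_analyticAt.and hf.eventually_ne_zero

end MeromorphicNonzeroAt

/-! ### The multiplicative Cousin problem -/

open MeasureTheory Set in
/-- **Runge's theorem**: a holomorphic function near a compact set `K` is uniformly close, on a
neighbourhood of `K`, to a meromorphic function on the plane. -/
theorem exists_meromorphic_approx {K V : Set ℂ} (hK : IsCompact K) (hV : IsOpen V) (hKV : K ⊆ V)
    {u : ℂ → ℂ} (hu : ∀ z ∈ V, AnalyticAt ℂ u z) {ε : ℝ} (hε : 0 < ε) :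
    ∃ (W : Set ℂ) (r : ℂ → ℂ), IsOpen W ∧ K ⊆ W ∧ W ⊆ V ∧ Meromorphic r ∧
      (∀ z ∈ W, AnalyticAt ℂ r z) ∧ ∀ z ∈ W, ‖u z - r z‖ < ε := by
  obtain ⟨c, W, hc, hcc, hW, hKW, hWV, hcW, hrep⟩ := exists_eq_cauchyTransform hK hV hKV hu
  obtain ⟨L, hL, hKL, hLW⟩ := exists_compact_between hK hW hKW
  have : CompactSpace L := isCompact_iff_compactSpace.1 hL
  have hcont : Continuous fun p : ℂ × L => c p.1 / (p.1 - p.2) := by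
    rw [continuous_iff_continuousAt]
    rintro ⟨w, z, hz⟩
    by_cases hw : w ∈ W
    · refine (continuousAt_const (y := (0 : ℂ))).congr ?_
      filter_upwards [(hW.preimage continuous_fst).mem_nhds (show (w, (⟨z, hz⟩ : L)).1 ∈ W from hw)]
        with p hp
      rw [hcW p.1 hp, zero_div]
    · have h1 : w - z ≠ 0 := sub_ne_zero.2 fun h => hw (h ▸ hLW hz)
      exact ContinuousAt.div (by fun_prop) (by fun_prop) h1
  set Φ : C(ℂ, C(L, ℂ)) := ContinuousMap.curry ⟨_, hcont⟩ with hΦ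
  have hΦs : HasCompactSupport Φ := by
    refine hcc.mono fun w hw => ?_
    rw [Function.mem_support] at hw ⊢
    intro h
    refine hw ?_
    ext z
    simp [hΦ, h]
  have hΦi : Integrable Φ := Φ.continuous.integrable_of_hasCompactSupport hΦs
  have happ : ∀ z : L, (∫ w, Φ w) z = cauchyTransform c z := by
    intro z
    rw [ContinuousMap.integral_apply hΦi]
    rfl
  -- the integral is approximated by linear combinations of the functions `c w / (w - z)`
  set S : Submodule ℂ C(L, ℂ) := Submodule.span ℂ (Set.range Φ) with hS
  have hmem : (∫ w, Φ w) ∈ S.topologicalClosure := by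
    have hcl : IsClosed (S.topologicalClosure : Set C(L, ℂ)) := S.isClosed_topologicalClosure
    rw [← Submodule.Quotient.mk_eq_zero]
    have h1 := (S.topologicalClosure.mkQL.integral_comp_comm hΦi)
    have h2 : ∀ w, S.topologicalClosure.mkQL (Φ w) = 0 := fun w =>
      (Submodule.Quotient.mk_eq_zero _).2
        (S.le_topologicalClosure (Submodule.subset_span (Set.mem_range_self w)))
    simp only [h2, integral_zero] at h1
    exact h1.symm
  obtain ⟨φ, hφS, hφ⟩ := Metric.mem_closure_iff.1 hmem ε hε
  have hspan : ∀ ψ ∈ S, ∃ r : ℂ → ℂ, Meromorphic r ∧ (∀ z ∈ W, AnalyticAt ℂ r z) ∧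
      ∀ z : L, ψ z = r z := by
    intro ψ hψ
    induction hψ using Submodule.span_induction with
    | mem ψ h =>
      obtain ⟨w, rfl⟩ := h
      refine ⟨fun z => c w / (w - z), fun z => ?_, fun z hz => ?_, fun z => rfl⟩
      · exact (MeromorphicAt.const _ _).fun_div ((MeromorphicAt.const _ _).fun_sub (.id _))
      · by_cases hw : w ∈ W
        · simp only [hcW w hw, zero_div]
          exact analyticAt_const
        · exact analyticAt_const.div (analyticAt_const.sub analyticAt_id)
            (sub_ne_zero.2 fun h => hw (h ▸ hz))
    | zero => exact ⟨fun _ => 0, fun z => .const _ _, fun _ _ => analyticAt_const, fun _ => rfl⟩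
    | add ψ₁ ψ₂ _ _ h₁ h₂ =>
      obtain ⟨r₁, hm₁, ha₁, he₁⟩ := h₁
      obtain ⟨r₂, hm₂, ha₂, he₂⟩ := h₂
      exact ⟨fun z => r₁ z + r₂ z, fun z => (hm₁ z).fun_add (hm₂ z),
        fun z hz => (ha₁ z hz).fun_add (ha₂ z hz), fun z => by simp [he₁, he₂]⟩
    | smul a ψ _ h =>
      obtain ⟨r, hm, ha, he⟩ := h
      exact ⟨fun z => a * r z, fun z => (MeromorphicAt.const _ _).fun_mul (hm z),
        fun z hz => analyticAt_const.fun_mul (ha z hz), fun z => by simp [he]⟩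
  obtain ⟨r, hrm, hra, hre⟩ := hspan φ hφS
  refine ⟨interior L, r, isOpen_interior, hKL, (interior_subset.trans hLW).trans hWV, hrm,
    fun z hz => hra z (hLW (interior_subset hz)), fun z hz => ?_⟩
  have h1 := (ContinuousMap.dist_apply_le_dist (f := ∫ w, Φ w) (g := φ)
    ⟨z, interior_subset hz⟩).trans_lt hφ
  rwa [happ, hre, dist_eq_norm, ← hrep z (hLW (interior_subset hz))] at h1

open Set in
theorem Meromorphic.nonzeroAt_of_exists {r : ℂ → ℂ} (hr : Meromorphic r) {z₀ : ℂ}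
    (h : MeromorphicNonzeroAt r z₀) (z : ℂ) : MeromorphicNonzeroAt r z :=
  ⟨hr z, MeromorphicOn.meromorphicOrderAt_ne_top_of_isPreconnected (U := univ)
    (fun z _ => hr z) isPreconnected_univ (mem_univ z₀) (mem_univ z) h.2⟩

open Set in
/-- A nowhere vanishing holomorphic function near a compact set is, up to a meromorphic function on
the plane, an exponential. -/
theorem exists_eq_mul_exp_of_analyticAt {K V : Set ℂ} (hK : IsCompact K) (hV : IsOpen V)
    (hKV : K ⊆ V) {g : ℂ → ℂ} (hg : ∀ z ∈ V, AnalyticAt ℂ g z) (hg0 : ∀ z ∈ V, g z ≠ 0) :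
    ∃ (W : Set ℂ) (r u : ℂ → ℂ), IsOpen W ∧ K ⊆ W ∧ W ⊆ V ∧ (∀ z, MeromorphicNonzeroAt r z) ∧
      (∀ z ∈ W, AnalyticAt ℂ u z) ∧ ∀ z ∈ W, g z = r z * Complex.exp (u z) := by
  rcases K.eq_empty_or_nonempty with rfl | ⟨z₀, hz₀⟩
  · exact ⟨∅, fun _ => 1, fun _ => 0, isOpen_empty, subset_rfl, empty_subset _,
      fun z => .of_analyticAt analyticAt_const one_ne_zero, by simp, by simp⟩
  obtain ⟨δ, hδ, hmin⟩ : ∃ δ > 0, ∀ z ∈ K, δ < ‖g z‖ := by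
    obtain ⟨z₁, hz₁, hmin⟩ := hK.exists_isMinOn ⟨z₀, hz₀⟩ (f := fun z => ‖g z‖)
      (fun z hz => (hg z (hKV hz)).continuousAt.norm.continuousWithinAt)
    have h1 : 0 < ‖g z₁‖ := norm_pos_iff.2 (hg0 z₁ (hKV hz₁))
    exact ⟨‖g z₁‖ / 2, half_pos h1, fun z hz => (half_lt_self h1).trans_le (hmin hz)⟩
  have hcont : ContinuousOn g V := fun z hz => (hg z hz).continuousAt.continuousWithinAt
  have hV' : IsOpen (V ∩ {z | δ < ‖g z‖}) :=
    hcont.norm.isOpen_inter_preimage hV isOpen_Ioi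
  obtain ⟨W, r, hW, hKW, hWV, hrm, hra, hrg⟩ := exists_meromorphic_approx hK hV'
    (fun z hz => ⟨hKV hz, hmin z hz⟩) (fun z hz => hg z hz.1) hδ
  -- `g⁻¹ r` takes its values in the disc of radius `1` about `1`
  have hq : ∀ z ∈ W, ‖r z / g z - 1‖ < 1 := by
    intro z hz
    have h1 : δ < ‖g z‖ := (hWV hz).2
    have h2 := hg0 z (hWV hz).1
    rw [show r z / g z - 1 = -((g z - r z) / g z) by field_simp; ring, norm_neg, norm_div,
      div_lt_one (norm_pos_iff.2 h2)]
    exact (hrg z hz).trans h1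
  have hslit : ∀ z ∈ W, r z / g z ∈ Complex.slitPlane := by
    intro z hz
    have := Complex.mem_slitPlane_of_norm_lt_one (hq z hz)
    rwa [add_sub_cancel] at this
  have hr0 : ∀ z ∈ W, r z ≠ 0 := fun z hz h => by
    have := hslit z hz
    simp [h] at this
  refine ⟨W, r, fun z => -Complex.log (r z / g z), hW, hKW, hWV.trans inter_subset_left,
    hrm.nonzeroAt_of_exists (.of_analyticAt (hra z₀ (hKW hz₀)) (hr0 z₀ (hKW hz₀))), ?_, ?_⟩
  · exact fun z hz => (((hra z hz).div (hg z (hWV hz).1) (hg0 z (hWV hz).1)).clog (hslit z hz)).neg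
  · intro z hz
    have h1 := hr0 z hz
    have h2 := hg0 z (hWV hz).1
    rw [Complex.exp_neg, Complex.exp_log (div_ne_zero h1 h2)]
    field_simp

open Set in
/-- A nonzero meromorphic function near a compact set is, up to a meromorphic function on
the plane, an exponential. -/
theorem exists_eq_mul_exp {K V : Set ℂ} (hK : IsCompact K) (hV : IsOpen V)
    (hKV : K ⊆ V) {f : ℂ → ℂ} (hf : ∀ z ∈ V, MeromorphicNonzeroAt f z) :
    ∃ (W : Set ℂ) (r u : ℂ → ℂ), IsOpen W ∧ K ⊆ W ∧ W ⊆ V ∧ (∀ z, MeromorphicNonzeroAt r z) ∧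
      (∀ z ∈ W, AnalyticAt ℂ u z) ∧
      ∀ z ∈ W, ∀ᶠ w in 𝓝[≠] z, f w = r w * Complex.exp (u w) := by
  obtain ⟨L, hL, hKL, hLV⟩ := exists_compact_between hK hV hKV
  have hfL : MeromorphicOn f L := fun z hz => (hf z (hLV hz)).1
  obtain ⟨g, hga, hg0, hfg⟩ := hfL.extract_zeros_poles (fun z => (hf z (hLV z.2)).2)
    ((MeromorphicOn.divisor f L).finiteSupport hL)
  obtain ⟨W, r, u, hW, hKW, hWV, hr, hu, he⟩ := exists_eq_mul_exp_of_analyticAt hK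
    isOpen_interior hKL (fun z hz => hga z (interior_subset hz))
    (fun z hz => hg0 ⟨z, interior_subset hz⟩)
  set q : ℂ → ℂ := ∏ᶠ v, (fun x => x - v) ^ MeromorphicOn.divisor f L v with hq
  refine ⟨W, fun z => q z * r z, u, hW, hKW, (hWV.trans interior_subset).trans hLV,
    fun z => MeromorphicNonzeroAt.mul ⟨?_, ?_⟩ (hr z), hu, fun z hz => ?_⟩
  · exact (Function.FactorizedRational.meromorphicNFOn_univ _ (mem_univ z)).meromorphicAt
  · exact Function.FactorizedRational.meromorphicOrderAt_ne_top _
  · have hzL : L ∈ 𝓝 z := mem_interior_iff_mem_nhds.1 (hWV hz)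
    have h1 : ∀ᶠ w in 𝓝[≠] z, f w = (q • g) w := by
      have h2 := mem_codiscreteWithin.1 hfg z (interior_subset (hWV hz))
      rw [disjoint_principal_right] at h2
      filter_upwards [h2, mem_nhdsWithin_of_mem_nhds hzL] with w hw hwL
      by_contra h
      exact hw ⟨hwL, h⟩
    filter_upwards [h1, mem_nhdsWithin_of_mem_nhds (hW.mem_nhds hz)] with w hw hwW
    rw [hw, Pi.smul_apply', smul_eq_mul, he w hwW, mul_assoc]

open Set in
/-- The multiplicative Cousin problem for a compact and a closed set in the plane, with a solution
which is holomorphic at infinity on the side of the closed set. -/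
theorem multiplicative_cousin {K₁ K₂ V : Set ℂ} (hK₁ : IsCompact K₁) (hK₂ : IsClosed K₂)
    (hV : IsOpen V) (hKV : K₁ ∩ K₂ ⊆ V) {f : ℂ → ℂ} (hf : ∀ z ∈ V, MeromorphicNonzeroAt f z) :
    ∃ (V₁ V₂ : Set ℂ) (f₁ f₂ : ℂ → ℂ), IsOpen V₁ ∧ IsOpen V₂ ∧ K₁ ⊆ V₁ ∧ K₂ ⊆ V₂ ∧ V₁ ∩ V₂ ⊆ V ∧
      (∀ z ∈ V₁, MeromorphicNonzeroAt f₁ z) ∧ (∀ z ∈ V₂, MeromorphicNonzeroAt f₂ z) ∧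
      MeromorphicNonzeroAt (fun w => f₂ w⁻¹) 0 ∧
      ∀ z ∈ V₁ ∩ V₂, ∀ᶠ w in 𝓝[≠] z, f₁ w = f w * f₂ w := by
  obtain ⟨W, r, u, hW, hKW, hWV, hr, hu, he⟩ := exists_eq_mul_exp (hK₁.inter_right hK₂) hV hKV hf
  obtain ⟨V₁, V₂, W', u₁, u₂, hV₁, hV₂, hW', hKV₁, hKV₂, hKW', hW'W, hu₁, hu₂, ⟨v, hv, hvu⟩, heq⟩ :=
    additive_cousin hK₁ hK₂ hW hKW hu
  obtain ⟨O₁, O₂, hO₁, hO₂, hKO₁, hKO₂, hO⟩ : SeparatedNhds (K₁ \ W') (K₂ \ W') := by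
    refine SeparatedNhds.of_isCompact_isClosed (hK₁.diff hW') (hK₂.sdiff hW') ?_
    rw [disjoint_iff_inter_eq_empty, eq_empty_iff_forall_notMem]
    rintro z ⟨⟨h1, h2⟩, h3, -⟩
    exact h2 (hKW' ⟨h1, h3⟩)
  have hint : ∀ z ∈ (V₁ ∩ (O₁ ∪ W')) ∩ (V₂ ∩ (O₂ ∪ W')), z ∈ W' := by
    rintro z ⟨⟨-, h1⟩, -, h2⟩
    rcases h1 with h1 | h1
    · rcases h2 with h2 | h2
      · exact (hO.le_bot ⟨h1, h2⟩ : False).elim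
      · exact h2
    · exact h1
  refine ⟨V₁ ∩ (O₁ ∪ W'), V₂ ∩ (O₂ ∪ W'), fun z => r z * Complex.exp (u₁ z),
    fun z => Complex.exp (-u₂ z), hV₁.inter (hO₁.union hW'), hV₂.inter (hO₂.union hW'), ?_, ?_,
    fun z hz => hWV (hW'W (hint z hz)), ?_, ?_, ?_, ?_⟩
  · intro z hz
    refine ⟨hKV₁ hz, ?_⟩
    by_cases h : z ∈ W'
    · exact Or.inr h
    · exact Or.inl (hKO₁ ⟨hz, h⟩)
  · intro z hz
    refine ⟨hKV₂ hz, ?_⟩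
    by_cases h : z ∈ W'
    · exact Or.inr h
    · exact Or.inl (hKO₂ ⟨hz, h⟩)
  · exact fun z hz => (hr z).mul (.of_analyticAt (hu₁ z hz.1).cexp (Complex.exp_ne_zero _))
  · exact fun z hz => .of_analyticAt (hu₂ z hz.1).neg.cexp (Complex.exp_ne_zero _)
  · refine (MeromorphicNonzeroAt.of_analyticAt hv.neg.cexp (Complex.exp_ne_zero _)).congr ?_
    filter_upwards [self_mem_nhdsWithin] with w hw
    simp [hvu w hw]
  · intro z hz
    filter_upwards [he z (hW'W (hint z hz)),
      mem_nhdsWithin_of_mem_nhds (hW'.mem_nhds (hint z hz))] with w hw hwW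
    rw [hw, heq w hwW, mul_assoc, ← Complex.exp_add]
    congr 2
    ring

/-! ### Orders of nonzero meromorphic germs -/

/-- The order of a nonzero meromorphic germ, as an integer. -/
noncomputable def intOrderAt (f : ℂ → ℂ) (z : ℂ) : ℤ := (meromorphicOrderAt f z).untop₀

theorem intOrderAt_congr {f g : ℂ → ℂ} {z : ℂ} (h : f =ᶠ[𝓝[≠] z] g) :
    intOrderAt f z = intOrderAt g z := by
  rw [intOrderAt, intOrderAt, meromorphicOrderAt_congr h]

theorem intOrderAt_comp_of_deriv_ne_zero {f g : ℂ → ℂ} {z : ℂ} (hg : AnalyticAt ℂ g z)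
    (hg' : deriv g z ≠ 0) : intOrderAt (f ∘ g) z = intOrderAt f (g z) := by
  rw [intOrderAt, intOrderAt, meromorphicOrderAt_comp_of_deriv_ne_zero hg hg']

theorem intOrderAt_of_analyticAt {f : ℂ → ℂ} {z : ℂ} (hf : AnalyticAt ℂ f z) (h0 : f z ≠ 0) :
    intOrderAt f z = 0 := by
  rw [intOrderAt, hf.meromorphicOrderAt_eq, hf.analyticOrderAt_eq_zero.2 h0]
  rfl

namespace MeromorphicNonzeroAt

variable {f g : ℂ → ℂ} {z : ℂ}

theorem coe_intOrderAt (hf : MeromorphicNonzeroAt f z) :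
    (intOrderAt f z : WithTop ℤ) = meromorphicOrderAt f z :=
  WithTop.coe_untop₀_of_ne_top hf.2

theorem intOrderAt_mul (hf : MeromorphicNonzeroAt f z) (hg : MeromorphicNonzeroAt g z) :
    intOrderAt (fun w => f w * g w) z = intOrderAt f z + intOrderAt g z := by
  have h := (hf.mul hg).coe_intOrderAt
  rw [show (fun w => f w * g w) = f * g from rfl, meromorphicOrderAt_mul hf.1 hg.1,
    ← hf.coe_intOrderAt, ← hg.coe_intOrderAt] at h
  exact_mod_cast h

theorem intOrderAt_inv (hf : MeromorphicNonzeroAt f z) :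
    intOrderAt (fun w => (f w)⁻¹) z = -intOrderAt f z := by
  have h := hf.inv.coe_intOrderAt
  rw [show (fun w => (f w)⁻¹) = f⁻¹ from rfl, meromorphicOrderAt_inv, ← hf.coe_intOrderAt] at h
  exact_mod_cast h

theorem zpow (hf : MeromorphicNonzeroAt f z) (n : ℤ) :
    MeromorphicNonzeroAt (fun w => f w ^ n) z :=
  of_eventually_ne_zero (hf.1.zpow n) <| by
    filter_upwards [hf.eventually_ne_zero] with w hw using zpow_ne_zero n hw

theorem intOrderAt_zpow (hf : MeromorphicNonzeroAt f z) (n : ℤ) :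
    intOrderAt (fun w => f w ^ n) z = n * intOrderAt f z := by
  have h := (hf.zpow n).coe_intOrderAt
  rw [show (fun w => f w ^ n) = f ^ n from rfl, meromorphicOrderAt_zpow hf.1,
    ← hf.coe_intOrderAt] at h
  exact_mod_cast h

theorem prod {ι : Type*} (s : Finset ι) {F : ι → ℂ → ℂ} (hF : ∀ i, MeromorphicNonzeroAt (F i) z) :
    MeromorphicNonzeroAt (fun w => ∏ i ∈ s, F i w) z ∧
      intOrderAt (fun w => ∏ i ∈ s, F i w) z = ∑ i ∈ s, intOrderAt (F i) z := by
  classical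
  induction s using Finset.induction with
  | empty =>
    simp only [Finset.prod_empty, Finset.sum_empty]
    exact ⟨.of_analyticAt analyticAt_const one_ne_zero,
      intOrderAt_of_analyticAt analyticAt_const one_ne_zero⟩
  | insert a s ha hs =>
    simp only [Finset.prod_insert ha, Finset.sum_insert ha]
    exact ⟨(hF a).mul hs.1, by rw [(hF a).intOrderAt_mul hs.1, hs.2]⟩

theorem not_eventuallyConst (hg : MeromorphicNonzeroAt g z) (h0 : g z = 0) :
    ¬ EventuallyConst g (𝓝 z) := by
  intro h
  obtain ⟨c, hc⟩ := eventuallyConst_iff_exists_eventuallyEq.1 h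
  have h1 : c = 0 := by rw [← hc.eq_of_nhds, h0]
  obtain ⟨w, hw1, hw2⟩ :=
    ((hc.filter_mono nhdsWithin_le_nhds).and hg.eventually_ne_zero).exists
  exact hw2 (hw1.trans h1)

/-- Orders are multiplied by the order of `g` under composition with `g`. -/
theorem intOrderAt_comp (hg : MeromorphicNonzeroAt g z) (hga : AnalyticAt ℂ g z) (h0 : g z = 0)
    (hf : MeromorphicNonzeroAt f 0) :
    intOrderAt (f ∘ g) z = intOrderAt f 0 * intOrderAt g z := by
  have hnc := hg.not_eventuallyConst h0
  have hf' : MeromorphicNonzeroAt f (g z) := h0 ▸ hf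
  have h := (hf'.comp_analyticAt hga hnc).coe_intOrderAt
  rw [hf'.1.meromorphicOrderAt_comp hga hnc, ← hf'.coe_intOrderAt] at h
  simp only [h0, sub_zero] at h
  rw [← hga.meromorphicOrderAt_eq, ← hg.coe_intOrderAt] at h
  exact_mod_cast h

end MeromorphicNonzeroAt

/-- Meromorphy descends along a nonconstant holomorphic map. -/
theorem MeromorphicNonzeroAt.of_comp {f g : ℂ → ℂ} {z : ℂ} (hga : AnalyticAt ℂ g z)
    (hg : MeromorphicNonzeroAt g z) (h0 : g z = 0) (hf : MeromorphicNonzeroAt (f ∘ g) z) :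
    MeromorphicNonzeroAt f 0 := by
  have hnc := hg.not_eventuallyConst h0
  have hopen : 𝓝 (0 : ℂ) ≤ map g (𝓝 z) := by
    have := hga.eventually_constant_or_nhds_le_map_nhds.resolve_left fun h =>
      hnc (eventuallyConst_iff_exists_eventuallyEq.2 ⟨g z, h⟩)
    rwa [h0] at this
  have hopen' : 𝓝[≠] (0 : ℂ) ≤ map g (𝓝[≠] z) := by
    intro s hs
    rw [mem_map, mem_nhdsWithin_iff_eventually] at hs
    rw [mem_nhdsWithin_iff_eventually]
    have : g '' {w | w ≠ z → w ∈ g ⁻¹' s} ∈ 𝓝 (0 : ℂ) := hopen (mem_map.2 (by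
      filter_upwards [hs] with w hw using ⟨w, hw, rfl⟩))
    filter_upwards [this]
    rintro _ ⟨w, hw, rfl⟩ hgw
    exact hw fun h => hgw (by rw [h, h0]; rfl)
  have hder : ∀ᶠ w in 𝓝[≠] z, deriv g w ≠ 0 := by
    rcases hga.deriv.eventually_eq_zero_or_eventually_ne_zero with h | h
    · exfalso
      refine hnc ?_
      obtain ⟨ε, hε, hb⟩ := Metric.eventually_nhds_iff_ball.1 (h.and hga.eventually_analyticAt)
      rw [eventuallyConst_iff_exists_eventuallyEq]
      refine ⟨g z, ?_⟩
      filter_upwards [Metric.ball_mem_nhds z hε] with w hw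
      exact (convex_ball z ε).is_const_of_fderivWithin_eq_zero (𝕜 := ℂ) (f := g)
        (fun v hv => (hb v hv).2.differentiableAt.differentiableWithinAt)
        (fun v hv => by
          rw [fderivWithin_of_isOpen Metric.isOpen_ball hv]
          ext
          simpa using (hb v hv).1) hw (Metric.mem_ball_self hε)
    · exact h
  have hfan : ∀ᶠ w in 𝓝[≠] (0 : ℂ), AnalyticAt ℂ f w ∧ f w ≠ 0 := by
    refine hopen' (mem_map.2 ?_)
    filter_upwards [hf.eventually_analyticAt, hder,
      hga.eventually_analyticAt.filter_mono nhdsWithin_le_nhds] with w h1 h2 h3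
    exact ⟨(analyticAt_comp_iff_of_deriv_ne_zero h3 h2).1 h1.1, h1.2⟩
  refine .of_eventually_ne_zero ?_ (hfan.mono fun _ h => h.2)
  -- a power of the coordinate, times `f`, tends to zero
  set n : ℕ := (1 - intOrderAt (f ∘ g) z).toNat with hn
  have hgpos : 1 ≤ intOrderAt g z := by
    have h1 : 0 < meromorphicOrderAt g z := by
      rw [← tendsto_zero_iff_meromorphicOrderAt_pos hg.1]
      exact (h0 ▸ hga.continuousAt.tendsto).mono_left nhdsWithin_le_nhds
    rw [← hg.coe_intOrderAt] at h1
    exact_mod_cast h1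
  have hlim : Tendsto (fun w => g w ^ (n : ℤ) * (f ∘ g) w) (𝓝[≠] z) (𝓝 0) := by
    have hm := (hg.zpow n).mul hf
    rw [tendsto_zero_iff_meromorphicOrderAt_pos hm.1, ← hm.coe_intOrderAt,
      (hg.zpow n).intOrderAt_mul hf, hg.intOrderAt_zpow]
    have : 1 - intOrderAt (f ∘ g) z ≤ n := Int.self_le_toNat _
    have h3 : (n : ℤ) ≤ n * intOrderAt g z := by nlinarith
    exact_mod_cast (by linarith : 0 < (n : ℤ) * intOrderAt g z + intOrderAt (f ∘ g) z)
  set F : ℂ → ℂ := Function.update (fun w => w ^ (n : ℤ) * f w) 0 0 with hF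
  have hFeq : ∀ w, w ≠ 0 → F w = w ^ (n : ℤ) * f w := fun w hw => by simp [hF, hw]
  have hFz : F 0 = 0 := by simp [hF]
  have hFa : AnalyticAt ℂ F 0 := by
    refine Complex.analyticAt_of_differentiable_on_punctured_nhds_of_continuousAt ?_ ?_
    · filter_upwards [hfan, self_mem_nhdsWithin] with w hw hw0
      have hw0' : w ≠ 0 := hw0
      refine ((differentiableAt_id.zpow (Or.inl hw0')).mul hw.1.differentiableAt
        ).congr_of_eventuallyEq (f := fun w => w ^ (n : ℤ) * f w) ?_
      filter_upwards [isOpen_ne.mem_nhds hw0'] with v hv using hFeq v hv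
    · rw [continuousAt_iff_punctured_nhds, hFz]
      have : Tendsto (fun w => w ^ (n : ℤ) * f w) (𝓝[≠] 0) (𝓝 0) :=
        (tendsto_map'_iff.2 hlim).mono_left hopen'
      refine this.congr' ?_
      filter_upwards [self_mem_nhdsWithin] with w hw using (hFeq w hw).symm
  have hmero : MeromorphicAt (fun w => (w ^ (n : ℤ))⁻¹ * F w) 0 :=
    (((MeromorphicAt.id 0).zpow n).inv).fun_mul hFa.meromorphicAt
  refine hmero.congr ?_
  filter_upwards [self_mem_nhdsWithin] with w hw
  have hw' : w ≠ 0 := hw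
  rw [hFeq w hw]
  field_simp

/-! ### Meromorphic functions on the Riemann sphere -/

open scoped Classical in
/-- The standard coordinate of the Riemann sphere centred at `c`: it is `w ↦ c + w` if `c` is
finite, and `w ↦ 1 / w` if `c = ∞`. -/
noncomputable def sphereCoord (c : OnePoint ℂ) : ℂ → OnePoint ℂ :=
  c.elim (fun w => if w = 0 then OnePoint.infty else ((w⁻¹ : ℂ) : OnePoint ℂ))
    (fun a w => ((a + w : ℂ) : OnePoint ℂ))

theorem sphereCoord_coe (a w : ℂ) : sphereCoord a w = ((a + w : ℂ) : OnePoint ℂ) := rfl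

theorem sphereCoord_infty {w : ℂ} (hw : w ≠ 0) :
    sphereCoord OnePoint.infty w = ((w⁻¹ : ℂ) : OnePoint ℂ) := by
  simp [sphereCoord, hw]

theorem sphereCoord_zero (c : OnePoint ℂ) : sphereCoord c 0 = c := by
  induction c with
  | infty => simp [sphereCoord]
  | coe a => simp [sphereCoord_coe]

/-- The function `F` on the Riemann sphere is meromorphic at `c`, and not identically zero
near `c`. -/
def SphereMeromorphicAt (F : OnePoint ℂ → ℂ) (c : OnePoint ℂ) : Prop :=
  MeromorphicNonzeroAt (F ∘ sphereCoord c) 0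

/-- The order at `c` of a function on the Riemann sphere. -/
noncomputable def sphereOrd (F : OnePoint ℂ → ℂ) (c : OnePoint ℂ) : ℤ :=
  intOrderAt (F ∘ sphereCoord c) 0

theorem sphereMeromorphicAt_coe {F : OnePoint ℂ → ℂ} {a : ℂ} :
    SphereMeromorphicAt F a ↔ MeromorphicNonzeroAt (fun z => F z) a := by
  have h : F ∘ sphereCoord a = (fun z : ℂ => F z) ∘ (fun w => a + w) := rfl
  have hd : deriv (fun w => a + w) 0 ≠ 0 := by simp
  have ha : AnalyticAt ℂ (fun w => a + w) 0 := by fun_prop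
  rw [SphereMeromorphicAt, MeromorphicNonzeroAt, MeromorphicNonzeroAt, h,
    meromorphicAt_comp_iff_of_deriv_ne_zero ha hd, meromorphicOrderAt_comp_of_deriv_ne_zero ha hd,
    add_zero]

theorem sphereOrd_coe (F : OnePoint ℂ → ℂ) (a : ℂ) :
    sphereOrd F a = intOrderAt (fun z => F z) a := by
  have h : F ∘ sphereCoord a = (fun z : ℂ => F z) ∘ (fun w => a + w) := rfl
  have hd : deriv (fun w => a + w) 0 ≠ 0 := by simp
  rw [sphereOrd, h, intOrderAt_comp_of_deriv_ne_zero (by fun_prop) hd, add_zero]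

theorem comp_sphereCoord_infty (F : OnePoint ℂ → ℂ) :
    F ∘ sphereCoord OnePoint.infty =ᶠ[𝓝[≠] 0] fun w => F ((w⁻¹ : ℂ) : OnePoint ℂ) := by
  filter_upwards [self_mem_nhdsWithin] with w hw
  rw [Function.comp_apply, sphereCoord_infty hw]

theorem sphereMeromorphicAt_infty {F : OnePoint ℂ → ℂ} :
    SphereMeromorphicAt F OnePoint.infty ↔
      MeromorphicNonzeroAt (fun w => F ((w⁻¹ : ℂ) : OnePoint ℂ)) 0 :=
  ⟨fun h => h.congr (comp_sphereCoord_infty F), fun h => h.congr (comp_sphereCoord_infty F).symm⟩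

theorem sphereOrd_infty (F : OnePoint ℂ → ℂ) :
    sphereOrd F OnePoint.infty = intOrderAt (fun w => F ((w⁻¹ : ℂ) : OnePoint ℂ)) 0 :=
  intOrderAt_congr (comp_sphereCoord_infty F)

theorem meromorphicNonzeroAt_sub (a z : ℂ) : MeromorphicNonzeroAt (fun w => w - a) z := by
  refine .of_eventually_ne_zero (by fun_prop) ?_
  by_cases h : z = a
  · subst h
    filter_upwards [self_mem_nhdsWithin] with w hw using sub_ne_zero.2 hw
  · filter_upwards [mem_nhdsWithin_of_mem_nhds (isOpen_ne.mem_nhds h)] with w hw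
      using sub_ne_zero.2 hw

theorem intOrderAt_sub (a z : ℂ) [Decidable (z = a)] :
    intOrderAt (fun w => w - a) z = if z = a then 1 else 0 := by
  split_ifs with h
  · rw [h, intOrderAt, meromorphicOrderAt_id_sub_const]; rfl
  · exact intOrderAt_of_analyticAt (by fun_prop) (sub_ne_zero.2 h)

/-- The function `w ↦ 1 / w - a` has a simple pole at the origin. -/
theorem inv_sub_order (a : ℂ) : MeromorphicNonzeroAt (fun w => w⁻¹ - a) 0 ∧
    intOrderAt (fun w => w⁻¹ - a) 0 = -1 := by
  have h1 : MeromorphicNonzeroAt (fun w : ℂ => w) 0 := by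
    simpa using meromorphicNonzeroAt_sub 0 0
  have h1o : intOrderAt (fun w : ℂ => w) 0 = 1 := by
    simpa using intOrderAt_sub 0 0
  have ha : AnalyticAt ℂ (fun w => 1 - a * w) 0 := by fun_prop
  have h2 : MeromorphicNonzeroAt (fun w => 1 - a * w) 0 := .of_analyticAt ha (by simp)
  have he : (fun w => w⁻¹ * (1 - a * w)) =ᶠ[𝓝[≠] 0] fun w => w⁻¹ - a := by
    filter_upwards [self_mem_nhdsWithin] with w hw
    have hw' : w ≠ 0 := hw
    field_simp
  refine ⟨(h1.inv.mul h2).congr he, ?_⟩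
  rw [← intOrderAt_congr he, h1.inv.intOrderAt_mul h2, h1.intOrderAt_inv, h1o,
    intOrderAt_of_analyticAt ha (by simp)]
  rfl

/-- The function `∏ a ∈ S, (z - a) ^ d a` has order `d a` at `a ∈ S`. -/
theorem prod_zpow_order (S : Finset ℂ) (d : ℂ → ℤ) (hd : ∀ a ∉ S, d a = 0) (z : ℂ) :
    MeromorphicNonzeroAt (fun w => ∏ a ∈ S, (w - a) ^ d a) z ∧
      intOrderAt (fun w => ∏ a ∈ S, (w - a) ^ d a) z = d z := by
  classical
  obtain ⟨h1, h2⟩ := MeromorphicNonzeroAt.prod S (F := fun a w => (w - a) ^ d a) (z := z)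
    (fun a => (meromorphicNonzeroAt_sub a z).zpow (d a))
  refine ⟨h1, h2.trans ?_⟩
  have h3 : ∀ a, intOrderAt (fun w => (w - a) ^ d a) z = if z = a then d a else 0 := fun a => by
    rw [(meromorphicNonzeroAt_sub a z).intOrderAt_zpow, intOrderAt_sub]
    split_ifs <;> simp
  simp only [h3, Finset.sum_ite_eq]
  split_ifs with h
  · rfl
  · exact (hd z h).symm

theorem prod_zpow_inv_order (S : Finset ℂ) (d : ℂ → ℤ) :
    MeromorphicNonzeroAt (fun w => ∏ a ∈ S, (w⁻¹ - a) ^ d a) 0 ∧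
      intOrderAt (fun w => ∏ a ∈ S, (w⁻¹ - a) ^ d a) 0 = -∑ a ∈ S, d a := by
  obtain ⟨h1, h2⟩ := MeromorphicNonzeroAt.prod S (F := fun a w => (w⁻¹ - a) ^ d a) (z := 0)
    (fun a => (inv_sub_order a).1.zpow (d a))
  refine ⟨h1, h2.trans ?_⟩
  rw [← Finset.sum_neg_distrib]
  refine Finset.sum_congr rfl fun a _ => ?_
  rw [(inv_sub_order a).1.intOrderAt_zpow, (inv_sub_order a).2]
  ring

/-- A nowhere vanishing entire function which is meromorphic at infinity is constant, so it has
order zero at infinity. -/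
theorem intOrderAt_infty_of_entire {g : ℂ → ℂ} (hg : Differentiable ℂ g) (hg0 : ∀ z, g z ≠ 0)
    (hinf : MeromorphicNonzeroAt (fun w => g w⁻¹) 0) : intOrderAt (fun w => g w⁻¹) 0 = 0 := by
  have key : ∀ f : ℂ → ℂ, Differentiable ℂ f → (∀ z, f z ≠ 0) →
      MeromorphicNonzeroAt (fun w => f w⁻¹) 0 → 0 ≤ intOrderAt (fun w => f w⁻¹) 0 →
      intOrderAt (fun w => f w⁻¹) 0 = 0 := by
    intro f hf hf0 hm hnn
    obtain ⟨c, hc⟩ := tendsto_nhds_of_meromorphicOrderAt_nonneg hm.1 (by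
      rw [← hm.coe_intOrderAt]; exact_mod_cast hnn)
    have h1 : Tendsto f (cocompact ℂ) (𝓝 c) := by
      have h2 : Tendsto (fun z : ℂ => z⁻¹) (cocompact ℂ) (𝓝[≠] 0) := by
        rw [← Metric.cobounded_eq_cocompact]
        exact Filter.inv_cobounded₀.le
      refine (hc.comp h2).congr fun z => ?_
      simp
    have h3 : ∀ z, f z = c := fun z => hf.apply_eq_of_tendsto_cocompact z h1
    have h4 : (fun w : ℂ => f w⁻¹) = fun _ => c := funext fun w => h3 _
    rw [h4]
    exact intOrderAt_of_analyticAt analyticAt_const (h3 0 ▸ hf0 0)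
  rcases le_total 0 (intOrderAt (fun w => g w⁻¹) 0) with h | h
  · exact key g hg hg0 hinf h
  · have h1 := key (fun z => (g z)⁻¹) (hg.inv hg0) (fun z => inv_ne_zero (hg0 z)) hinf.inv (by
      rw [hinf.intOrderAt_inv]; linarith)
    rw [hinf.intOrderAt_inv] at h1
    linarith

open Set in
/-- A nonzero meromorphic function on the Riemann sphere has finitely many zeros and poles, and as
many zeros as poles. -/
theorem sphere_degree_eq_zero {F : OnePoint ℂ → ℂ} (hF : ∀ c, SphereMeromorphicAt F c) :
    (Function.support (sphereOrd F)).Finite ∧ ∑ᶠ c, sphereOrd F c = 0 := by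
  classical
  set f : ℂ → ℂ := fun z => F z with hf
  have hfm : ∀ z, MeromorphicNonzeroAt f z := fun z => sphereMeromorphicAt_coe.1 (hF z)
  have hinf : MeromorphicNonzeroAt (fun w => f w⁻¹) 0 := sphereMeromorphicAt_infty.1 (hF _)
  -- there are no zeros and poles near infinity
  obtain ⟨R, hR⟩ : ∃ R : ℝ, ∀ z, R < ‖z‖ → AnalyticAt ℂ f z ∧ f z ≠ 0 := by
    obtain ⟨ε, hε, hb⟩ := Metric.mem_nhdsWithin_iff.1 hinf.eventually_analyticAt
    refine ⟨ε⁻¹, fun z hz => ?_⟩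
    have hz0 : z ≠ 0 := fun h => by
      rw [h, norm_zero] at hz
      exact absurd hz (not_lt.2 (by positivity))
    have h1 : z⁻¹ ∈ Metric.ball 0 ε ∩ {0}ᶜ := by
      refine ⟨?_, inv_ne_zero hz0⟩
      rw [mem_ball_zero_iff, norm_inv]
      exact inv_lt_of_inv_lt₀ hε hz
    have h2 := hb h1
    have h3 : AnalyticAt ℂ ((fun w => f w⁻¹) ∘ fun z => z⁻¹) z :=
      AnalyticAt.comp h2.1 (analyticAt_id.inv hz0)
    have h4 : ((fun w => f w⁻¹) ∘ fun z => z⁻¹) = f := by ext; simp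
    rw [h4] at h3
    exact ⟨h3, by simpa using h2.2⟩
  have hord : ∀ z, R < ‖z‖ → intOrderAt f z = 0 := fun z hz =>
    intOrderAt_of_analyticAt (hR z hz).1 (hR z hz).2
  have hfmU : MeromorphicOn f univ := fun z _ => (hfm z).1
  have hdiv : ∀ z, MeromorphicOn.divisor f univ z = intOrderAt f z := fun z =>
    MeromorphicOn.divisor_apply hfmU (mem_univ z)
  have hfin : (Function.support (intOrderAt f)).Finite := by
    have hfmB : MeromorphicOn f (Metric.closedBall 0 R) := fun z _ => (hfm z).1
    refine ((MeromorphicOn.divisor f (Metric.closedBall 0 R)).finiteSupport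
      (isCompact_closedBall 0 R)).subset fun z hz => ?_
    have hzR : z ∈ Metric.closedBall 0 R := by
      by_contra h
      rw [mem_closedBall_zero_iff, not_le] at h
      exact hz (hord z h)
    rw [Function.mem_support, MeromorphicOn.divisor_apply hfmB hzR]
    exact hz
  set S := hfin.toFinset with hS
  have hSd : ∀ a ∉ S, intOrderAt f a = 0 := fun a ha => by
    by_contra h
    exact ha (hfin.mem_toFinset.2 h)
  obtain ⟨g, hga, hg0, hfg⟩ := hfmU.extract_zeros_poles (fun z => (hfm z).2)
    (hfin.subset fun z hz => by rwa [Function.mem_support, hdiv] at hz)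
  have hprod : (∏ᶠ u, (fun x => x - u) ^ (MeromorphicOn.divisor f univ) u)
      = fun w => ∏ a ∈ S, (w - a) ^ intOrderAt f a := by
    rw [finprod_eq_prod_of_mulSupport_subset (s := S)]
    · ext w
      simp [hdiv]
    · intro a ha
      rw [Function.mem_mulSupport] at ha
      refine hfin.mem_toFinset.2 fun h => ha ?_
      rw [hdiv, h, zpow_zero]
  rw [hprod] at hfg
  set q : ℂ → ℂ := fun w => ∏ a ∈ S, (w - a) ^ intOrderAt f a with hq
  -- the factorization `f = q g` holds near infinity
  have hev : (fun w => f w⁻¹) =ᶠ[𝓝[≠] 0] fun w => q w⁻¹ * g w⁻¹ := by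
    have htend : Tendsto (fun w : ℂ => ‖w⁻¹‖) (𝓝[≠] 0) atTop := by
      simpa using tendsto_norm_inv_nhdsNE_zero_atTop (α := ℂ)
    filter_upwards [htend.eventually_gt_atTop R] with w hw
    have h1 : f =ᶠ[𝓝[≠] w⁻¹] fun z => q z * g z := by
      have h2 := mem_codiscreteWithin.1 hfg w⁻¹ (mem_univ _)
      rw [disjoint_principal_right] at h2
      filter_upwards [h2] with z hz
      by_contra h
      exact hz ⟨mem_univ _, h⟩
    have hqa : ContinuousAt q w⁻¹ := by
      refine tendsto_finsetProd _ fun a ha => ?_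
      have hne : w⁻¹ - a ≠ 0 := sub_ne_zero.2 fun h => by
        subst h
        exact hfin.mem_toFinset.1 ha (hord _ hw)
      exact ((continuousAt_id.sub continuousAt_const).zpow₀ _ (Or.inl hne))
    exact (((hR _ hw).1.continuousAt.eventuallyEq_nhds_iff_eventuallyEq_nhdsNE
      (hqa.mul (hga _ (mem_univ _)).continuousAt)).1 h1).eq_of_nhds
  obtain ⟨hqm, hqo⟩ := prod_zpow_inv_order S (intOrderAt f)
  have hgm : MeromorphicNonzeroAt (fun w => g w⁻¹) 0 := by
    refine (hinf.mul hqm.inv).congr ?_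
    filter_upwards [hev, hqm.eventually_ne_zero] with w hw hw0
    rw [hw, mul_comm, inv_mul_cancel_left₀ hw0]
  have hg_order := intOrderAt_infty_of_entire (fun z => (hga z (mem_univ z)).differentiableAt)
    (fun z => hg0 ⟨z, mem_univ z⟩) hgm
  have hinfo : sphereOrd F OnePoint.infty = -∑ a ∈ S, intOrderAt f a := by
    rw [sphereOrd_infty, intOrderAt_congr hev, hqm.intOrderAt_mul hgm, hqo, hg_order, add_zero]
  have hsub : Function.support (sphereOrd F) ⊆
      (insert OnePoint.infty (S.image ((↑) : ℂ → OnePoint ℂ)) : Finset (OnePoint ℂ)) := by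
    intro c hc
    induction c with
    | infty => simp
    | coe a =>
      rw [Function.mem_support, sphereOrd_coe] at hc
      have : a ∈ S := hfin.mem_toFinset.2 hc
      simp [this]
  refine ⟨(Finset.finite_toSet _).subset hsub, ?_⟩
  rw [finsum_eq_sum_of_support_subset _ hsub, Finset.sum_insert (by simp),
    Finset.sum_image (by simp), hinfo]
  simp only [sphereOrd_coe]
  exact neg_add_cancel _

/-- Every divisor of degree zero on the Riemann sphere is principal. -/
theorem exists_sphereOrd_eq {d : OnePoint ℂ → ℤ} (hd : (Function.support d).Finite)
    (hd0 : ∑ᶠ c, d c = 0) :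
    ∃ F : OnePoint ℂ → ℂ, (∀ c, SphereMeromorphicAt F c) ∧ ∀ c, sphereOrd F c = d c := by
  classical
  have hfin : (Function.support fun a : ℂ => d a).Finite :=
    hd.preimage OnePoint.coe_injective.injOn
  set S := hfin.toFinset with hS
  have hSd : ∀ a ∉ S, d (a : ℂ) = 0 := fun a ha => by
    by_contra h
    exact ha (hfin.mem_toFinset.2 h)
  set F : OnePoint ℂ → ℂ := fun c => c.elim 0 fun w => ∏ a ∈ S, (w - a) ^ d (a : ℂ) with hF
  have hFm : ∀ c, SphereMeromorphicAt F c := by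
    intro c
    induction c with
    | infty => exact sphereMeromorphicAt_infty.2 (prod_zpow_inv_order S fun a => d a).1
    | coe a => exact sphereMeromorphicAt_coe.2 (prod_zpow_order S (fun a => d a) hSd a).1
  have hcoe : ∀ a : ℂ, sphereOrd F a = d a := fun a => by
    rw [sphereOrd_coe]
    exact (prod_zpow_order S (fun a => d a) hSd a).2
  have hsum : ∀ e : OnePoint ℂ → ℤ, (∀ a : ℂ, e a = d a) →
      ∑ᶠ c, e c = e OnePoint.infty + ∑ a ∈ S, d (a : ℂ) := by
    intro e he
    have hsub : Function.support e ⊆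
        (insert OnePoint.infty (S.image ((↑) : ℂ → OnePoint ℂ)) : Finset (OnePoint ℂ)) := by
      intro c hc
      induction c with
      | infty => simp
      | coe a =>
        rw [Function.mem_support, he] at hc
        have : a ∈ S := hfin.mem_toFinset.2 hc
        simp [this]
    rw [finsum_eq_sum_of_support_subset _ hsub, Finset.sum_insert (by simp),
      Finset.sum_image (by simp)]
    simp only [he]
  refine ⟨F, hFm, fun c => ?_⟩
  induction c with
  | infty =>
    have h1 := (sphere_degree_eq_zero hFm).2
    rw [hsum _ hcoe] at h1
    rw [hsum d fun _ => rfl] at hd0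
    linarith
  | coe a => exact hcoe a

/-! ### Local embeddings of charts -/

/-- A nonconstant holomorphic function is a power of a local coordinate. -/
theorem exists_pow_eq_of_order {g : ℂ → ℂ} {u : ℂ} (hga : AnalyticAt ℂ g u)
    (hg : MeromorphicNonzeroAt g u) (h0 : g u = 0) :
    ∃ (e : ℕ) (ψ : ℂ → ℂ), e ≠ 0 ∧ intOrderAt g u = e ∧ AnalyticAt ℂ ψ u ∧ ψ u = 0 ∧
      deriv ψ u ≠ 0 ∧ ∀ᶠ w in 𝓝 u, g w = ψ w ^ e := by
  obtain ⟨n, hn⟩ : ∃ n : ℕ, analyticOrderAt g u = n := by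
    refine ENat.ne_top_iff_exists.1 (fun h => ?_) |>.imp fun n h => h.symm
    apply hg.2
    rw [hga.meromorphicOrderAt_eq, h]
    rfl
  obtain ⟨k, hka, hk0, hk⟩ := hga.analyticOrderAt_eq_natCast.1 hn
  have hn0 : n ≠ 0 := by
    rintro rfl
    have := hk.self_of_nhds
    simp only [pow_zero, one_smul] at this
    exact hk0 (this ▸ h0)
  obtain ⟨a, ha⟩ := IsAlgClosed.exists_pow_nat_eq (k u) (Nat.pos_of_ne_zero hn0)
  have ha0 : a ≠ 0 := by
    rintro rfl
    rw [zero_pow hn0] at ha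
    exact hk0 ha.symm
  -- a holomorphic `n`-th root of `k`
  set κ : ℂ → ℂ := fun w => a * Complex.exp (Complex.log (k w / k u) / n) with hκ
  have hκa : AnalyticAt ℂ κ u := by
    refine analyticAt_const.mul (AnalyticAt.cexp (AnalyticAt.div_const (AnalyticAt.clog
      (hka.div analyticAt_const hk0) ?_)))
    simp [div_self hk0]
  have hκ0 : κ u ≠ 0 := mul_ne_zero ha0 (Complex.exp_ne_zero _)
  have hκe : ∀ᶠ w in 𝓝 u, κ w ^ n = k w := by
    filter_upwards [hka.continuousAt.eventually_ne hk0] with w hw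
    have hn0' : (n : ℂ) ≠ 0 := Nat.cast_ne_zero.2 hn0
    rw [hκ]
    simp only
    rw [mul_pow, ← Complex.exp_nat_mul, mul_div_cancel₀ _ hn0',
      Complex.exp_log (div_ne_zero hw hk0), ha]
    field_simp
  refine ⟨n, fun w => (w - u) * κ w, hn0, ?_, by fun_prop, by simp, ?_, ?_⟩
  · rw [intOrderAt, hga.meromorphicOrderAt_eq, hn]
    rfl
  · have h1 : HasDerivAt (fun w => (w - u) * κ w) (1 * κ u + (u - u) * deriv κ u) u :=
      ((hasDerivAt_id u).sub_const u).mul hκa.differentiableAt.hasDerivAt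
    rw [h1.deriv]
    simpa using hκ0
  · filter_upwards [hk, hκe] with w hw hκw
    rw [hw, mul_pow, hκw, smul_eq_mul]

namespace OrbifoldAtlas

variable {X : Type*} [TopologicalSpace X] {A : OrbifoldAtlas X}

theorem IsArrow.φ_eq {i j : A.ι} {f : ℂ → ℂ} {z : ℂ} (h : A.IsArrow i j f z) :
    A.φ j (f z) = A.φ i z := h.comm.self_of_nhds

theorem IsArrow.eventually {i j : A.ι} {f : ℂ → ℂ} {z : ℂ} (h : A.IsArrow i j f z) :
    ∀ᶠ w in 𝓝 z, A.IsArrow i j f w := by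
  filter_upwards [(A.isOpen_U i).mem_nhds h.mem_source,
    h.analyticAt.continuousAt.preimage_mem_nhds ((A.isOpen_U j).mem_nhds h.mem_target),
    h.analyticAt.eventually_analyticAt, h.analyticAt.deriv.continuousAt.eventually_ne
      h.deriv_ne_zero, h.comm.eventually_nhds] with w h1 h2 h3 h4 h5
  exact ⟨h1, h2, h3, h4, h5⟩

theorem IsArrow.comp {i j k : A.ι} {f f' : ℂ → ℂ} {z : ℂ} (h : A.IsArrow i j f z)
    (h' : A.IsArrow j k f' (f z)) : A.IsArrow i k (f' ∘ f) z where
  mem_source := h.mem_source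
  mem_target := h'.mem_target
  analyticAt := h'.analyticAt.comp h.analyticAt
  deriv_ne_zero := by
    rw [deriv_comp z h'.analyticAt.differentiableAt h.analyticAt.differentiableAt]
    exact mul_ne_zero h'.deriv_ne_zero h.deriv_ne_zero
  comm := by
    filter_upwards [h.comm, h.analyticAt.continuousAt.eventually h'.comm] with w h1 h2
    rw [Function.comp_apply, h2, h1]

theorem isArrow_id {i : A.ι} {z : ℂ} (hz : z ∈ A.U i) : A.IsArrow i i id z where
  mem_source := hz
  mem_target := hz
  analyticAt := analyticAt_id
  deriv_ne_zero := by simp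
  comm := Eventually.of_forall fun _ => rfl

/-- Local embeddings between two charts exist over every point of `X`. -/
theorem exists_isArrow {i j : A.ι} {z v : ℂ} (hz : z ∈ A.U i) (hv : v ∈ A.U j)
    (h : A.φ i z = A.φ j v) : ∃ f, A.IsArrow i j f z ∧ f z = v :=
  A.compatible i j ⟨z, hz⟩ ⟨v, hv⟩ h

theorem IsArrow.tendsto_nhdsNE {i j : A.ι} {f : ℂ → ℂ} {z : ℂ} (h : A.IsArrow i j f z) :
    Tendsto f (𝓝[≠] z) (𝓝[≠] (f z)) := by
  refine tendsto_nhdsWithin_of_tendsto_nhds_of_eventually_within _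
    (h.analyticAt.continuousAt.tendsto.mono_left nhdsWithin_le_nhds) ?_
  exact h.analyticAt.differentiableAt.hasDerivAt.eventually_ne h.deriv_ne_zero

variable (A) in
/-- The holomorphic function on the chart `i` given by an element of the group of this chart. -/
noncomputable def act (i : A.ι) (γ : A.G i) : ℂ → ℂ := (A.holomorphic_G i γ γ.2).choose

theorem act_coe {i : A.ι} (γ : A.G i) (u : A.U i) :
    A.act i γ u = ((γ : Equiv.Perm (A.U i)) u : ℂ) :=
  (A.holomorphic_G i γ γ.2).choose_spec.2 u

theorem act_eq {i : A.ι} (γ : A.G i) {z : ℂ} (hz : z ∈ A.U i) :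
    A.act i γ z = (γ • (⟨z, hz⟩ : A.U i) : A.U i) := act_coe γ ⟨z, hz⟩

theorem act_mem {i : A.ι} (γ : A.G i) {z : ℂ} (hz : z ∈ A.U i) : A.act i γ z ∈ A.U i := by
  rw [act_eq γ hz]
  exact Subtype.coe_prop _

theorem act_mul {i : A.ι} (γ δ : A.G i) {z : ℂ} (hz : z ∈ A.U i) :
    A.act i (γ * δ) z = A.act i γ (A.act i δ z) := by
  rw [act_eq γ (act_mem δ hz), act_eq (γ * δ) hz, mul_smul]
  congr 2
  exact Subtype.ext (act_eq δ hz).symm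

theorem act_one {i : A.ι} {z : ℂ} (hz : z ∈ A.U i) : A.act i 1 z = z := by
  rw [act_eq 1 hz, one_smul]

theorem act_analyticAt {i : A.ι} (γ : A.G i) {z : ℂ} (hz : z ∈ A.U i) :
    AnalyticAt ℂ (A.act i γ) z :=
  (A.holomorphic_G i γ γ.2).choose_spec.1.analyticAt ((A.isOpen_U i).mem_nhds hz)

theorem φ_act {i : A.ι} (γ : A.G i) {z : ℂ} (hz : z ∈ A.U i) : A.φ i (A.act i γ z) = A.φ i z := by
  rw [act_eq γ hz]
  exact ((A.φ_eq_iff i ⟨z, hz⟩ _).2 ⟨γ, γ.2, rfl⟩).symm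

theorem exists_act_eq {i : A.ι} {z w : ℂ} (hz : z ∈ A.U i) (hw : w ∈ A.U i)
    (h : A.φ i z = A.φ i w) : ∃ γ : A.G i, A.act i γ z = w := by
  obtain ⟨γ, hγ, h1⟩ := (A.φ_eq_iff i ⟨z, hz⟩ ⟨w, hw⟩).1 h
  refine ⟨⟨γ, hγ⟩, ?_⟩
  rw [act_coe ⟨γ, hγ⟩ ⟨z, hz⟩]
  exact congrArg Subtype.val h1

theorem isArrow_act {i : A.ι} (γ : A.G i) {z : ℂ} (hz : z ∈ A.U i) :
    A.IsArrow i i (A.act i γ) z where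
  mem_source := hz
  mem_target := act_mem γ hz
  analyticAt := act_analyticAt γ hz
  deriv_ne_zero := by
    intro h
    have h1 : (A.act i γ⁻¹ ∘ A.act i γ) =ᶠ[𝓝 z] id := by
      filter_upwards [(A.isOpen_U i).mem_nhds hz] with w hw
      rw [Function.comp_apply, ← act_mul _ _ hw, inv_mul_cancel, act_one hw, id]
    have h2 := h1.deriv_eq
    rw [deriv_comp z (act_analyticAt _ (act_mem γ hz)).differentiableAt
      (act_analyticAt γ hz).differentiableAt, h] at h2
    simp at h2
  comm := by
    filter_upwards [(A.isOpen_U i).mem_nhds hz] with w hw using φ_act γ hw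

/-- Two local embeddings differ by an element of the group of the target chart. -/
theorem IsArrow.exists_act_comp {i j : A.ι} {f f' : ℂ → ℂ} {z : ℂ} (h : A.IsArrow i j f z)
    (h' : A.IsArrow i j f' z) : ∃ γ : A.G j, f' =ᶠ[𝓝 z] A.act j γ ∘ f := by
  have := A.finite_G j
  have h1 : ∀ᶠ w in 𝓝[≠] z, ∃ γ : A.G j, f' w = A.act j γ (f w) := by
    filter_upwards [h.eventually.filter_mono nhdsWithin_le_nhds,
      h'.eventually.filter_mono nhdsWithin_le_nhds] with w hw hw'
    obtain ⟨γ, hγ⟩ := exists_act_eq hw.mem_target hw'.mem_target (hw.φ_eq.trans hw'.φ_eq.symm)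
    exact ⟨γ, hγ.symm⟩
  obtain ⟨γ, hγ⟩ : ∃ γ : A.G j, ∃ᶠ w in 𝓝[≠] z, f' w = A.act j γ (f w) := by
    by_contra hcon
    push Not at hcon
    have h2 := eventually_all.2 hcon
    obtain ⟨w, ⟨γ, hw⟩, hw'⟩ := (h1.and h2).exists
    exact hw' γ hw
  exact ⟨γ, (h'.analyticAt.frequently_eq_iff_eventually_eq
    ((act_analyticAt γ h.mem_target).comp h.analyticAt)).1 hγ⟩

/-- The action is faithful on germs, by the identity theorem. -/
theorem eq_of_frequently_act_eq {i : A.ι} {γ δ : A.G i} {u : ℂ} (hu : u ∈ A.U i)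
    (h : ∃ᶠ w in 𝓝[≠] u, A.act i γ w = A.act i δ w) : γ = δ := by
  have h1 : Set.EqOn (A.act i γ) (A.act i δ) (A.U i) :=
    AnalyticOnNhd.eqOn_of_preconnected_of_frequently_eq (fun z hz => act_analyticAt γ hz)
      (fun z hz => act_analyticAt δ hz) (A.isConnected_U i).isPreconnected hu h
  refine Subtype.ext (Equiv.ext fun z => Subtype.ext ?_)
  rw [← act_coe, ← act_coe]
  exact h1 z.2

/-- The fibres of a chart are discrete. -/
theorem eventually_φ_ne {i : A.ι} {u : ℂ} (hu : u ∈ A.U i) :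
    ∀ᶠ w in 𝓝[≠] u, A.φ i w ≠ A.φ i u := by
  have := A.finite_G i
  have h1 : ∀ᶠ w in 𝓝[≠] u, ∀ γ : A.G i, A.act i γ u = w → False := by
    rw [eventually_all]
    intro γ
    by_cases h : A.act i γ u = u
    · filter_upwards [self_mem_nhdsWithin] with w hw hγ
      exact hw (hγ.symm.trans h)
    · filter_upwards [mem_nhdsWithin_of_mem_nhds (isOpen_ne.mem_nhds (Ne.symm h))] with w hw hγ
      exact hw hγ.symm
  filter_upwards [h1, mem_nhdsWithin_of_mem_nhds ((A.isOpen_U i).mem_nhds hu)] with w hw hwU heq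
  obtain ⟨γ, hγ⟩ := exists_act_eq hu hwU heq.symm
  exact hw γ hγ

end OrbifoldAtlas

/-! ### The chart maps as maps to the Riemann sphere -/

theorem sphereCoord_injective (c : OnePoint ℂ) : Function.Injective (sphereCoord c) := by
  induction c with
  | infty =>
    intro z w h
    by_cases hz : z = 0 <;> by_cases hw : w = 0
    · rw [hz, hw]
    · subst hz
      rw [sphereCoord_zero, sphereCoord_infty hw] at h
      exact absurd h.symm (OnePoint.coe_ne_infty _)
    · subst hw
      rw [sphereCoord_zero, sphereCoord_infty hz] at h
      exact absurd h (OnePoint.coe_ne_infty _)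
    · rw [sphereCoord_infty hz, sphereCoord_infty hw] at h
      exact inv_injective (OnePoint.coe_injective h)
  | coe a =>
    intro z w h
    simp only [sphereCoord_coe] at h
    exact add_left_cancel (OnePoint.coe_injective h)

/-- A holomorphic map to the Riemann sphere is holomorphic in the coordinate centred at the
image point. -/
theorem HolomorphicToSphereAt.exists_coord {f : ℂ → OnePoint ℂ} {u : ℂ}
    (hf : HolomorphicToSphereAt f u) :
    ∃ g : ℂ → ℂ, AnalyticAt ℂ g u ∧ g u = 0 ∧ ∀ᶠ w in 𝓝 u, f w = sphereCoord (f u) (g w) := by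
  rcases hf with ⟨g, hg, h⟩ | ⟨g, hg, h⟩
  · refine ⟨fun w => g w - g u, by fun_prop, sub_self _, ?_⟩
    filter_upwards [h] with w hw
    rw [hw, h.self_of_nhds, sphereCoord_coe, add_sub_cancel]
  · by_cases h0 : g u = 0
    · have hfu : f u = OnePoint.infty := by rw [h.self_of_nhds, if_pos h0]
      refine ⟨g, hg, h0, ?_⟩
      filter_upwards [h] with w hw
      rw [hw, hfu]
      split_ifs with h1
      · rw [h1, sphereCoord_zero]
      · rw [sphereCoord_infty h1]
    · have hfu : f u = ((g u)⁻¹ : ℂ) := by rw [h.self_of_nhds, if_neg h0]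
      refine ⟨fun w => (g w)⁻¹ - (g u)⁻¹, (hg.inv h0).sub analyticAt_const, sub_self _, ?_⟩
      filter_upwards [h, hg.continuousAt.eventually_ne h0] with w hw hw0
      rw [hw, if_neg hw0, hfu, sphereCoord_coe, add_sub_cancel]

namespace OrbifoldAtlas

variable {X : Type*} [TopologicalSpace X] {A : OrbifoldAtlas X}

variable (A) in
/-- `h` is an isomorphism of the Riemann surface underlying the orbifold to the Riemann sphere. -/
def IsSphereIso (h : X ≃ₜ OnePoint ℂ) : Prop :=
  ∀ i, ∀ u ∈ A.U i, HolomorphicToSphereAt (fun z => h (A.φ i z)) u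

variable (A) in
/-- The holomorphic function `g` expresses the map `h ∘ φ i` in the coordinate of the Riemann
sphere centred at the image of `u`. -/
structure IsLocalCoord (h : X ≃ₜ OnePoint ℂ) (i : A.ι) (u : ℂ) (g : ℂ → ℂ) : Prop where
  analyticAt : AnalyticAt ℂ g u
  apply_eq_zero : g u = 0
  nonzeroAt : MeromorphicNonzeroAt g u
  eventually_eq : ∀ᶠ w in 𝓝 u, h (A.φ i w) = sphereCoord (h (A.φ i u)) (g w)

variable {h : X ≃ₜ OnePoint ℂ}

theorem IsSphereIso.exists_isLocalCoord (hh : A.IsSphereIso h) {i : A.ι} {u : ℂ} (hu : u ∈ A.U i) :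
    ∃ g, A.IsLocalCoord h i u g := by
  obtain ⟨g, hg, h0, he⟩ := (hh i u hu).exists_coord
  refine ⟨g, hg, h0, .of_eventually_ne_zero hg.meromorphicAt ?_, he⟩
  filter_upwards [eventually_φ_ne hu, he.filter_mono nhdsWithin_le_nhds] with w hw hw' hgw
  rw [hgw, sphereCoord_zero] at hw'
  exact hw (h.injective hw')

theorem IsLocalCoord.comp {i j : A.ι} {f g : ℂ → ℂ} {u : ℂ} (hf : A.IsArrow i j f u)
    (hg : A.IsLocalCoord h j (f u) g) : A.IsLocalCoord h i u (g ∘ f) where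
  analyticAt := hg.analyticAt.comp hf.analyticAt
  apply_eq_zero := hg.apply_eq_zero
  nonzeroAt := hg.nonzeroAt.comp_of_deriv_ne_zero hf.analyticAt hf.deriv_ne_zero
  eventually_eq := by
    filter_upwards [hf.comm, hf.analyticAt.continuousAt.eventually hg.eventually_eq] with w h1 h2
    rw [← h1, h2, hf.φ_eq]
    rfl

theorem IsLocalCoord.eventuallyEq {i : A.ι} {g g' : ℂ → ℂ} {u : ℂ}
    (hg : A.IsLocalCoord h i u g) (hg' : A.IsLocalCoord h i u g') : g =ᶠ[𝓝 u] g' := by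
  filter_upwards [hg.eventually_eq, hg'.eventually_eq] with w h1 h2
  exact sphereCoord_injective _ (h1.symm.trans h2)

/-- The local degree of the chart map to the Riemann surface underlying the orbifold is the order
of the stabilizer: with `g = ψ ^ e` for a local coordinate `ψ`, the stabilizer acts by
multiplication of `ψ` with the `e`-th roots of unity. -/
theorem IsLocalCoord.intOrderAt_eq_card {i : A.ι} {g : ℂ → ℂ} {u : A.U i}
    (hg : A.IsLocalCoord h i u g) :
    intOrderAt g u = Nat.card (MulAction.stabilizer (A.G i) u) ∧
      0 < Nat.card (MulAction.stabilizer (A.G i) u) := by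
  have := A.finite_G i
  refine ⟨?_, Nat.card_pos⟩
  obtain ⟨e, ψ, he, heg, hψ, hψ0, hψ', hgψ⟩ :=
    exists_pow_eq_of_order hg.analyticAt hg.nonzeroAt hg.apply_eq_zero
  have : NeZero e := ⟨he⟩
  rw [heg]
  norm_cast
  have hψnz : ∀ᶠ w in 𝓝[≠] (u : ℂ), ψ w ≠ 0 := by
    have := hψ.differentiableAt.hasDerivAt.eventually_ne (c := 0) hψ'
    exact this
  -- the root of unity of an element of the stabilizer
  have hroot : ∀ γ : MulAction.stabilizer (A.G i) u, ∃ ω : rootsOfUnity e ℂ,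
      ∀ᶠ w in 𝓝 (u : ℂ), ψ (A.act i γ.1 w) = ((ω : ℂˣ) : ℂ) * ψ w := by
    intro γ
    have hγu : A.act i γ.1 u = u := by
      rw [act_eq γ.1 u.2]
      exact congrArg Subtype.val γ.2
    have hγa := act_analyticAt γ.1 u.2
    have hγt : Tendsto (A.act i γ.1) (𝓝 (u : ℂ)) (𝓝 (u : ℂ)) := by
      have := hγa.continuousAt.tendsto
      rwa [hγu] at this
    have hgg : ∀ᶠ w in 𝓝 (u : ℂ), g (A.act i γ.1 w) = g w := by
      have h1 : A.IsLocalCoord h i (A.act i γ.1 u) g := by rw [hγu]; exact hg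
      exact (h1.comp (isArrow_act γ.1 u.2)).eventuallyEq hg
    have hev : ∀ᶠ w in 𝓝[≠] (u : ℂ), ∃ ω : rootsOfUnity e ℂ,
        ψ (A.act i γ.1 w) = ((ω : ℂˣ) : ℂ) * ψ w := by
      filter_upwards [hgg.filter_mono nhdsWithin_le_nhds, hψnz,
        hgψ.filter_mono nhdsWithin_le_nhds,
        (hγt.eventually hgψ).filter_mono nhdsWithin_le_nhds] with w h1 h2 h3 h4
      refine ⟨rootsOfUnity.mkOfPowEq (ψ (A.act i γ.1 w) / ψ w) ?_, ?_⟩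
      · rw [div_pow, ← h4, ← h3, h1, div_self]
        rw [h3]
        exact pow_ne_zero _ h2
      · rw [rootsOfUnity.val_mkOfPowEq_coe, div_mul_cancel₀ _ h2]
    by_contra hcon
    push Not at hcon
    have h2 : ∀ᶠ w in 𝓝[≠] (u : ℂ), ∀ ω : rootsOfUnity e ℂ,
        ψ (A.act i γ.1 w) ≠ ((ω : ℂˣ) : ℂ) * ψ w := by
      rw [eventually_all]
      intro ω
      by_contra h3
      have h3' : ∃ᶠ w in 𝓝[≠] (u : ℂ), ψ (A.act i γ.1 w) = ((ω : ℂˣ) : ℂ) * ψ w :=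
        fun h4 => h3 h4
      have h4 := (AnalyticAt.frequently_eq_iff_eventually_eq
        (f := fun w => ψ (A.act i γ.1 w)) (g := fun w => ((ω : ℂˣ) : ℂ) * ψ w)
        (AnalyticAt.fun_comp (by rw [hγu]; exact hψ) hγa) (analyticAt_const.mul hψ)).1
        h3'
      obtain ⟨w, hw⟩ := (hcon ω).and_eventually h4 |>.exists
      exact hw.1 hw.2
    obtain ⟨w, ⟨ω, hw⟩, hw'⟩ := (hev.and h2).exists
    exact hw' ω hw
  choose ω hω using hroot
  have hstrict := hψ.hasStrictDerivAt
  set r := hstrict.localInverse _ _ _ hψ' with hr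
  have hleft : ∀ᶠ w in 𝓝 (u : ℂ), r (ψ w) = w :=
    HasStrictDerivAt.eventually_left_inverse hstrict hψ'
  have hright : ∀ᶠ w in 𝓝 (0 : ℂ), ψ (r w) = w := by
    rw [← hψ0]
    exact HasStrictDerivAt.eventually_right_inverse hstrict hψ'
  have hra : AnalyticAt ℂ r 0 := by
    rw [← hψ0]
    exact hψ.analyticAt_localInverse hψ'
  have hr0 : r 0 = u := by
    have := hleft.self_of_nhds
    rwa [hψ0] at this
  have hψt : Tendsto ψ (𝓝 (u : ℂ)) (𝓝 0) := by
    have := hψ.continuousAt.tendsto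
    rwa [hψ0] at this
  have hbij : Function.Bijective ω := by
    constructor
    · intro γ δ hγδ
      have hγu : A.act i γ.1 u = u := by
        rw [act_eq γ.1 u.2]
        exact congrArg Subtype.val γ.2
      have hδu : A.act i δ.1 u = u := by
        rw [act_eq δ.1 u.2]
        exact congrArg Subtype.val δ.2
      have hγt : Tendsto (A.act i γ.1) (𝓝 (u : ℂ)) (𝓝 (u : ℂ)) := by
        have := (act_analyticAt γ.1 u.2).continuousAt.tendsto
        rwa [hγu] at this
      have hδt : Tendsto (A.act i δ.1) (𝓝 (u : ℂ)) (𝓝 (u : ℂ)) := by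
        have := (act_analyticAt δ.1 u.2).continuousAt.tendsto
        rwa [hδu] at this
      refine Subtype.ext (eq_of_frequently_act_eq u.2 (Eventually.frequently ?_))
      refine Eventually.filter_mono nhdsWithin_le_nhds ?_
      filter_upwards [hω γ, hω δ, hγt.eventually hleft, hδt.eventually hleft] with w h1 h2 h3 h4
      rw [← h3, ← h4, h1, h2, hγδ]
    · intro ζ
      -- `ψ ↦ ζ ψ` preserves `g = ψ ^ e`, so it is a local embedding of the chart into itself
      set f : ℂ → ℂ := fun w => r (((ζ : ℂˣ) : ℂ) * ψ w) with hf
      have hfu : f u = u := by simp [hf, hψ0, hr0]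
      have hζt : Tendsto (fun w => ((ζ : ℂˣ) : ℂ) * ψ w) (𝓝 (u : ℂ)) (𝓝 0) := by
        simpa using hψt.const_mul ((ζ : ℂˣ) : ℂ)
      have hfa : AnalyticAt ℂ f u :=
        AnalyticAt.fun_comp (g := r) (by simpa [hψ0] using hra) (analyticAt_const.mul hψ)
      have hψf : ∀ᶠ w in 𝓝 (u : ℂ), ψ (f w) = ((ζ : ℂˣ) : ℂ) * ψ w := hζt.eventually hright
      have hft : Tendsto f (𝓝 (u : ℂ)) (𝓝 (u : ℂ)) := by
        have := hfa.continuousAt.tendsto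
        rwa [hfu] at this
      have harr : A.IsArrow i i f u := by
        refine ⟨u.2, by rw [hfu]; exact u.2, hfa, ?_, ?_⟩
        · intro h0
          have h1 : deriv (fun w => ψ (f w)) u = deriv ψ (f u) * deriv f u :=
            deriv_comp (h₂ := ψ) (h := f) (u : ℂ) (by rw [hfu]; exact hψ.differentiableAt)
              hfa.differentiableAt
          rw [h0, mul_zero, (show (fun w => ψ (f w)) =ᶠ[𝓝 (u : ℂ)] _ from hψf).deriv_eq,
            deriv_const_mul _ hψ.differentiableAt] at h1
          exact mul_ne_zero (Units.ne_zero _) hψ' h1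
        · have hge : ∀ᶠ w in 𝓝 (u : ℂ), g (f w) = g w := by
            filter_upwards [hft.eventually hgψ, hgψ, hψf] with w h1 h2 h3
            have h4 : ((ζ : ℂˣ) : ℂ) ^ e = 1 := by
              have := congrArg Units.val ((mem_rootsOfUnity e (ζ : ℂˣ)).1 ζ.2)
              rwa [Units.val_pow_eq_pow_val, Units.val_one] at this
            rw [h1, h3, mul_pow, h4, one_mul, h2]
          filter_upwards [hft.eventually hg.eventually_eq, hg.eventually_eq, hge] with w h1 h2 h3
          exact h.injective (h1.trans ((congrArg _ h3).trans h2.symm))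
      obtain ⟨γ, hγ⟩ := (isArrow_id u.2).exists_act_comp harr
      have hγu : γ • u = u := by
        have h1 := hγ.self_of_nhds
        rw [hfu, Function.comp_apply, id, act_eq γ u.2] at h1
        exact Subtype.ext h1.symm
      refine ⟨⟨γ, hγu⟩, ?_⟩
      have h1 : ∀ᶠ w in 𝓝[≠] (u : ℂ), ((ω ⟨γ, hγu⟩ : ℂˣ) : ℂ) * ψ w = ((ζ : ℂˣ) : ℂ) * ψ w := by
        refine Eventually.filter_mono nhdsWithin_le_nhds ?_
        filter_upwards [hω ⟨γ, hγu⟩, hγ, hψf] with w h1 h2 h3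
        rw [← h1, ← h3, h2]
        rfl
      obtain ⟨w, hw1, hw2⟩ := (h1.and hψnz).exists
      exact Subtype.ext (Units.ext (mul_right_cancel₀ hw2 hw1))
  rw [Nat.card_congr (Equiv.ofBijective ω hbij), Complex.card_rootsOfUnity]

/-- The order of a local coordinate of `X` in an orbifold chart is the order of the stabilizer. -/
theorem IsLocalCoord.intOrderAt_eq_stabOrder (hh : A.IsSphereIso h) {i : A.ι} {g : ℂ → ℂ} {u : ℂ}
    (hu : u ∈ A.U i) (hg : A.IsLocalCoord h i u g) :
    intOrderAt g u = A.stabOrder (A.φ i u) := by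
  set a := A.lift (A.φ i u) with ha
  have hφ : A.φ a.1 a.2 = A.φ i u := (A.covers (A.φ i u)).choose_spec.choose_spec
  obtain ⟨f, hf, hfu⟩ := exists_isArrow hu a.2.2 hφ.symm
  obtain ⟨g', hg'⟩ := hh.exists_isLocalCoord a.2.2
  have h1 : A.IsLocalCoord h i u (g' ∘ f) := IsLocalCoord.comp hf (hfu ▸ hg')
  rw [intOrderAt_congr ((hg.eventuallyEq h1).filter_mono nhdsWithin_le_nhds),
    intOrderAt_comp_of_deriv_ne_zero hf.analyticAt hf.deriv_ne_zero, hfu,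
    hg'.intOrderAt_eq_card.1]
  rfl

theorem stabOrder_pos (x : X) : 0 < A.stabOrder x := by
  have := A.finite_G (A.lift x).1
  exact Nat.card_pos

/-- The pull-back to a chart of a meromorphic function on the Riemann sphere. -/
theorem IsSphereIso.pullback (hh : A.IsSphereIso h) {F : OnePoint ℂ → ℂ} {i : A.ι} {u : ℂ}
    (hu : u ∈ A.U i) (hF : SphereMeromorphicAt F (h (A.φ i u))) :
    MeromorphicNonzeroAt (fun z => F (h (A.φ i z))) u ∧
      intOrderAt (fun z => F (h (A.φ i z))) u
        = sphereOrd F (h (A.φ i u)) * A.stabOrder (A.φ i u) := by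
  obtain ⟨g, hg⟩ := hh.exists_isLocalCoord hu
  have he : (F ∘ sphereCoord (h (A.φ i u))) ∘ g =ᶠ[𝓝[≠] u] fun z => F (h (A.φ i z)) := by
    filter_upwards [hg.eventually_eq.filter_mono nhdsWithin_le_nhds] with w hw
    rw [hw]
    rfl
  have hF' : MeromorphicNonzeroAt (F ∘ sphereCoord (h (A.φ i u))) (g u) := by
    rw [hg.apply_eq_zero]
    exact hF
  refine ⟨(hF'.comp_analyticAt hg.analyticAt (hg.nonzeroAt.not_eventuallyConst
    hg.apply_eq_zero)).congr he, ?_⟩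
  rw [← intOrderAt_congr he, hg.nonzeroAt.intOrderAt_comp hg.analyticAt hg.apply_eq_zero hF,
    hg.intOrderAt_eq_stabOrder hh hu]
  rfl

/-- A function on the Riemann sphere with meromorphic pull-back to a chart is meromorphic. -/
theorem IsSphereIso.sphereMeromorphicAt (hh : A.IsSphereIso h) {F : OnePoint ℂ → ℂ} {i : A.ι}
    {u : ℂ} (hu : u ∈ A.U i) (hF : MeromorphicNonzeroAt (fun z => F (h (A.φ i z))) u) :
    SphereMeromorphicAt F (h (A.φ i u)) := by
  obtain ⟨g, hg⟩ := hh.exists_isLocalCoord hu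
  refine .of_comp hg.analyticAt hg.nonzeroAt hg.apply_eq_zero (hF.congr ?_)
  filter_upwards [hg.eventually_eq.filter_mono nhdsWithin_le_nhds] with w hw
  rw [hw]
  rfl

end OrbifoldAtlas

namespace OrbifoldAtlas

variable {X : Type*} [TopologicalSpace X] {A : OrbifoldAtlas X}

/-! ### Rational sections over open subsets -/

/-- The functions `s a` are the coordinates of a rational section of `L` over `W ⊆ X`. -/
structure IsSectionOn (L : A.LineBundle) (W : Set X) (s : A.Pt → ℂ → ℂ) : Prop where
  nonzeroAt : ∀ a, ∀ z ∈ L.N a, A.φ a.1 z ∈ W → MeromorphicNonzeroAt (s a) z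
  compatible : ∀ a b f z, A.IsArrow a.1 b.1 f z → z ∈ L.N a → f z ∈ L.N b → A.φ a.1 z ∈ W →
    ∀ᶠ w in 𝓝[≠] z, s b (f w) = L.g a b f w * s a w

theorem IsSectionOn.mono {L : A.LineBundle} {W W' : Set X} {s : A.Pt → ℂ → ℂ}
    (hs : IsSectionOn L W s) (h : W' ⊆ W) : IsSectionOn L W' s :=
  ⟨fun a z hz hw => hs.nonzeroAt a z hz (h hw),
    fun a b f z hf hz hfz hw => hs.compatible a b f z hf hz hfz (h hw)⟩

/-- A section over `X` as a rational section. -/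
def IsSectionOn.toRationalSection {L : A.LineBundle} {s : A.Pt → ℂ → ℂ}
    (hs : IsSectionOn L Set.univ s) : RationalSection L where
  s := s
  meromorphic a z hz := (hs.nonzeroAt a z hz trivial).1
  order_ne_top a z hz := (hs.nonzeroAt a z hz trivial).2
  compatible a b f z hf hz hfz := hs.compatible a b f z hf hz hfz trivial

theorem RationalSection.isSectionOn {L : A.LineBundle} (s : RationalSection L) :
    IsSectionOn L Set.univ s.s :=
  ⟨fun a z hz _ => ⟨s.meromorphic a z hz, s.order_ne_top a z hz⟩,
    fun a b f z hf hz hfz _ => s.compatible a b f z hf hz hfz⟩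

theorem continuousAt_φ {i : A.ι} {z : ℂ} (hz : z ∈ A.U i) : ContinuousAt (A.φ i) z :=
  (A.continuousOn_φ i).continuousAt ((A.isOpen_U i).mem_nhds hz)

theorem eventually_φ_mem {i : A.ι} {z : ℂ} (hz : z ∈ A.U i) {W : Set X} (hW : IsOpen W)
    (h : A.φ i z ∈ W) : ∀ᶠ w in 𝓝 z, A.φ i w ∈ W :=
  (continuousAt_φ hz).eventually (hW.mem_nhds h)

theorem φ_lift (x : X) : A.φ (A.lift x).1 (A.lift x).2 = x :=
  (A.covers x).choose_spec.choose_spec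

/-! ### Local existence of rational sections -/

noncomputable instance stabilizerFintype (a : A.Pt) :
    Fintype (MulAction.stabilizer (A.G a.1) a.2) :=
  have := A.finite_G a.1
  Fintype.ofFinite _

/-- `D ⊆ N` is an open neighbourhood of the point `a` of a chart which is invariant under the
stabilizer of `a`, and which is met by its translate under no other element of the group. -/
structure IsInvariantNhd (a : A.Pt) (N D : Set ℂ) : Prop where
  isOpen : IsOpen D
  mem : (a.2 : ℂ) ∈ D
  subset : D ⊆ N
  subset_U : D ⊆ A.U a.1
  act_mem : ∀ γ ∈ MulAction.stabilizer (A.G a.1) a.2, ∀ w ∈ D, A.act a.1 γ w ∈ D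
  mem_stabilizer : ∀ γ, ∀ w ∈ D, A.act a.1 γ w ∈ D → γ ∈ MulAction.stabilizer (A.G a.1) a.2

theorem exists_isInvariantNhd (a : A.Pt) {N : Set ℂ} (hN : IsOpen N) (ha : (a.2 : ℂ) ∈ N) :
    ∃ D : Set ℂ, IsInvariantNhd a N D := by
  have := A.finite_G a.1
  set H := MulAction.stabilizer (A.G a.1) a.2 with hH
  have h1 : ∀ γ : A.G a.1, ∃ B : Set ℂ, IsOpen B ∧ (a.2 : ℂ) ∈ B ∧
      (γ ∉ H → ∀ w ∈ B, w ∈ A.U a.1 → A.act a.1 γ w ∉ B) := by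
    intro γ
    by_cases hγ : γ ∈ H
    · exact ⟨Set.univ, isOpen_univ, trivial, fun h => absurd hγ h⟩
    · have hne : A.act a.1 γ a.2 ≠ a.2 := fun h => hγ (by
        rw [act_eq γ a.2.2] at h
        exact Subtype.ext h)
      obtain ⟨O₁, O₂, hO₁, hO₂, h1, h2, hO⟩ := t2_separation hne
      have h3 := (act_analyticAt γ a.2.2).continuousAt.preimage_mem_nhds (hO₁.mem_nhds h1)
      obtain ⟨B, hB, hBo, haB⟩ := mem_nhds_iff.1 (inter_mem h3 (hO₂.mem_nhds h2))
      exact ⟨B, hBo, haB, fun _ w hw _ hw' =>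
        (hO.le_bot ⟨(hB hw).1, (hB hw').2⟩ : False)⟩
  choose B hBo haB hB using h1
  have hC : IsOpen (N ∩ ⋂ γ, B γ) := hN.inter (isOpen_iInter_of_finite hBo)
  set C := N ∩ ⋂ γ, B γ with hCdef
  have hD : IsOpen (⋂ γ : H, (A.U a.1 ∩ A.act a.1 γ ⁻¹' C)) := by
    refine isOpen_iInter_of_finite fun γ => ?_
    exact ContinuousOn.isOpen_inter_preimage (fun z hz =>
      (act_analyticAt γ.1 hz).continuousAt.continuousWithinAt) (A.isOpen_U a.1) hC
  have hDU : (⋂ γ : H, (A.U a.1 ∩ A.act a.1 γ ⁻¹' C)) ⊆ A.U a.1 :=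
    fun w hw => (Set.mem_iInter.1 hw 1).1
  have hDC : (⋂ γ : H, (A.U a.1 ∩ A.act a.1 γ ⁻¹' C)) ⊆ C := fun w hw => by
    have h2 := (Set.mem_iInter.1 hw 1).2
    rwa [Set.mem_preimage, Subgroup.coe_one, act_one (hDU hw)] at h2
  refine ⟨_, hD, ?_, hDC.trans Set.inter_subset_left, hDU, ?_, ?_⟩
  · refine Set.mem_iInter.2 fun γ => ⟨a.2.2, ?_⟩
    have h2 : A.act a.1 γ a.2 = a.2 := by
      rw [act_eq γ.1 a.2.2]
      exact congrArg Subtype.val γ.2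
    rw [Set.mem_preimage, h2]
    exact ⟨ha, Set.mem_iInter.2 haB⟩
  · intro γ hγ w hw
    refine Set.mem_iInter.2 fun δ => ⟨act_mem γ (hDU hw), ?_⟩
    have h2 := (Set.mem_iInter.1 hw (δ * ⟨γ, hγ⟩)).2
    rwa [Set.mem_preimage, Subgroup.coe_mul, act_mul _ _ (hDU hw)] at h2
  · intro γ w hw hγw
    by_contra hγ
    exact hB γ hγ w (Set.mem_iInter.1 (hDC hw).2 γ) (hDU hw) (Set.mem_iInter.1 (hDC hγw).2 γ)

/-- The average, over the stabilizer of the point `a`, of the section `q • e a` (where `e a` is the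
frame at `a`), at the point `z` of the chart `b`, which is moved by `f` to the chart of `a`. -/
noncomputable def average (L : A.LineBundle) (a : A.Pt) (q : ℂ → ℂ) (b : A.Pt) (f : ℂ → ℂ)
    (z : ℂ) : ℂ :=
  ∑ γ : MulAction.stabilizer (A.G a.1) a.2,
    (L.g b a (A.act a.1 γ ∘ f) z)⁻¹ * q (A.act a.1 γ (f z))

theorem average_analyticAt {L : A.LineBundle} {a : A.Pt} {D : Set ℂ}
    (hD : IsInvariantNhd a (L.N a) D) {q : ℂ → ℂ} (hq : ∀ z, AnalyticAt ℂ q z)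
    {b : A.Pt} {f : ℂ → ℂ} {z : ℂ} (hf : A.IsArrow b.1 a.1 f z) (hz : z ∈ L.N b) (hfz : f z ∈ D) :
    AnalyticAt ℂ (average L a q b f) z := by
  unfold average
  refine Finset.analyticAt_fun_sum _ fun γ _ => ?_
  have harr : A.IsArrow b.1 a.1 (A.act a.1 γ ∘ f) z :=
    IsArrow.comp hf (isArrow_act γ.1 (hD.subset_U hfz))
  have hmem : (A.act a.1 γ ∘ f) z ∈ L.N a := hD.subset (hD.act_mem γ.1 γ.2 _ hfz)
  exact ((L.g_analytic b a _ z harr hz hmem).inv (L.g_ne_zero b a _ z harr hz hmem)).mul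
    (AnalyticAt.fun_comp (hq _) harr.analyticAt)

/-- The average does not depend on the way in which `z` is moved to the chart of `a`. -/
theorem average_congr {L : A.LineBundle} {a : A.Pt} {D : Set ℂ}
    (hD : IsInvariantNhd a (L.N a) D) {q : ℂ → ℂ} {b : A.Pt} {f f' : ℂ → ℂ} {z : ℂ}
    (hf : A.IsArrow b.1 a.1 f z)
    (hf' : A.IsArrow b.1 a.1 f' z) (hz : z ∈ L.N b) (hfz : f z ∈ D) (hfz' : f' z ∈ D) :
    average L a q b f z = average L a q b f' z := by
  obtain ⟨δ, hδ⟩ := hf.exists_act_comp hf'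
  have hδH : δ ∈ MulAction.stabilizer (A.G a.1) a.2 := hD.mem_stabilizer δ (f z) hfz (by
    have := hδ.self_of_nhds
    rw [Function.comp_apply] at this
    rwa [← this])
  unfold average
  rw [← Equiv.sum_comp (Equiv.mulRight (⟨δ, hδH⟩ : MulAction.stabilizer (A.G a.1) a.2))]
  refine Finset.sum_congr rfl fun γ _ => ?_
  have he : A.act a.1 (γ.1 * δ) ∘ f =ᶠ[𝓝 z] A.act a.1 γ ∘ f' := by
    filter_upwards [hδ, hf.eventually] with w hw hfw
    rw [Function.comp_apply, Function.comp_apply, hw, act_mul _ _ hfw.mem_target]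
    rfl
  have harr : A.IsArrow b.1 a.1 (A.act a.1 (γ.1 * δ) ∘ f) z :=
    IsArrow.comp hf (isArrow_act _ (hD.subset_U hfz))
  have hmem : (A.act a.1 (γ.1 * δ) ∘ f) z ∈ L.N a :=
    hD.subset (hD.act_mem _ (mul_mem γ.2 hδH) _ hfz)
  have h1 := L.g_congr b a _ _ z harr hz hmem he
  have h2 := he.self_of_nhds
  simp only [Function.comp_apply] at h2
  change (L.g b a (A.act a.1 (γ.1 * δ) ∘ f) z)⁻¹ * q (A.act a.1 (γ.1 * δ) (f z)) = _
  rw [h1, h2]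

/-- The averages in different charts are coordinates of the same section. -/
theorem average_comp {L : A.LineBundle} {a : A.Pt} {D : Set ℂ}
    (hD : IsInvariantNhd a (L.N a) D) {q : ℂ → ℂ} {b c : A.Pt} {f k : ℂ → ℂ} {z : ℂ}
    (hk : A.IsArrow b.1 c.1 k z)
    (hf : A.IsArrow c.1 a.1 f (k z)) (hz : z ∈ L.N b) (hkz : k z ∈ L.N c) (hfz : f (k z) ∈ D) :
    average L a q c f (k z) = L.g b c k z * average L a q b (f ∘ k) z := by
  unfold average
  rw [Finset.mul_sum]
  refine Finset.sum_congr rfl fun γ _ => ?_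
  have harr : A.IsArrow c.1 a.1 (A.act a.1 γ ∘ f) (k z) :=
    IsArrow.comp hf (isArrow_act γ.1 (hD.subset_U hfz))
  have hmem : (A.act a.1 γ ∘ f) (k z) ∈ L.N a := hD.subset (hD.act_mem γ.1 γ.2 _ hfz)
  have h1 := L.g_comp b c a k (A.act a.1 γ ∘ f) z hk harr hz hkz hmem
  have h2 := L.g_ne_zero b c k z hk hz hkz
  have h3 := L.g_ne_zero c a _ _ harr hkz hmem
  rw [← Function.comp_assoc, h1, Function.comp_apply]
  field_simp

/-- The average of a holomorphic multiple of a frame extends to a section over the image of an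
invariant neighbourhood `D`, except that it may vanish. -/
theorem exists_average_extension {L : A.LineBundle} {a : A.Pt} {D : Set ℂ}
    (hD : IsInvariantNhd a (L.N a) D) {q : ℂ → ℂ} :
    ∃ s : A.Pt → ℂ → ℂ,
      (∀ (b : A.Pt) (f : ℂ → ℂ) (z : ℂ), A.IsArrow b.1 a.1 f z → z ∈ L.N b → f z ∈ D →
        ∀ᶠ w in 𝓝 z, s b w = average L a q b f w) ∧
      ∀ (b c : A.Pt) (k : ℂ → ℂ) (z : ℂ), A.IsArrow b.1 c.1 k z → z ∈ L.N b → k z ∈ L.N c →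
        A.φ b.1 z ∈ A.φ a.1 '' D → ∀ᶠ w in 𝓝 z, s c (k w) = L.g b c k w * s b w := by
  classical
  have hex : ∀ (b : A.Pt) (z : ℂ), z ∈ A.U b.1 → A.φ b.1 z ∈ A.φ a.1 '' D →
      ∃ f, A.IsArrow b.1 a.1 f z ∧ f z ∈ D := by
    rintro b z hz ⟨v, hv, hvz⟩
    obtain ⟨f, hf, hfv⟩ := exists_isArrow hz (hD.subset_U hv) hvz.symm
    exact ⟨f, hf, hfv ▸ hv⟩
  have hev : ∀ (b : A.Pt) (f : ℂ → ℂ) (z : ℂ), A.IsArrow b.1 a.1 f z → z ∈ L.N b → f z ∈ D →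
      ∀ᶠ w in 𝓝 z, A.IsArrow b.1 a.1 f w ∧ w ∈ L.N b ∧ f w ∈ D := by
    intro b f z hf hz hfz
    filter_upwards [hf.eventually, (L.isOpen_N b).mem_nhds hz,
      hf.analyticAt.continuousAt.preimage_mem_nhds (hD.isOpen.mem_nhds hfz)] with w h1 h2 h3
    exact ⟨h1, h2, h3⟩
  set s : A.Pt → ℂ → ℂ := fun b z =>
    if h : ∃ f, A.IsArrow b.1 a.1 f z ∧ f z ∈ D then average L a q b h.choose z else 0 with hs
  have hval : ∀ (b : A.Pt) (f : ℂ → ℂ) (z : ℂ), A.IsArrow b.1 a.1 f z → z ∈ L.N b → f z ∈ D →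
      s b z = average L a q b f z := by
    intro b f z hf hz hfz
    have h : ∃ f, A.IsArrow b.1 a.1 f z ∧ f z ∈ D := ⟨f, hf, hfz⟩
    simp only [hs, dif_pos h]
    exact average_congr hD h.choose_spec.1 hf hz h.choose_spec.2 hfz
  refine ⟨s, fun b f z hf hz hfz => ?_, fun b c k z hk hz hkz hφ => ?_⟩
  · filter_upwards [hev b f z hf hz hfz] with w hw
    exact hval b f w hw.1 hw.2.1 hw.2.2
  · obtain ⟨f, hf, hfz⟩ := hex c (k z) hk.mem_target (by rwa [hk.φ_eq])
    filter_upwards [hk.eventually, (L.isOpen_N b).mem_nhds hz,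
      hk.analyticAt.continuousAt.eventually (hev c f (k z) hf hkz hfz)] with w h1 h2 h3
    rw [hval c f (k w) h3.1 h3.2.1 h3.2.2, average_comp hD h1 h3.1 h2 h3.2.1 h3.2.2,
      hval b (f ∘ k) w (IsArrow.comp h1 h3.1) h2 h3.2.2]

/-- Every line bundle has a rational section near every point of `X`: the average, over the
stabilizer, of a suitable multiple of a frame. -/
theorem exists_isSectionOn_nhd (L : A.LineBundle) (x : X) :
    ∃ (W : Set X) (s : A.Pt → ℂ → ℂ), IsOpen W ∧ x ∈ W ∧ IsSectionOn L W s := by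
  have := A.finite_G (A.lift x).1
  obtain ⟨D, hD⟩ := exists_isInvariantNhd (A.lift x) (L.isOpen_N _) (L.mem_N _)
  have hx := φ_lift (A := A) x
  set a := A.lift x with ha
  obtain ⟨ε, hε, hball⟩ := Metric.isOpen_iff.1 hD.isOpen _ hD.mem
  -- a point with a free orbit under the stabilizer
  obtain ⟨w₀, hw₀b, hw₀⟩ : ∃ w₀ ∈ Metric.ball (a.2 : ℂ) ε,
      ∀ γ : MulAction.stabilizer (A.G a.1) a.2, γ ≠ 1 → A.act a.1 γ w₀ ≠ w₀ := by
    have h1 : ∀ᶠ w in 𝓝[≠] (a.2 : ℂ), ∀ γ : MulAction.stabilizer (A.G a.1) a.2, γ ≠ 1 →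
        A.act a.1 γ w ≠ w := by
      rw [eventually_all]
      intro γ
      by_contra h
      rw [not_eventually] at h
      obtain ⟨w, hw⟩ := h.exists
      push Not at hw
      refine hw.1 (Subtype.ext (eq_of_frequently_act_eq a.2.2 (h.mp ?_)))
      filter_upwards [mem_nhdsWithin_of_mem_nhds ((A.isOpen_U a.1).mem_nhds a.2.2)] with w hwU hw
      push Not at hw
      rw [hw.2, Subgroup.coe_one, act_one hwU]
    obtain ⟨w, hw1, hw2⟩ := (h1.and (mem_nhdsWithin_of_mem_nhds
      (Metric.ball_mem_nhds (a.2 : ℂ) hε))).exists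
    exact ⟨w, hw2, hw1⟩
  classical
  -- at `w₀`, all terms of the average but one vanish for this `q`
  set q : ℂ → ℂ := fun w => ∏ γ ∈ (Finset.univ : Finset
    (MulAction.stabilizer (A.G a.1) a.2)).erase 1, (w - A.act a.1 γ w₀) with hq
  have hqa : ∀ z, AnalyticAt ℂ q z := fun z =>
    Finset.analyticAt_fun_prod _ fun γ _ => analyticAt_id.sub analyticAt_const
  obtain ⟨s, hs, hsc⟩ := exists_average_extension hD (q := q)
  have hw₀D := hball hw₀b
  have hav : average L a q a id w₀ ≠ 0 := by
    have harr : A.IsArrow a.1 a.1 (A.act a.1 1 ∘ id) w₀ :=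
      IsArrow.comp (isArrow_id (hD.subset_U hw₀D)) (isArrow_act 1 (hD.subset_U hw₀D))
    have hmem : (A.act a.1 1 ∘ id) w₀ ∈ L.N a := by
      rw [Function.comp_apply, id, act_one (hD.subset_U hw₀D)]
      exact hD.subset hw₀D
    unfold average
    rw [Finset.sum_eq_single 1]
    · refine mul_ne_zero (inv_ne_zero (L.g_ne_zero _ _ _ _ harr (hD.subset hw₀D) hmem)) ?_
      rw [id, Subgroup.coe_one, act_one (hD.subset_U hw₀D), hq]
      refine Finset.prod_ne_zero_iff.2 fun γ hγ => sub_ne_zero.2 ?_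
      exact (hw₀ γ (Finset.ne_of_mem_erase hγ)).symm
    · intro γ _ hγ
      have : q (A.act a.1 γ (id w₀)) = 0 :=
        Finset.prod_eq_zero (Finset.mem_erase.2 ⟨hγ, Finset.mem_univ γ⟩) (sub_self _)
      rw [this, mul_zero]
    · exact fun h => absurd (Finset.mem_univ _) h
  have hava : ∀ w ∈ D, AnalyticAt ℂ (average L a q a id) w := fun w hw =>
    average_analyticAt hD hqa (isArrow_id (hD.subset_U hw)) (hD.subset hw) hw
  have hsa : ∀ w ∈ D, s a =ᶠ[𝓝 w] average L a q a id := fun w hw =>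
    hs a id w (isArrow_id (hD.subset_U hw)) (hD.subset hw) hw
  -- by the identity theorem, the average does not vanish near `a`
  have hnz : MeromorphicNonzeroAt (s a) a.2 := by
    refine MeromorphicNonzeroAt.congr (f := average L a q a id)
      ⟨(hava _ hD.mem).meromorphicAt, ?_⟩ ((hsa _ hD.mem).symm.filter_mono nhdsWithin_le_nhds)
    exact MeromorphicOn.meromorphicOrderAt_ne_top_of_isPreconnected
      (U := Metric.ball (a.2 : ℂ) ε) (fun w hw => (hava w (hball hw)).meromorphicAt)
      (convex_ball _ _).isPreconnected hw₀b (Metric.mem_ball_self hε)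
      (MeromorphicNonzeroAt.of_analyticAt (hava w₀ hw₀D) hav).2
  obtain ⟨D', hD', hD'o, haD'⟩ := mem_nhds_iff.1 (inter_mem (hD.isOpen.mem_nhds hD.mem)
    (eventually_nhdsWithin_iff.1 hnz.eventually_ne_zero))
  have hnzD : ∀ w ∈ D', MeromorphicNonzeroAt (s a) w := by
    intro w hw
    have hm : AnalyticAt ℂ (s a) w := (hava w (hD' hw).1).congr (hsa w (hD' hw).1).symm
    by_cases h : w = a.2
    · rw [h]; exact hnz
    · exact .of_analyticAt hm ((hD' hw).2 h)
  refine ⟨A.φ a.1 '' D', s, A.isOpen_image _ _ (fun w hw => hD.subset_U (hD' hw).1) hD'o,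
    ⟨a.2, haD', hx⟩, ?_, ?_⟩
  · rintro b z hz ⟨v, hv, hvz⟩
    have hvD := (hD' hv).1
    have hzU := L.N_subset b hz
    obtain ⟨f, hf, hfv⟩ := exists_isArrow hzU (hD.subset_U hvD) hvz.symm
    have hfz : f z ∈ L.N a := hfv ▸ hD.subset hvD
    have hc := hsc b a f z hf hz hfz ⟨v, hvD, hvz⟩
    have h1 : MeromorphicNonzeroAt (s a ∘ f) z :=
      MeromorphicNonzeroAt.comp_of_deriv_ne_zero (hfv ▸ hnzD v hv) hf.analyticAt hf.deriv_ne_zero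
    have hga := L.g_analytic b a f z hf hz hfz
    have hg0 := L.g_ne_zero b a f z hf hz hfz
    refine ((MeromorphicNonzeroAt.of_analyticAt hga hg0).inv.mul h1).congr ?_
    filter_upwards [hc.filter_mono nhdsWithin_le_nhds,
      (hga.continuousAt.eventually_ne hg0).filter_mono nhdsWithin_le_nhds] with w hw hw0
    rw [Function.comp_apply, hw, inv_mul_cancel_left₀ hw0]
  · rintro b c k z hk hz hkz ⟨v, hv, hvz⟩
    exact (hsc b c k z hk hz hkz ⟨v, (hD' hv).1, hvz⟩).filter_mono nhdsWithin_le_nhds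

end OrbifoldAtlas

/-! ### Meromorphic functions up to their values at poles and removable singularities -/

/-- The limit of `f` at `z` along the punctured neighbourhoods of `z` (a junk value if there is no
limit). It depends only on the germ of `f` outside `z`. -/
noncomputable def puncturedLim (f : ℂ → ℂ) (z : ℂ) : ℂ := limUnder (𝓝[≠] z) f

theorem puncturedLim_congr {f g : ℂ → ℂ} {z : ℂ} (h : f =ᶠ[𝓝[≠] z] g) :
    puncturedLim f z = puncturedLim g z := by
  rw [puncturedLim, puncturedLim, limUnder, limUnder, Filter.map_congr h]

theorem puncturedLim_of_continuousAt {f : ℂ → ℂ} {z : ℂ} (hf : ContinuousAt f z) :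
    puncturedLim f z = f z :=
  (hf.tendsto.mono_left nhdsWithin_le_nhds).limUnder_eq

/-- Locally injective holomorphic functions preserve punctured neighbourhoods. -/
theorem map_nhdsNE_eq {f : ℂ → ℂ} {z : ℂ} (hf : AnalyticAt ℂ f z) (hf' : deriv f z ≠ 0) :
    map f (𝓝[≠] z) = 𝓝[≠] (f z) := by
  refine le_antisymm (tendsto_nhdsWithin_of_tendsto_nhds_of_eventually_within _
    (hf.continuousAt.tendsto.mono_left nhdsWithin_le_nhds)
    (hf.differentiableAt.hasDerivAt.eventually_ne hf')) ?_
  intro t ht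
  have h1 : insert z (f ⁻¹' t) ∈ 𝓝 z := insert_mem_nhds_iff.2 ht
  have h2 : map f (𝓝 z) = 𝓝 (f z) :=
    hf.hasStrictDerivAt.map_nhds_eq hf'
  have h3 : f '' insert z (f ⁻¹' t) ∈ 𝓝 (f z) := h2 ▸ image_mem_map h1
  refine insert_mem_nhds_iff.1 (mem_of_superset h3 ?_)
  rintro _ ⟨w, rfl | hw, rfl⟩
  exacts [Or.inl rfl, Or.inr hw]

theorem puncturedLim_comp {f g : ℂ → ℂ} {z : ℂ} (hf : AnalyticAt ℂ f z) (hf' : deriv f z ≠ 0) :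
    puncturedLim (g ∘ f) z = puncturedLim g (f z) := by
  rw [puncturedLim, puncturedLim, limUnder, limUnder, ← Filter.map_map, map_nhdsNE_eq hf hf']

theorem MeromorphicNonzeroAt.eventually_puncturedLim_eq {f : ℂ → ℂ} {z : ℂ}
    (hf : MeromorphicNonzeroAt f z) : ∀ᶠ w in 𝓝[≠] z, puncturedLim f w = f w := by
  filter_upwards [hf.eventually_analyticAt] with w hw
  exact puncturedLim_of_continuousAt hw.1.continuousAt

namespace OrbifoldAtlas

variable {X : Type*} [TopologicalSpace X] {A : OrbifoldAtlas X}

/-! ### Gluing rational sections -/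

/-- Meromorphic functions on the charts which are compatible with the local embeddings descend to a
function on `X`. -/
theorem exists_descent {M : A.Pt → Set ℂ} (hM : ∀ a, IsOpen (M a)) (hm : ∀ a, (a.2 : ℂ) ∈ M a)
    (hMU : ∀ a, M a ⊆ A.U a.1) {W : Set X} (hW : IsOpen W) {r : A.Pt → ℂ → ℂ}
    (hr : ∀ a, ∀ z ∈ M a, A.φ a.1 z ∈ W → MeromorphicNonzeroAt (r a) z)
    (hrc : ∀ a b f z, A.IsArrow a.1 b.1 f z → z ∈ M a → f z ∈ M b → A.φ a.1 z ∈ W →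
      ∀ᶠ w in 𝓝[≠] z, r b (f w) = r a w) :
    ∃ F : X → ℂ,
      (∀ i, ∀ z ∈ A.U i, A.φ i z ∈ W → MeromorphicNonzeroAt (fun w => F (A.φ i w)) z) ∧
      ∀ a, ∀ z ∈ M a, A.φ a.1 z ∈ W → ∀ᶠ w in 𝓝[≠] z, r a w = F (A.φ a.1 w) := by
  set F : X → ℂ := fun x => puncturedLim (r (A.lift x)) (A.lift x).2 with hF
  have h1 : ∀ a, ∀ z ∈ M a, A.φ a.1 z ∈ W → F (A.φ a.1 z) = puncturedLim (r a) z := by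
    intro a z hz hzW
    obtain ⟨f, hf, hfz⟩ := exists_isArrow (hMU a hz) (A.lift (A.φ a.1 z)).2.2 (φ_lift _).symm
    have h2 := hrc a _ f z hf hz (by rw [hfz]; exact hm _) hzW
    rw [← puncturedLim_congr h2]
    change _ = puncturedLim (r _ ∘ f) z
    rw [puncturedLim_comp hf.analyticAt hf.deriv_ne_zero, hfz]
  have h2 : ∀ a, ∀ z ∈ M a, A.φ a.1 z ∈ W → ∀ᶠ w in 𝓝[≠] z, r a w = F (A.φ a.1 w) := by
    intro a z hz hzW
    filter_upwards [(hr a z hz hzW).eventually_puncturedLim_eq,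
      ((hM a).mem_nhds hz |> mem_nhdsWithin_of_mem_nhds),
      (eventually_φ_mem (hMU a hz) hW hzW).filter_mono nhdsWithin_le_nhds] with w h3 h4 h5
    rw [h1 a w h4 h5, h3]
  refine ⟨F, fun i z hz hzW => ?_, h2⟩
  exact (hr ⟨i, z, hz⟩ z (hm ⟨i, z, hz⟩) hzW).congr (h2 ⟨i, z, hz⟩ z (hm ⟨i, z, hz⟩) hzW)

/-- The quotient of sections of isomorphic line bundles is a function on `X`. -/
theorem exists_ratio {L L' : A.LineBundle} {M : A.Pt → Set ℂ} {k : A.Pt → ℂ → ℂ}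
    (hM : ∀ a, IsOpen (M a)) (hm : ∀ a, (a.2 : ℂ) ∈ M a) (hMN : ∀ a, M a ⊆ L.N a ∩ L'.N a)
    (hk : ∀ a, ∀ z ∈ M a, AnalyticAt ℂ (k a) z ∧ k a z ≠ 0)
    (hkc : ∀ a b f z, A.IsArrow a.1 b.1 f z → z ∈ M a → f z ∈ M b →
      k b (f z) * L.g a b f z = L'.g a b f z * k a z)
    {W : Set X} (hW : IsOpen W) {s s' : A.Pt → ℂ → ℂ} (hs : IsSectionOn L W s)
    (hs' : IsSectionOn L' W s') :
    ∃ F : X → ℂ,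
      (∀ i, ∀ z ∈ A.U i, A.φ i z ∈ W → MeromorphicNonzeroAt (fun w => F (A.φ i w)) z) ∧
      ∀ a, ∀ z ∈ M a, A.φ a.1 z ∈ W →
        ∀ᶠ w in 𝓝[≠] z, k a w * s a w = F (A.φ a.1 w) * s' a w := by
  obtain ⟨F, hF, hF'⟩ := exists_descent hM hm (fun a z hz => L.N_subset a (hMN a hz).1) hW
    (r := fun a w => k a w * s a w * (s' a w)⁻¹)
    (fun a z hz hzW => ((MeromorphicNonzeroAt.of_analyticAt (hk a z hz).1 (hk a z hz).2).mul
      (hs.nonzeroAt a z (hMN a hz).1 hzW)).mul (hs'.nonzeroAt a z (hMN a hz).2 hzW).inv)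
    (fun a b f z hf hz hfz hzW => by
      filter_upwards [hs.compatible a b f z hf (hMN a hz).1 (hMN b hfz).1 hzW,
        hs'.compatible a b f z hf (hMN a hz).2 (hMN b hfz).2 hzW,
        (hs'.nonzeroAt a z (hMN a hz).2 hzW).eventually_ne_zero,
        hf.eventually.filter_mono nhdsWithin_le_nhds,
        mem_nhdsWithin_of_mem_nhds ((hM a).mem_nhds hz),
        mem_nhdsWithin_of_mem_nhds
          (hf.analyticAt.continuousAt.preimage_mem_nhds ((hM b).mem_nhds hfz))]
        with w h1 h2 h3 h4 h5 h6
      have h7 := hkc a b f w h4 h5 h6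
      have h8 := L'.g_ne_zero a b f w h4 (hMN a h5).2 (hMN b h6).2
      rw [h1, h2]
      field_simp
      linear_combination s a w * h7)
  refine ⟨F, hF, fun a z hz hzW => ?_⟩
  filter_upwards [hF' a z hz hzW, (hs'.nonzeroAt a z (hMN a hz).2 hzW).eventually_ne_zero]
    with w h1 h2
  rw [← h1]
  field_simp

theorem IsSectionOn.smul {L : A.LineBundle} {W W' : Set X} {s : A.Pt → ℂ → ℂ}
    (hs : IsSectionOn L W s) (hW : W' ⊆ W) {F : X → ℂ}
    (hF : ∀ i, ∀ z ∈ A.U i, A.φ i z ∈ W' → MeromorphicNonzeroAt (fun w => F (A.φ i w)) z) :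
    IsSectionOn L W' fun a z => F (A.φ a.1 z) * s a z where
  nonzeroAt a z hz hw := (hF a.1 z (L.N_subset a hz) hw).mul (hs.nonzeroAt a z hz (hW hw))
  compatible a b f z hf hz hfz hw := by
    filter_upwards [hs.compatible a b f z hf hz hfz (hW hw),
      hf.comm.filter_mono nhdsWithin_le_nhds] with w h1 h2
    rw [h1, h2]
    ring

theorem IsSectionOn.congr {L : A.LineBundle} {W : Set X} {s s' : A.Pt → ℂ → ℂ}
    (hs : IsSectionOn L W s)
    (h : ∀ a, ∀ z ∈ L.N a, A.φ a.1 z ∈ W → s a =ᶠ[𝓝[≠] z] s' a) : IsSectionOn L W s' where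
  nonzeroAt a z hz hw := (hs.nonzeroAt a z hz hw).congr (h a z hz hw)
  compatible a b f z hf hz hfz hw := by
    filter_upwards [hs.compatible a b f z hf hz hfz hw, h a z hz hw,
      hf.tendsto_nhdsNE.eventually (h b (f z) hfz (by rwa [hf.φ_eq]))] with w h1 h2 h3
    rw [← h2, ← h3, h1]

/-- Sections over two open sets which agree over the intersection can be glued. -/
theorem exists_glue {L : A.LineBundle} {W₁ W₂ : Set X} (hW₁ : IsOpen W₁) (hW₂ : IsOpen W₂)
    {s₁ s₂ : A.Pt → ℂ → ℂ} (hs₁ : IsSectionOn L W₁ s₁) (hs₂ : IsSectionOn L W₂ s₂)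
    (h : ∀ a, ∀ z ∈ L.N a, A.φ a.1 z ∈ W₁ ∩ W₂ → s₁ a =ᶠ[𝓝[≠] z] s₂ a) :
    ∃ s, IsSectionOn L (W₁ ∪ W₂) s := by
  classical
  set s : A.Pt → ℂ → ℂ := fun a z =>
    if A.φ a.1 z ∈ W₁ then puncturedLim (s₁ a) z else puncturedLim (s₂ a) z
  have h1 : IsSectionOn L W₁ s := hs₁.congr fun a z hz hw => by
    filter_upwards [(hs₁.nonzeroAt a z hz hw).eventually_puncturedLim_eq,
      (eventually_φ_mem (L.N_subset a hz) hW₁ hw).filter_mono nhdsWithin_le_nhds] with w h3 h4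
    simp only [s]
    rw [if_pos h4, h3]
  have h2 : IsSectionOn L W₂ s := hs₂.congr fun a z hz hw => by
    filter_upwards [(hs₂.nonzeroAt a z hz hw).eventually_puncturedLim_eq,
      (eventually_φ_mem (L.N_subset a hz) hW₂ hw).filter_mono nhdsWithin_le_nhds,
      mem_nhdsWithin_of_mem_nhds ((L.isOpen_N a).mem_nhds hz)] with w h3 h4 h5
    simp only [s]
    split_ifs with h6
    · rw [puncturedLim_congr (h a w h5 ⟨h6, h4⟩), h3]
    · rw [h3]
  exact ⟨s, fun a z hz hw => hw.elim (h1.nonzeroAt a z hz) (h2.nonzeroAt a z hz),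
    fun a b f z hf hz hfz hw =>
      hw.elim (h1.compatible a b f z hf hz hfz) (h2.compatible a b f z hf hz hfz)⟩

/-! ### Global existence of rational sections -/

variable {h : X ≃ₜ OnePoint ℂ}

theorem IsSphereIso.pullback_coe (hh : A.IsSphereIso h) {F : OnePoint ℂ → ℂ} {V : Set ℂ}
    (hF : ∀ z ∈ V, MeromorphicNonzeroAt (fun w => F (w : OnePoint ℂ)) z) {i : A.ι} {u : ℂ}
    (hu : u ∈ A.U i) (hV : h (A.φ i u) ∈ ((↑) : ℂ → OnePoint ℂ) '' V) :
    MeromorphicNonzeroAt (fun z => F (h (A.φ i z))) u := by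
  obtain ⟨z, hz, hzu⟩ := hV
  refine (hh.pullback hu ?_).1
  rw [← hzu]
  exact sphereMeromorphicAt_coe.2 (hF z hz)

/-- Cousin's theorem glues a section near a compact part of the plane with a section near a closed
part of the plane. The set `E` is either empty or consists of the point at infinity, and is added
to the domain of the section if the closed part is a neighbourhood of infinity. -/
theorem IsSphereIso.exists_isSectionOn_union (hh : A.IsSphereIso h) (L : A.LineBundle)
    {K₁ K₂ : Set ℂ} (hK₁ : IsCompact K₁) (hK₂ : IsClosed K₂) {W₁ W₂ : Set X}
    (hW₁ : IsOpen W₁) (hW₂ : IsOpen W₂) (hKW₁ : ∀ z ∈ K₁, h.symm z ∈ W₁)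
    (hKW₂ : ∀ z ∈ K₂, h.symm z ∈ W₂) (E : Set X) (hE : E ⊆ {h.symm OnePoint.infty} ∩ W₂)
    (hEo : E.Nonempty → K₂ ∈ cocompact ℂ) {s₁ s₂ : A.Pt → ℂ → ℂ}
    (hs₁ : IsSectionOn L W₁ s₁) (hs₂ : IsSectionOn L W₂ s₂) :
    ∃ W s, IsOpen W ∧ E ⊆ W ∧ (∀ z ∈ K₁ ∪ K₂, h.symm z ∈ W) ∧ IsSectionOn L W s := by
  obtain ⟨F, hF, hFs⟩ := exists_ratio (L := L) (L' := L) (M := L.N) (k := fun _ _ => 1)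
    L.isOpen_N L.mem_N (fun a => by simp) (fun _ _ _ => ⟨analyticAt_const, one_ne_zero⟩)
    (fun a b f z _ _ _ => by ring) (hW₁.inter hW₂) (hs₁.mono Set.inter_subset_left)
    (hs₂.mono Set.inter_subset_right)
  have hcont : Continuous fun z : ℂ => h.symm (z : OnePoint ℂ) :=
    h.symm.continuous.comp OnePoint.continuous_coe
  set V : Set ℂ := {z | h.symm (z : OnePoint ℂ) ∈ W₁ ∩ W₂}
  obtain ⟨V₁, V₂, f₁, f₂, hV₁, hV₂, hKV₁, hKV₂, hVV, hf₁, hf₂, hf₂i, hff⟩ :=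
    multiplicative_cousin hK₁ hK₂ (V := V) ((hW₁.inter hW₂).preimage hcont)
      (fun z hz => ⟨hKW₁ z hz.1, hKW₂ z hz.2⟩) (f := fun z => F (h.symm z)) (fun z hz => by
        set a := A.lift (h.symm z)
        have ha : A.φ a.1 a.2 = h.symm z := φ_lift _
        have h1 := hF a.1 a.2 a.2.2 (by rw [ha]; exact hz)
        have h2 := hh.sphereMeromorphicAt (F := fun c => F (h.symm c)) a.2.2
          (by simpa using h1)
        rw [ha, h.apply_symm_apply] at h2
        exact sphereMeromorphicAt_coe.1 h2)
  -- the functions of Cousin's theorem on the sphere; the values at infinity do not matter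
  set F₁ : OnePoint ℂ → ℂ := fun c => (c.elim 0 f₁)⁻¹ with hF₁
  set F₂ : OnePoint ℂ → ℂ := fun c => (c.elim 0 f₂)⁻¹ with hF₂
  set W₁' : Set X := W₁ ∩ h ⁻¹' ((↑) '' V₁) with hW₁'
  set W₂' : Set X := W₂ ∩ h ⁻¹' ((↑) '' V₂) with hW₂'
  have hW₁o : IsOpen W₁' :=
    hW₁.inter ((OnePoint.isOpenEmbedding_coe.isOpenMap _ hV₁).preimage h.continuous)
  have hW₂o : IsOpen (W₂' ∪ E) := by
    rcases E.eq_empty_or_nonempty with rfl | hEn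
    · rw [Set.union_empty]
      exact hW₂.inter ((OnePoint.isOpenEmbedding_coe.isOpenMap _ hV₂).preimage h.continuous)
    · have hEe : E = {h.symm OnePoint.infty} :=
        (Set.subset_singleton_iff_eq.1 fun x hx => (hE hx).1).resolve_left hEn.ne_empty
      have h1 : W₂' ∪ E = W₂ ∩ h ⁻¹' ((↑) '' V₂ ∪ {OnePoint.infty}) := by
        ext x
        have h3 : h.symm OnePoint.infty ∈ W₂ := (hE (by rw [hEe]; rfl)).2
        have h4 : x = h.symm OnePoint.infty ↔ h x = OnePoint.infty := by
          rw [← h.eq_symm_apply]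
        rw [hEe]
        simp only [hW₂', Set.mem_union, Set.mem_inter_iff, Set.mem_preimage, Set.mem_singleton_iff,
          h4]
        have h5 : h x = OnePoint.infty → x ∈ W₂ := fun hx => h4.2 hx ▸ h3
        tauto
      rw [h1]
      refine hW₂.inter (IsOpen.preimage h.continuous ?_)
      rw [OnePoint.isOpen_iff_of_mem (by simp)]
      have h2 : (((↑) : ℂ → OnePoint ℂ) ⁻¹' ((↑) '' V₂ ∪ {OnePoint.infty})) = V₂ := by
        ext z
        simp
      rw [h2]
      refine ⟨hV₂.isClosed_compl, ?_⟩
      obtain ⟨C, hC, hCK⟩ := mem_cocompact.1 (hEo hEn)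
      exact hC.of_isClosed_subset hV₂.isClosed_compl fun z hz => by
        by_contra hzC
        exact hz (hKV₂ (hCK hzC))
  have h1 : IsSectionOn L W₁' fun a z => F₁ (h (A.φ a.1 z)) * s₁ a z :=
    hs₁.smul (F := fun x => F₁ (h x)) Set.inter_subset_left fun i z hz hw =>
      hh.pullback_coe (F := F₁) (fun w hw => (hf₁ w hw).inv) hz hw.2
  have h2 : IsSectionOn L (W₂' ∪ E) fun a z => F₂ (h (A.φ a.1 z)) * s₂ a z := by
    refine hs₂.smul (F := fun x => F₂ (h x))
      (Set.union_subset Set.inter_subset_left fun x hx => (hE hx).2) fun i z hz hw => ?_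
    rcases hw with hw | hw
    · exact hh.pullback_coe (F := F₂) (fun w hw => (hf₂ w hw).inv) hz hw.2
    · refine (hh.pullback hz ?_).1
      rw [show A.φ i z = h.symm OnePoint.infty from (hE hw).1, h.apply_symm_apply]
      exact sphereMeromorphicAt_infty.2 hf₂i.inv
  obtain ⟨s, hs⟩ := exists_glue hW₁o hW₂o h1 h2 (by
    rintro a z hz ⟨⟨hz1, v, hv, hvz⟩, hz2⟩
    have hz2' : A.φ a.1 z ∈ W₂' := by
      refine hz2.resolve_right fun hzE => ?_
      rw [(hE hzE).1, h.apply_symm_apply] at hvz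
      exact OnePoint.coe_ne_infty _ hvz
    obtain ⟨hz2, v', hv', hvz'⟩ := hz2'
    obtain rfl : v = v' := OnePoint.coe_injective (hvz.trans hvz'.symm)
    have hVV' : ∀ᶠ w in 𝓝[≠] v, f₁ w = F (h.symm w) * f₂ w := hff v ⟨hv, hv'⟩
    have hsph : SphereMeromorphicAt (fun c => c.elim 0 f₁) (h (A.φ a.1 z)) := by
      rw [← hvz]
      exact sphereMeromorphicAt_coe.2 (hf₁ v hv)
    have hne1 := (hh.pullback (L.N_subset a hz) hsph).1.eventually_ne_zero
    have htend : Tendsto (fun w => h (A.φ a.1 w)) (𝓝[≠] z) (𝓝[≠] (v : OnePoint ℂ)) := by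
      rw [hvz]
      refine tendsto_nhdsWithin_of_tendsto_nhds_of_eventually_within _
        ((h.continuous.continuousAt.comp
          (continuousAt_φ (L.N_subset a hz))).tendsto.mono_left nhdsWithin_le_nhds) ?_
      filter_upwards [eventually_φ_ne (L.N_subset a hz)] with w hw heq
      exact hw (h.injective heq)
    have hVV'' : ∀ᶠ c in 𝓝[≠] (v : OnePoint ℂ), ∃ w : ℂ, (w : OnePoint ℂ) = c ∧
        f₁ w = F (h.symm w) * f₂ w := by
      have hpre : ((↑) : ℂ → OnePoint ℂ) ⁻¹' {(v : OnePoint ℂ)}ᶜ = {v}ᶜ := by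
        ext w
        simp
      rw [OnePoint.nhdsWithin_coe, hpre, eventually_map]
      filter_upwards [hVV'] with w hw using ⟨w, rfl, hw⟩
    filter_upwards [hFs a z hz ⟨hz1, hz2⟩, htend.eventually hVV'', hne1] with w h3 h4 h5
    obtain ⟨w', hw', h4⟩ := h4
    rw [one_mul] at h3
    rw [← hw'] at h5 ⊢
    have h6 : h.symm w' = A.φ a.1 w := by rw [hw', h.symm_apply_apply]
    rw [h6] at h4
    change f₁ w' ≠ 0 at h5
    change (f₁ w')⁻¹ * _ = (f₂ w')⁻¹ * _
    rw [h3, h4]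
    have h7 : F (A.φ a.1 w) ≠ 0 := fun h0 => h5 (by rw [h4, h0, zero_mul])
    have h8 : f₂ w' ≠ 0 := fun h0 => h5 (by rw [h4, h0, mul_zero])
    field_simp)
  refine ⟨_, s, hW₁o.union hW₂o, fun x hx => Or.inr (Or.inr hx), ?_, hs⟩
  rintro z (hz | hz)
  · exact Or.inl ⟨hKW₁ z hz, z, hKV₁ hz, by simp⟩
  · exact Or.inr (Or.inl ⟨hKW₂ z hz, z, hKV₂ hz, by simp⟩)

/-- Every line bundle has a rational section. -/
theorem IsSphereIso.nonempty_rationalSection (hh : A.IsSphereIso h) (L : A.LineBundle) :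
    Nonempty (RationalSection L) := by
  have hcont : Continuous fun z : ℂ => h.symm (z : OnePoint ℂ) :=
    h.symm.continuous.comp OnePoint.continuous_coe
  -- sections near compact subsets of the plane, by adding small compact sets one by one
  have hcompact : ∀ K : Set ℂ, IsCompact K → ∃ K', K ⊆ K' ∧ IsCompact K' ∧
      ∃ W s, IsOpen W ∧ (∀ z ∈ K', h.symm z ∈ W) ∧ IsSectionOn L W s := by
    intro K hK
    refine hK.induction_on (p := fun K => ∃ K', K ⊆ K' ∧ IsCompact K' ∧
      ∃ W s, IsOpen W ∧ (∀ z ∈ K', h.symm z ∈ W) ∧ IsSectionOn L W s) ?_ ?_ ?_ ?_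
    · exact ⟨∅, subset_rfl, isCompact_empty, ∅, 0, isOpen_empty, by simp,
        fun _ _ _ hw => hw.elim, fun _ _ _ _ _ _ _ hw => hw.elim⟩
    · rintro S T hST ⟨K', hK', hh'⟩
      exact ⟨K', hST.trans hK', hh'⟩
    · rintro S T ⟨K, hSK, hK, W, s, hW, hKW, hs⟩ ⟨K', hTK, hK', W', s', hW', hKW', hs'⟩
      obtain ⟨W'', s'', hW'', -, hKW'', hs''⟩ := hh.exists_isSectionOn_union L hK hK'.isClosed
        hW hW' hKW hKW' ∅ (Set.empty_subset _) (by simp) hs hs'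
      exact ⟨K ∪ K', Set.union_subset_union hSK hTK, hK.union hK', W'', s'', hW'', hKW'', hs''⟩
    · intro z _
      obtain ⟨W, s, hW, hzW, hs⟩ := exists_isSectionOn_nhd L (h.symm z)
      obtain ⟨K', hK', hzK', hKW⟩ := exists_compact_subset (hW.preimage hcont) hzW
      exact ⟨K', mem_nhdsWithin_of_mem_nhds (mem_interior_iff_mem_nhds.1 hzK'), K', subset_rfl,
        hK', W, s, hW, fun w hw => hKW hw, hs⟩
  -- it remains to add a neighbourhood of infinity
  obtain ⟨W₂, s₂, hW₂, hiW₂, hs₂⟩ := exists_isSectionOn_nhd L (h.symm OnePoint.infty)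
  have hopen : IsOpen (h.symm ⁻¹' W₂) := hW₂.preimage h.symm.continuous
  have hC := ((OnePoint.isOpen_iff_of_mem hiW₂).1 hopen).2
  obtain ⟨R, hR⟩ := hC.isBounded.subset_ball 0
  obtain ⟨K', hK', hK'c, W₁, s₁, hW₁, hKW₁, hs₁⟩ := hcompact _ (isCompact_closedBall (0 : ℂ) R)
  obtain ⟨W, s, hW, hEW, hKW, hs⟩ := hh.exists_isSectionOn_union L hK'c
    (K₂ := (Metric.ball (0 : ℂ) R)ᶜ) Metric.isOpen_ball.isClosed_compl hW₁ hW₂ hKW₁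
    (fun z hz => by
      by_contra hzW
      exact hz (hR hzW)) {h.symm OnePoint.infty} (by simpa using hiW₂)
    (fun _ => mem_cocompact.2 ⟨_, isCompact_closedBall (0 : ℂ) R,
      Set.compl_subset_compl.2 Metric.ball_subset_closedBall⟩) hs₁ hs₂
  have huniv : W = Set.univ := by
    refine Set.eq_univ_of_forall fun x => ?_
    obtain ⟨c, rfl⟩ := h.symm.surjective x
    induction c with
    | infty => exact hEW rfl
    | coe z =>
      refine hKW z ?_
      by_cases hz : z ∈ Metric.ball (0 : ℂ) R
      · exact Or.inl (hK' (Metric.ball_subset_closedBall hz))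
      · exact Or.inr hz
  exact ⟨(huniv ▸ hs : IsSectionOn L Set.univ s).toRationalSection⟩

end OrbifoldAtlas

/-! ### Divisors of rational sections -/

theorem puncturedLim_eventuallyEq {f g : ℂ → ℂ} {z : ℂ} (hg : AnalyticAt ℂ g z)
    (h : f =ᶠ[𝓝[≠] z] g) : puncturedLim f =ᶠ[𝓝 z] g := by
  have h1 : ∀ᶠ y in 𝓝 z, y ≠ z → ∀ᶠ w in 𝓝[≠] y, f w = g w := by
    refine eventually_nhdsWithin_iff.1 (?_ : ∀ᶠ y in 𝓝[≠] z, ∀ᶠ w in 𝓝[≠] y, f w = g w)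
    filter_upwards [eventually_eventually_nhdsWithin.2 h, self_mem_nhdsWithin] with y hy hyz
    rw [isOpen_compl_singleton.nhdsWithin_eq hyz] at hy
    exact hy.filter_mono nhdsWithin_le_nhds
  filter_upwards [h1, hg.eventually_analyticAt] with y hy hgy
  have h2 : f =ᶠ[𝓝[≠] y] g := by
    by_cases hyz : y = z
    · rwa [hyz]
    · exact hy hyz
  rw [puncturedLim_congr h2, puncturedLim_of_continuousAt hgy.continuousAt]

namespace MeromorphicNonzeroAt

variable {f g : ℂ → ℂ} {z : ℂ}

theorem exists_analyticAt_of_intOrderAt_eq_zero (hf : MeromorphicNonzeroAt f z)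
    (h0 : intOrderAt f z = 0) :
    ∃ g, AnalyticAt ℂ g z ∧ g z ≠ 0 ∧ f =ᶠ[𝓝[≠] z] g ∧ puncturedLim f =ᶠ[𝓝 z] g := by
  have h1 := hf.coe_intOrderAt
  rw [h0] at h1
  obtain ⟨g, hg, hgz, hfg⟩ := (meromorphicOrderAt_eq_int_iff hf.1).1 h1.symm
  have hfg' : f =ᶠ[𝓝[≠] z] g := by
    filter_upwards [hfg] with w hw
    simpa using hw
  exact ⟨g, hg, hgz, hfg', puncturedLim_eventuallyEq hg hfg'⟩

theorem analyticAt_puncturedLim (hf : MeromorphicNonzeroAt f z) (h0 : intOrderAt f z = 0) :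
    AnalyticAt ℂ (puncturedLim f) z ∧ puncturedLim f z ≠ 0 := by
  obtain ⟨g, hg, hgz, -, h⟩ := hf.exists_analyticAt_of_intOrderAt_eq_zero h0
  exact ⟨hg.congr h.symm, by rwa [h.eq_of_nhds]⟩

theorem tendsto_puncturedLim (hf : MeromorphicNonzeroAt f z) (h0 : intOrderAt f z = 0) :
    Tendsto f (𝓝[≠] z) (𝓝 (puncturedLim f z)) := by
  obtain ⟨g, hg, -, h1, h⟩ := hf.exists_analyticAt_of_intOrderAt_eq_zero h0
  rw [h.eq_of_nhds]
  exact (hg.continuousAt.tendsto.mono_left nhdsWithin_le_nhds).congr' h1.symm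

theorem puncturedLim_mul (hf : MeromorphicNonzeroAt f z) (h0 : intOrderAt f z = 0)
    (hg : MeromorphicNonzeroAt g z) (hg0 : intOrderAt g z = 0) :
    puncturedLim (fun w => f w * g w) z = puncturedLim f z * puncturedLim g z :=
  ((hf.tendsto_puncturedLim h0).mul (hg.tendsto_puncturedLim hg0)).limUnder_eq

end MeromorphicNonzeroAt

namespace OrbifoldAtlas

variable {X : Type*} [TopologicalSpace X] {A : OrbifoldAtlas X}

namespace RationalSection

variable {L L' : A.LineBundle}

theorem nonzeroAt (s : RationalSection L) {a : A.Pt} {z : ℂ} (hz : z ∈ L.N a) :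
    MeromorphicNonzeroAt (s.s a) z := ⟨s.meromorphic a z hz, s.order_ne_top a z hz⟩

/-- The order of a section at a point of `X` can be computed in any chart. -/
theorem intOrderAt_eq_ord (s : RationalSection L) {a : A.Pt} {z : ℂ} (hz : z ∈ L.N a) :
    intOrderAt (s.s a) z = s.ord (A.φ a.1 z) := by
  set b := A.lift (A.φ a.1 z) with hb
  obtain ⟨f, hf, hfz⟩ := exists_isArrow (L.N_subset a hz) b.2.2 (φ_lift _).symm
  have hfN : f z ∈ L.N b := by rw [hfz]; exact L.mem_N b
  have hg := MeromorphicNonzeroAt.of_analyticAt (L.g_analytic a b f z hf hz hfN)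
    (L.g_ne_zero a b f z hf hz hfN)
  have h1 : intOrderAt (s.s b ∘ f) z = intOrderAt (s.s a) z := by
    refine (intOrderAt_congr (s.compatible a b f z hf hz hfN)).trans ?_
    rw [hg.intOrderAt_mul (s.nonzeroAt hz),
      intOrderAt_of_analyticAt (L.g_analytic a b f z hf hz hfN) (L.g_ne_zero a b f z hf hz hfN),
      zero_add]
  rw [← h1, intOrderAt_comp_of_deriv_ne_zero hf.analyticAt hf.deriv_ne_zero, hfz]
  rfl

theorem finite_support_ord [CompactSpace X] (s : RationalSection L) :
    (Function.support s.ord).Finite := by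
  have h1 : ∀ x : X, ∃ W, IsOpen W ∧ x ∈ W ∧ ∀ y ∈ W, y ≠ x → s.ord y = 0 := by
    intro x
    set a := A.lift x with ha
    have h2 := (s.nonzeroAt (L.mem_N a)).eventually_analyticAt
    obtain ⟨O, hO, hOo, haO⟩ := mem_nhds_iff.1 (inter_mem (eventually_nhdsWithin_iff.1 h2)
      ((L.isOpen_N a).mem_nhds (L.mem_N a)))
    refine ⟨A.φ a.1 '' O, A.isOpen_image a.1 O (fun w hw => L.N_subset a (hO hw).2) hOo,
      ⟨a.2, haO, φ_lift x⟩, ?_⟩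
    rintro _ ⟨w, hw, rfl⟩ hne
    have h3 : w ≠ a.2 := fun h => hne (by rw [h, φ_lift x])
    obtain ⟨h4, h5⟩ := (hO hw).1 h3
    rw [← s.intOrderAt_eq_ord (hO hw).2, intOrderAt_of_analyticAt h4 h5]
  choose W hW hxW hWs using h1
  obtain ⟨t, ht⟩ := isCompact_univ.elim_finite_subcover W hW
    fun x _ => Set.mem_iUnion.2 ⟨x, hxW x⟩
  refine t.finite_toSet.subset fun y hy => ?_
  obtain ⟨x, hx, hyx⟩ := Set.mem_iUnion₂.1 (ht (Set.mem_univ y))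
  by_cases h : y = x
  · rwa [h]
  · exact absurd (hWs x y hyx h) hy

/-- A line bundle with a section without zeros and poles is trivial. -/
theorem iso_trivial (s : RationalSection L) (hs : s.ord = 0) :
    L.Iso (LineBundle.trivial A) := by
  have h0 : ∀ a, ∀ z ∈ L.N a, intOrderAt (s.s a) z = 0 := fun a z hz => by
    rw [s.intOrderAt_eq_ord hz, hs]; rfl
  have h1 := fun a z (hz : z ∈ L.N a) => (s.nonzeroAt hz).analyticAt_puncturedLim (h0 a z hz)
  refine ⟨L.N, fun a z => (puncturedLim (s.s a) z)⁻¹, L.isOpen_N, L.mem_N,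
    fun a z hz => ⟨hz, L.N_subset a hz⟩,
    fun a z hz => ⟨(h1 a z hz).1.inv (h1 a z hz).2, inv_ne_zero (h1 a z hz).2⟩, ?_⟩
  intro a b f z hf hz hfz
  change (puncturedLim (s.s b) (f z))⁻¹ * _ = 1 * (puncturedLim (s.s a) z)⁻¹
  have h2 : puncturedLim (s.s b) (f z) = L.g a b f z * puncturedLim (s.s a) z := by
    rw [← puncturedLim_comp hf.analyticAt hf.deriv_ne_zero]
    refine (puncturedLim_congr (s.compatible a b f z hf hz hfz)).trans ?_
    exact (((L.g_analytic a b f z hf hz hfz).continuousAt.tendsto.mono_left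
      nhdsWithin_le_nhds).mul ((s.nonzeroAt hz).tendsto_puncturedLim (h0 a z hz))).limUnder_eq
  have h3 := (h1 a z hz).2
  have h4 := L.g_ne_zero a b f z hf hz hfz
  rw [h2]
  field_simp

/-- The tensor product of sections. -/
def tensor (s : RationalSection L) (s' : RationalSection L') :
    RationalSection (L.tensor L') where
  s a z := s.s a z * s'.s a z
  meromorphic a z hz := ((s.nonzeroAt hz.1).mul (s'.nonzeroAt hz.2)).1
  order_ne_top a z hz := ((s.nonzeroAt hz.1).mul (s'.nonzeroAt hz.2)).2
  compatible a b f z hf hz hfz := by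
    filter_upwards [s.compatible a b f z hf hz.1 hfz.1, s'.compatible a b f z hf hz.2 hfz.2]
      with w h1 h2
    change _ = L.g a b f w * L'.g a b f w * _
    rw [h1, h2]
    ring

theorem ord_tensor (s : RationalSection L) (s' : RationalSection L') :
    (s.tensor s').ord = s.ord + s'.ord := by
  ext x
  exact (s.nonzeroAt (L.mem_N _)).intOrderAt_mul (s'.nonzeroAt (L'.mem_N _))

/-- The inverse section of the dual bundle. -/
noncomputable def dual (s : RationalSection L) : RationalSection L.dual where
  s a z := (s.s a z)⁻¹
  meromorphic a z hz := (s.nonzeroAt hz).inv.1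
  order_ne_top a z hz := (s.nonzeroAt hz).inv.2
  compatible a b f z hf hz hfz := by
    filter_upwards [s.compatible a b f z hf hz hfz] with w h1
    change _ = (L.g a b f w)⁻¹ * _
    rw [h1, mul_inv]

theorem ord_dual (s : RationalSection L) : s.dual.ord = -s.ord := by
  ext x
  exact (s.nonzeroAt (L.mem_N _)).intOrderAt_inv

/-- A function on `X` with meromorphic pull-backs to the charts is a section of the trivial
bundle. -/
def ofFunction (F : X → ℂ)
    (hF : ∀ i, ∀ z ∈ A.U i, MeromorphicNonzeroAt (fun w => F (A.φ i w)) z) :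
    RationalSection (LineBundle.trivial A) where
  s a z := F (A.φ a.1 z)
  meromorphic a z hz := (hF a.1 z hz).1
  order_ne_top a z hz := (hF a.1 z hz).2
  compatible a b f z hf hz hfz := by
    filter_upwards [hf.comm.filter_mono nhdsWithin_le_nhds] with w h1
    change _ = 1 * _
    rw [h1, one_mul]

end RationalSection

/-! ### The line bundle of a point -/

section PointBundle

variable (x : X)

variable (A) in
open scoped Classical in
/-- In the frame near the point `a` of a chart, the equation of the point `x`. -/
noncomputable def pointEquation (a : A.Pt) (w : ℂ) : ℂ :=
  if A.φ a.1 a.2 = x then w - a.2 else 1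

variable (A) in
/-- A neighbourhood of the point `a` of a chart in which no other point lies over `x`. -/
def pointNhd (a : A.Pt) : Set ℂ := {w | w ∈ A.U a.1 ∧ (A.φ a.1 w = x → w = a.2)}

theorem isOpen_pointNhd [T2Space X] (a : A.Pt) : IsOpen (A.pointNhd x a) := by
  rw [isOpen_iff_mem_nhds]
  rintro w ⟨hw, hwa⟩
  by_cases h : A.φ a.1 w = x
  · filter_upwards [(A.isOpen_U a.1).mem_nhds hw,
      eventually_nhdsWithin_iff.1 (eventually_φ_ne hw)] with v hv hv'
    refine ⟨hv, fun hvx => ?_⟩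
    by_contra hne
    exact hv' (fun hvw => hne (by rw [hvw, hwa h])) (hvx.trans h.symm)
  · filter_upwards [(A.isOpen_U a.1).mem_nhds hw,
      eventually_φ_mem hw isOpen_compl_singleton h] with v hv hv'
    exact ⟨hv, fun hvx => absurd hvx hv'⟩

theorem pointEquation_nonzeroAt (a : A.Pt) (z : ℂ) :
    MeromorphicNonzeroAt (A.pointEquation x a) z := by
  unfold pointEquation
  split_ifs
  · exact meromorphicNonzeroAt_sub _ _
  · exact .of_analyticAt analyticAt_const one_ne_zero

open scoped Classical in
theorem intOrderAt_pointEquation {a : A.Pt} {z : ℂ} (hz : z ∈ A.pointNhd x a) :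
    intOrderAt (A.pointEquation x a) z = if A.φ a.1 z = x then 1 else 0 := by
  unfold pointEquation
  by_cases h : A.φ a.1 z = x
  · have h1 : z = a.2 := hz.2 h
    rw [if_pos h]
    rw [h1] at h
    simp only [h, if_true]
    rw [intOrderAt_sub, if_pos h1]
  · rw [if_neg h]
    split_ifs with h1
    · rw [intOrderAt_sub, if_neg fun h2 => h (by rw [h2, h1])]
    · exact intOrderAt_of_analyticAt analyticAt_const one_ne_zero

variable (A) in
/-- The quotient of the equations of `x` in two frames. -/
noncomputable def pointRatio (a b : A.Pt) (f : ℂ → ℂ) (w : ℂ) : ℂ :=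
  A.pointEquation x b (f w) * (A.pointEquation x a w)⁻¹

theorem pointRatio_nonzeroAt {a b : A.Pt} {f : ℂ → ℂ} {z : ℂ} (hf : A.IsArrow a.1 b.1 f z) :
    MeromorphicNonzeroAt (A.pointRatio x a b f) z :=
  ((pointEquation_nonzeroAt x b (f z)).comp_of_deriv_ne_zero hf.analyticAt hf.deriv_ne_zero).mul
    (pointEquation_nonzeroAt x a z).inv

theorem intOrderAt_pointRatio {a b : A.Pt} {f : ℂ → ℂ} {z : ℂ} (hf : A.IsArrow a.1 b.1 f z)
    (hz : z ∈ A.pointNhd x a) (hfz : f z ∈ A.pointNhd x b) :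
    intOrderAt (A.pointRatio x a b f) z = 0 := by
  have h1 := (pointEquation_nonzeroAt x b (f z)).comp_of_deriv_ne_zero hf.analyticAt
    hf.deriv_ne_zero
  have h2 : intOrderAt (fun w => A.pointEquation x b (f w)) z = _ :=
    intOrderAt_comp_of_deriv_ne_zero (f := A.pointEquation x b) hf.analyticAt hf.deriv_ne_zero
  refine (h1.intOrderAt_mul (pointEquation_nonzeroAt x a z).inv).trans ?_
  rw [(pointEquation_nonzeroAt x a z).intOrderAt_inv]
  change intOrderAt (fun w => A.pointEquation x b (f w)) z + _ = 0
  rw [h2, intOrderAt_pointEquation x hz, intOrderAt_pointEquation x hfz, hf.φ_eq]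
  ring

variable (A) in
/-- The line bundle `𝒪(x)`. Its frame near a point `a` of a chart is the inverse of the equation of
`x`, and the transition functions are the quotients of these equations, extended over `x`. -/
noncomputable def pointBundle [T2Space X] : A.LineBundle where
  N := A.pointNhd x
  isOpen_N := isOpen_pointNhd x
  mem_N a := ⟨a.2.2, fun _ => rfl⟩
  N_subset _ _ hw := hw.1
  g a b f := puncturedLim (A.pointRatio x a b f)
  g_ne_zero a b f z hf hz hfz :=
    ((pointRatio_nonzeroAt x hf).analyticAt_puncturedLim (intOrderAt_pointRatio x hf hz hfz)).2
  g_congr a b f f' z hf hz hfz h := by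
    refine puncturedLim_congr ?_
    filter_upwards [h.filter_mono nhdsWithin_le_nhds] with w hw
    rw [pointRatio, pointRatio, hw]
  g_analytic a b f z hf hz hfz :=
    ((pointRatio_nonzeroAt x hf).analyticAt_puncturedLim (intOrderAt_pointRatio x hf hz hfz)).1
  g_comp a b c f f' z hf hf' hz hfz hfz' := by
    have h1 := pointRatio_nonzeroAt x hf'
    have h2 : intOrderAt (A.pointRatio x b c f' ∘ f) z = 0 := by
      rw [intOrderAt_comp_of_deriv_ne_zero hf.analyticAt hf.deriv_ne_zero,
        intOrderAt_pointRatio x hf' hfz hfz']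
    rw [← puncturedLim_comp hf.analyticAt hf.deriv_ne_zero,
      ← (h1.comp_of_deriv_ne_zero hf.analyticAt hf.deriv_ne_zero).puncturedLim_mul h2
        (pointRatio_nonzeroAt x hf) (intOrderAt_pointRatio x hf hz hfz)]
    refine puncturedLim_congr ?_
    filter_upwards [hf.tendsto_nhdsNE.eventually
      (pointEquation_nonzeroAt x b (f z)).eventually_ne_zero] with w hw
    simp only [pointRatio, Function.comp_apply]
    field_simp

variable (A) in
/-- The canonical section of `𝒪(x)`. -/
noncomputable def pointSection [T2Space X] : RationalSection (A.pointBundle x) where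
  s := A.pointEquation x
  meromorphic a z _ := (pointEquation_nonzeroAt x a z).1
  order_ne_top a z _ := (pointEquation_nonzeroAt x a z).2
  compatible a b f z hf hz hfz := by
    filter_upwards [(pointRatio_nonzeroAt x hf).eventually_puncturedLim_eq,
      (pointEquation_nonzeroAt x a z).eventually_ne_zero] with w h1 h2
    change _ = puncturedLim (A.pointRatio x a b f) w * _
    rw [h1, pointRatio, inv_mul_cancel_right₀ h2]

open scoped Classical in
theorem ord_pointSection [T2Space X] : (A.pointSection x).ord = Pi.single x 1 := by
  ext y
  have h1 := intOrderAt_pointEquation x (a := A.lift y) ((A.pointBundle x).mem_N (A.lift y))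
  rw [φ_lift] at h1
  rw [Pi.single_apply]
  exact h1

end PointBundle

/-! ### Divisors of functions -/

variable {h : X ≃ₜ OnePoint ℂ}

/-- Sections of isomorphic line bundles differ by a meromorphic function on the sphere, which has
as many zeros as poles. -/
theorem IsSphereIso.exists_ord_sub (hh : A.IsSphereIso h) {L L' : A.LineBundle} (hL : L.Iso L')
    (s : RationalSection L) (s' : RationalSection L') :
    ∃ D : X → ℤ, (Function.support D).Finite ∧ ∑ᶠ x, D x = 0 ∧
      ∀ x, s.ord x = s'.ord x + D x * A.stabOrder x := by
  obtain ⟨M, k, hM, hm, hMN, hk, hkc⟩ := hL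
  obtain ⟨F, hF, hFs⟩ := exists_ratio hM hm hMN hk hkc isOpen_univ s.isSectionOn s'.isSectionOn
  have hF' : ∀ c, SphereMeromorphicAt (F ∘ h.symm) c := by
    intro c
    have h1 := hh.sphereMeromorphicAt (F := F ∘ h.symm) (A.lift (h.symm c)).2.2
      (by simpa using hF _ _ (A.lift (h.symm c)).2.2 trivial)
    rwa [φ_lift, h.apply_symm_apply] at h1
  obtain ⟨h1, h2⟩ := sphere_degree_eq_zero hF'
  refine ⟨fun x => sphereOrd (F ∘ h.symm) (h x), h1.preimage h.injective.injOn, ?_, fun x => ?_⟩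
  · rw [← h2]
    exact finsum_comp_equiv h.toEquiv
  · set a := A.lift x with ha
    have h3 := hFs a a.2 (hm a) trivial
    have h4 := intOrderAt_congr h3
    have hkn := MeromorphicNonzeroAt.of_analyticAt (hk a _ (hm a)).1 (hk a _ (hm a)).2
    obtain ⟨h5, h6⟩ := hh.pullback a.2.2 (hF' (h (A.φ a.1 a.2)))
    simp only [Function.comp_apply, h.symm_apply_apply] at h5 h6
    rw [hkn.intOrderAt_mul (s.nonzeroAt (L.mem_N a)),
      intOrderAt_of_analyticAt (hk a _ (hm a)).1 (hk a _ (hm a)).2,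
      h5.intOrderAt_mul (s'.nonzeroAt (L'.mem_N a)), h6, φ_lift, zero_add] at h4
    rw [add_comm]
    exact h4

theorem IsSphereIso.exists_section_trivial (hh : A.IsSphereIso h) {D : X → ℤ}
    (hD : (Function.support D).Finite) (hD0 : ∑ᶠ x, D x = 0) :
    ∃ s : RationalSection (LineBundle.trivial A), ∀ x, s.ord x = D x * A.stabOrder x := by
  obtain ⟨F, hF, hFD⟩ := exists_sphereOrd_eq (d := D ∘ h.symm)
    (hD.preimage h.symm.injective.injOn) (by rw [← hD0]; exact finsum_comp_equiv h.symm.toEquiv)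
  refine ⟨.ofFunction (fun x => F (h x)) fun i z hz => (hh.pullback hz (hF _)).1, fun x => ?_⟩
  have h1 := (hh.pullback (A.lift x).2.2 (hF _)).2
  rw [φ_lift, hFD, Function.comp_apply, h.symm_apply_apply] at h1
  exact h1

end OrbifoldAtlas

/-! ### The abelian group with generators `x i` and relations `p i • x i = p j • x j` -/

section Presentation

variable {ι : Type*} [Fintype ι] (p : ι → ℕ)

/-- The degree of `∑ i, c i • x i`, where `x i` has degree `1 / p i`, multiplied by the least common
multiple of the `p i`. -/
def weight : (ι → ℤ) →+ ℤ where
  toFun c := ∑ i, c i * ((Finset.univ.lcm p / p i : ℕ) : ℤ)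
  map_zero' := by simp
  map_add' c c' := by simp [add_mul, Finset.sum_add_distrib]

variable {p}

theorem lcm_pos_of_pos (hp : ∀ i, 0 < p i) : 0 < Finset.univ.lcm p :=
  Nat.pos_of_ne_zero fun h => by
    obtain ⟨i, -, hi⟩ := Finset.lcm_eq_zero_iff.1 h
    exact (hp i).ne' hi

theorem lcm_div_mul (i : ι) : Finset.univ.lcm p / p i * p i = Finset.univ.lcm p :=
  Nat.div_mul_cancel (Finset.dvd_lcm (Finset.mem_univ i))

theorem sum_div_eq_weight {K : Type*} [Field K] [CharZero K] (hp : ∀ i, 0 < p i) (c : ι → ℤ) :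
    ∑ i, (c i : K) / p i = weight p c / (Finset.univ.lcm p : ℕ) := by
  have hm : ((Finset.univ.lcm p : ℕ) : K) ≠ 0 := Nat.cast_ne_zero.2 (lcm_pos_of_pos hp).ne'
  rw [eq_div_iff hm, Finset.sum_mul]
  simp only [weight, AddMonoidHom.coe_mk, ZeroHom.coe_mk]
  simp only [Int.cast_sum, Int.cast_mul, Int.cast_natCast]
  refine Finset.sum_congr rfl fun i _ => ?_
  have hi : (p i : K) ≠ 0 := Nat.cast_ne_zero.2 (hp i).ne'
  have h1 : ((Finset.univ.lcm p / p i : ℕ) : K) * p i = (Finset.univ.lcm p : ℕ) := by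
    exact_mod_cast congrArg (Nat.cast (R := K)) (lcm_div_mul (p := p) i)
  rw [← h1]
  field_simp

/-- Bézout's identity: the numbers `lcm p / p i` have no common divisor. -/
theorem exists_weight_eq_one [Nonempty ι] (hp : ∀ i, 0 < p i) : ∃ c, weight p c = 1 := by
  obtain ⟨c, hc⟩ := Finset.gcd_eq_sum_mul (Finset.univ : Finset ι)
    fun i => ((Finset.univ.lcm p / p i : ℕ) : ℤ)
  refine ⟨c, ?_⟩
  have h1 : weight p c = Finset.univ.gcd fun i => ((Finset.univ.lcm p / p i : ℕ) : ℤ) := by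
    rw [hc]
    exact Finset.sum_congr rfl fun i _ => mul_comm _ _
  have hm := lcm_pos_of_pos hp
  set d := (weight p c).natAbs with hd
  have h2 : ∀ i, d ∣ Finset.univ.lcm p / p i := fun i => by
    have h3 : weight p c ∣ ((Finset.univ.lcm p / p i : ℕ) : ℤ) := by
      rw [h1]
      exact Finset.gcd_dvd (Finset.mem_univ i)
    exact Int.natAbs_dvd_natAbs.2 h3
  have h4 : ∀ i, d * p i ∣ Finset.univ.lcm p := fun i => by
    conv_rhs => rw [← lcm_div_mul (p := p) i]
    exact mul_dvd_mul_right (h2 i) _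
  obtain ⟨i₀⟩ := ‹Nonempty ι›
  obtain ⟨r, hr⟩ := (dvd_mul_right d (p i₀)).trans (h4 i₀)
  have hd0 : 0 < d := Nat.pos_of_ne_zero fun h => by rw [h, zero_mul] at hr; omega
  have h5 : Finset.univ.lcm p ∣ r := Finset.lcm_dvd fun i _ =>
    Nat.dvd_of_mul_dvd_mul_left hd0 (hr ▸ h4 i)
  have hr0 : 0 < r := Nat.pos_of_ne_zero fun h => by rw [h, mul_zero] at hr; omega
  have h6 : d = 1 := by
    have := Nat.le_of_dvd hr0 h5
    rw [hr] at this
    nlinarith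
  have h7 : 0 ≤ weight p c := by
    rw [h1, ← Finset.normalize_gcd]
    exact Int.nonneg_of_normalize_eq_self (normalize_idem _)
  omega

theorem sum_single_sub_mem_closure [DecidableEq ι] (i₀ : ι) {k : ι → ℤ} (hk : ∑ i, k i = 0) :
    (fun i => k i * (p i : ℤ)) ∈ AddSubgroup.closure (Set.range fun ij : ι × ι =>
      (Pi.single ij.1 (p ij.1 : ℤ) - Pi.single ij.2 (p ij.2 : ℤ) : ι → ℤ)) := by
  have h1 : (fun i => k i * (p i : ℤ))
      = ∑ i, k i • (Pi.single i (p i : ℤ) - Pi.single i₀ (p i₀ : ℤ) : ι → ℤ) := by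
    ext j
    simp only [Finset.sum_apply, Pi.smul_apply, Pi.sub_apply, smul_eq_mul, mul_sub,
      Finset.sum_sub_distrib, ← Finset.sum_mul, hk, zero_mul, sub_zero]
    simp [Pi.single_apply]
  rw [h1]
  exact sum_mem fun i _ => zsmul_mem (AddSubgroup.subset_closure (Set.mem_range.2 ⟨(i, i₀), rfl⟩)) _

/-- `c` is a combination of the relations if and only if `c i = k i * p i` with `∑ i, k i = 0`. -/
theorem mem_closure_relations_iff [DecidableEq ι] [Nonempty ι] {c : ι → ℤ} :
    c ∈ AddSubgroup.closure (Set.range fun ij : ι × ι =>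
      (Pi.single ij.1 (p ij.1 : ℤ) - Pi.single ij.2 (p ij.2 : ℤ) : ι → ℤ)) ↔
    ∃ k : ι → ℤ, ∑ i, k i = 0 ∧ ∀ i, c i = k i * p i := by
  constructor
  · intro hc
    induction hc using AddSubgroup.closure_induction with
    | mem c hc =>
      obtain ⟨⟨i, j⟩, rfl⟩ := hc
      refine ⟨Pi.single i 1 - Pi.single j 1, by simp, fun l => ?_⟩
      simp only [Pi.sub_apply, Pi.single_apply]
      split_ifs with h1 h2 h2 <;> simp_all
    | zero => exact ⟨0, by simp, by simp⟩
    | add c c' _ _ hc hc' =>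
      obtain ⟨k, hk, h⟩ := hc
      obtain ⟨k', hk', h'⟩ := hc'
      exact ⟨k + k', by simp [Finset.sum_add_distrib, hk, hk'],
        fun i => by simp [h, h', add_mul]⟩
    | neg c _ hc =>
      obtain ⟨k, hk, h⟩ := hc
      exact ⟨-k, by simp [hk], fun i => by simp [h]⟩
  · rintro ⟨k, hk, h⟩
    rw [show c = fun i => k i * (p i : ℤ) from funext h]
    exact sum_single_sub_mem_closure (Classical.arbitrary ι) hk

variable {Q : Type*} [AddCommGroup Q] {φ : (ι → ℤ) →+ Q} {deg : Q →+ ℚ}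

theorem map_eq_zero_iff_weight (hp : ∀ i, 0 < p i)
    (hdeg : ∀ c, deg (φ c) = ∑ i, (c i : ℚ) / p i) (c : ι → ℤ) :
    deg (φ c) = 0 ↔ weight p c = 0 := by
  have hm : ((Finset.univ.lcm p : ℕ) : ℚ) ≠ 0 := Nat.cast_ne_zero.2 (lcm_pos_of_pos hp).ne'
  rw [hdeg, sum_div_eq_weight hp, div_eq_zero_iff]
  simp only [hm, or_false, Int.cast_eq_zero]

theorem range_degree [Nonempty ι] (hp : ∀ i, 0 < p i) (hφ : Function.Surjective φ)
    (hdeg : ∀ c, deg (φ c) = ∑ i, (c i : ℚ) / p i) :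
    deg.range = AddSubgroup.zmultiples (1 / (Finset.univ.lcm p : ℕ) : ℚ) := by
  ext r
  rw [AddSubgroup.mem_zmultiples_iff]
  constructor
  · rintro ⟨q, rfl⟩
    obtain ⟨c, rfl⟩ := hφ q
    refine ⟨weight p c, ?_⟩
    rw [hdeg, sum_div_eq_weight hp, zsmul_eq_mul, mul_one_div]
  · rintro ⟨k, rfl⟩
    obtain ⟨c, hc⟩ := exists_weight_eq_one hp
    refine ⟨k • φ c, ?_⟩
    rw [map_zsmul, hdeg, sum_div_eq_weight hp, hc, Int.cast_one]

theorem ker_degree (hp : ∀ i, 0 < p i) (hφ : Function.Surjective φ)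
    (hker : ∀ c, φ c = 0 ↔ ∃ k : ι → ℤ, ∑ i, k i = 0 ∧ ∀ i, c i = k i * p i)
    (hdeg : ∀ c, deg (φ c) = ∑ i, (c i : ℚ) / p i) :
    deg.ker = AddCommGroup.torsion Q := by
  have hm := lcm_pos_of_pos hp
  ext q
  rw [AddCommGroup.mem_torsion, isOfFinAddOrder_iff_nsmul_eq_zero, AddMonoidHom.mem_ker]
  constructor
  · obtain ⟨c, rfl⟩ := hφ q
    intro h
    rw [map_eq_zero_iff_weight hp hdeg] at h
    refine ⟨_, hm, ?_⟩
    rw [← map_nsmul, hker]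
    refine ⟨fun i => c i * ((Finset.univ.lcm p / p i : ℕ) : ℤ), h, fun i => ?_⟩
    rw [Pi.smul_apply, nsmul_eq_mul, mul_assoc, ← Nat.cast_mul, lcm_div_mul, mul_comm]
  · rintro ⟨k, hk, h⟩
    have := congrArg deg h
    rw [map_nsmul, map_zero, nsmul_eq_mul, mul_eq_zero] at this
    exact this.resolve_left (by exact_mod_cast hk.ne')

/-- A group with a homomorphism to `ℚ` which has torsion kernel and a nonzero cyclic image has rank
one. -/
theorem rank_eq_one_of_degree {d : ℚ} (hd : d ≠ 0)
    (hrange : deg.range = AddSubgroup.zmultiples d) (hker : deg.ker = AddCommGroup.torsion Q) :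
    Module.rank ℤ Q = 1 := by
  set D : Q →ₗ[ℤ] ℚ := deg.toIntLinearMap with hD
  have h1 : D.ker ≤ Submodule.torsion ℤ Q := by
    intro q hq
    have hq' : q ∈ deg.ker := hq
    rw [hker, AddCommGroup.mem_torsion, isOfFinAddOrder_iff_nsmul_eq_zero] at hq'
    obtain ⟨k, hk, h⟩ := hq'
    refine (Submodule.mem_torsion_iff _).2
      ⟨⟨(k : ℤ), mem_nonZeroDivisors_of_ne_zero (by exact_mod_cast hk.ne')⟩, ?_⟩
    change (k : ℤ) • q = 0
    rw [natCast_zsmul, h]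
  have h2 : D.range = Submodule.span ℤ {d} := by
    ext r
    rw [Submodule.mem_span_singleton]
    have h3 : r ∈ deg.range ↔ r ∈ AddSubgroup.zmultiples d := by rw [hrange]
    exact h3
  have h4 := D.quotKerEquivRange.lift_rank_eq
  rw [h2, ← (LinearEquiv.toSpanNonzeroSingleton ℤ ℚ d hd).rank_eq, Module.rank_self,
    Cardinal.lift_one, Cardinal.lift_eq_one] at h4
  rw [← rank_quotient_eq_of_le_torsion h1, h4]

/-- The homomorphism `z ↦ exp (2 π i z)` from the complex numbers to the additive version of the
group of nonzero complex numbers. -/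
noncomputable def expHom : ℂ →+ Additive ℂˣ where
  toFun z := Additive.ofMul (Units.mk0 _ (Complex.exp_ne_zero (2 * Real.pi * Complex.I * z)))
  map_zero' := by
    rw [← ofMul_one]
    congr 1
    ext
    simp
  map_add' z w := by
    rw [← ofMul_mul]
    congr 1
    ext
    simp [mul_add, Complex.exp_add]

theorem expHom_eq_zero_iff {z : ℂ} : expHom z = 0 ↔ ∃ k : ℤ, z = k := by
  have h1 : expHom z = 0 ↔ Complex.exp (2 * Real.pi * Complex.I * z) = 1 := by
    rw [← Units.val_mk0 (Complex.exp_ne_zero (2 * Real.pi * Complex.I * z)), Units.val_eq_one]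
    exact Iff.rfl
  rw [h1, Complex.exp_eq_one_iff]
  refine exists_congr fun k => ?_
  rw [mul_comm, mul_left_inj' Complex.two_pi_I_ne_zero]

theorem expHom_surjective : Function.Surjective expHom := by
  intro u
  refine ⟨Complex.log (Additive.toMul u : ℂˣ) / (2 * Real.pi * Complex.I), ?_⟩
  apply Additive.toMul.injective
  ext
  change Complex.exp (2 * Real.pi * Complex.I * (_ / (2 * Real.pi * Complex.I))) = _
  rw [mul_div_cancel₀ _ Complex.two_pi_I_ne_zero, Complex.exp_log (Units.ne_zero _)]

/-- The pairing `∑ i, a i * c i / p i` defines characters of the kernel of the degree. -/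
theorem exists_pairing (hφ : Function.Surjective φ)
    (hker : ∀ c, φ c = 0 ↔ ∃ k : ι → ℤ, ∑ i, k i = 0 ∧ ∀ i, c i = k i * p i)
    (hp : ∀ i, 0 < p i) :
    ∃ Ψ : (ι → ℤ) →+ (deg.ker →+ Additive ℂˣ), ∀ a c (hc : φ c ∈ deg.ker),
      Ψ a ⟨φ c, hc⟩ = expHom (∑ i, (a i : ℂ) * c i / p i) := by
  have hwd : ∀ (a c c' : ι → ℤ), φ c = φ c' →
      expHom (∑ i, (a i : ℂ) * c i / p i) = expHom (∑ i, (a i : ℂ) * c' i / p i) := by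
    intro a c c' h
    obtain ⟨k, -, hk⟩ := (hker (c - c')).1 (by rw [map_sub, h, sub_self])
    rw [← sub_eq_zero, ← map_sub, expHom_eq_zero_iff]
    refine ⟨∑ i, a i * k i, ?_⟩
    rw [← Finset.sum_sub_distrib]
    push_cast
    refine Finset.sum_congr rfl fun i _ => ?_
    have h1 : (c i : ℂ) - c' i = k i * p i := by exact_mod_cast hk i
    have hi : (p i : ℂ) ≠ 0 := Nat.cast_ne_zero.2 (hp i).ne'
    field_simp
    linear_combination (a i : ℂ) * h1
  choose f hf using hφ
  refine ⟨AddMonoidHom.mk' (fun a => AddMonoidHom.mk'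
    (fun t => expHom (∑ i, (a i : ℂ) * f t i / p i)) fun t t' => ?_) fun a a' => ?_,
    fun a c hc => hwd a _ _ (hf _)⟩
  · rw [← map_add, ← Finset.sum_add_distrib, hwd a (f ↑(t + t')) (f t + f t')]
    · congr 1
      refine Finset.sum_congr rfl fun i _ => ?_
      rw [Pi.add_apply]
      push_cast
      ring
    · rw [hf, map_add, hf, hf]
      rfl
  · ext t : 1
    change expHom _ = expHom _ + expHom _
    rw [← map_add, ← Finset.sum_add_distrib]
    congr 1
    refine Finset.sum_congr rfl fun i _ => ?_
    rw [Pi.add_apply]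
    push_cast
    ring

/-- The kernel of the degree is isomorphic to its dual, and this is `(∏ ℤ / p i) / ⟨(1, …, 1)⟩`
since the kernel of the degree consists of the elements `∑ i, c i • x i` such that `c` is orthogonal
to `(1, …, 1)` with respect to the pairing `∑ i, a i * c i / p i`. -/
theorem nonempty_ker_degree_equiv [Nonempty ι] (hp : ∀ i, 0 < p i) (hφ : Function.Surjective φ)
    (hker : ∀ c, φ c = 0 ↔ ∃ k : ι → ℤ, ∑ i, k i = 0 ∧ ∀ i, c i = k i * p i)
    (hdeg : ∀ c, deg (φ c) = ∑ i, (c i : ℚ) / p i) :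
    Nonempty (deg.ker ≃+
      ((∀ j, ZMod (p j)) ⧸ AddSubgroup.zmultiples (1 : ∀ j, ZMod (p j)))) := by
  classical
  have hm := lcm_pos_of_pos hp
  have hm' : ((Finset.univ.lcm p : ℕ) : ℂ) ≠ 0 := Nat.cast_ne_zero.2 hm.ne'
  have hp' : ∀ i, (p i : ℂ) ≠ 0 := fun i => Nat.cast_ne_zero.2 (hp i).ne'
  have hpm : ∀ i, ((Finset.univ.lcm p / p i : ℕ) : ℂ) * p i = (Finset.univ.lcm p : ℕ) :=
    fun i => by exact_mod_cast congrArg (Nat.cast (R := ℂ)) (lcm_div_mul (p := p) i)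
  obtain ⟨c₁, hc₁⟩ := exists_weight_eq_one hp
  have hmem : ∀ c, φ c ∈ deg.ker ↔ weight p c = 0 := fun c => map_eq_zero_iff_weight hp hdeg c
  have hproj : ∀ c, weight p (c - weight p c • c₁) = 0 := fun c => by
    rw [map_sub, map_zsmul, hc₁, smul_eq_mul, mul_one, sub_self]
  obtain ⟨Ψ, hΨ⟩ := exists_pairing (deg := deg) hφ hker hp
  -- every character of the kernel of the degree comes from the pairing
  have hΨs : Function.Surjective Ψ := by
    intro χ
    have hχ0 : ∀ c (hc : φ c ∈ deg.ker), φ c = 0 → χ ⟨φ c, hc⟩ = 0 := fun c hc h => by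
      rw [show (⟨φ c, hc⟩ : deg.ker) = 0 from Subtype.ext h, map_zero]
    -- extend the character to `ι → ℤ` by the projection to the kernel of `weight p` along `c₁`
    set g : (ι → ℤ) →+ Additive ℂˣ := AddMonoidHom.mk'
      (fun c => χ ⟨φ (c - weight p c • c₁), (hmem _).2 (hproj c)⟩) (fun c c' => by
        rw [← map_add]
        congr 1
        apply Subtype.ext
        change φ _ = φ _ + φ _
        rw [← map_add, map_add]
        congr 1
        rw [add_smul]
        abel) with hg
    have hgχ : ∀ c (hc : φ c ∈ deg.ker), g c = χ ⟨φ c, hc⟩ := fun c hc => by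
      simp only [hg, AddMonoidHom.mk'_apply, (hmem c).1 hc, zero_smul, sub_zero]
    choose z hz using fun i => expHom_surjective (g (Pi.single i 1))
    have hgz : ∀ c, g c = expHom (∑ i, c i * z i) := by
      intro c
      have h1 : c = ∑ i, c i • (Pi.single i 1 : ι → ℤ) := by
        ext j
        simp [Finset.sum_apply, Pi.single_apply]
      conv_lhs => rw [h1]
      rw [map_sum, map_sum]
      refine Finset.sum_congr rfl fun i _ => ?_
      rw [map_zsmul, ← hz, ← map_zsmul, zsmul_eq_mul]
    set i₀ := Classical.arbitrary ι with hi₀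
    have h2 : ∀ i, ∃ n : ℤ, (p i : ℂ) * z i - p i₀ * z i₀ = n := by
      intro i
      have h3 : φ (Pi.single i (p i : ℤ) - Pi.single i₀ (p i₀ : ℤ)) = 0 := by
        refine (hker _).2 ⟨Pi.single i 1 - Pi.single i₀ 1, by simp, fun l => ?_⟩
        simp only [Pi.sub_apply, Pi.single_apply]
        split_ifs with h1 h2 h2 <;> simp_all
      have h4 : φ (Pi.single i (p i : ℤ) - Pi.single i₀ (p i₀ : ℤ)) ∈ deg.ker := by
        rw [h3]; exact zero_mem _
      have h5 := hgχ _ h4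
      rw [hχ0 _ h4 h3, hgz, expHom_eq_zero_iff] at h5
      obtain ⟨n, hn⟩ := h5
      refine ⟨n, ?_⟩
      rw [← hn]
      simp [Pi.single_apply, sub_mul, Finset.sum_sub_distrib]
    choose a ha using h2
    -- `z i` differs from `a i / p i` by a multiple of `1 / p i` with a factor that does not depend
    -- on `i`, and `c i / p i` sums to zero on the kernel of the degree
    refine ⟨a, ?_⟩
    ext ⟨t, ht⟩ : 1
    obtain ⟨c, rfl⟩ := hφ t
    rw [hΨ, ← hgχ c ht, hgz]
    congr 1
    have h3 := sum_div_eq_weight (K := ℂ) hp c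
    rw [(hmem c).1 ht, Int.cast_zero, zero_div] at h3
    have h4 : ∀ i, (a i : ℂ) * c i / p i = c i * z i - (p i₀ * z i₀) * ((c i : ℂ) / p i) :=
      fun i => by
        have := hp' i
        rw [← ha i]
        field_simp
    rw [Finset.sum_congr rfl fun i _ => h4 i, Finset.sum_sub_distrib, ← Finset.mul_sum, h3,
      mul_zero, sub_zero]
  set Θ : (ι → ℤ) →+ ((∀ j, ZMod (p j)) ⧸ AddSubgroup.zmultiples (1 : ∀ j, ZMod (p j))) :=
    (QuotientAddGroup.mk' _).comp
      (AddMonoidHom.pi fun j => (Int.castAddHom (ZMod (p j))).comp (Pi.evalAddMonoidHom _ j))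
    with hΘ
  have hΘs : Function.Surjective Θ := by
    refine (QuotientAddGroup.mk'_surjective _).comp fun v => ?_
    choose a ha using fun j => ZMod.intCast_surjective (v j)
    exact ⟨a, funext ha⟩
  have hΘker : ∀ a, a ∈ Θ.ker ↔ ∃ t : ℤ, ∀ j, ((t : ℤ) : ZMod (p j)) = a j := by
    intro a
    rw [AddMonoidHom.mem_ker]
    refine (QuotientAddGroup.eq_zero_iff _).trans ?_
    rw [AddSubgroup.mem_zmultiples_iff]
    refine exists_congr fun t => ?_
    rw [funext_iff]
    refine forall_congr' fun j => ?_
    rw [show (t • (1 : ∀ j, ZMod (p j))) j = t by simp]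
    rfl
  have hΨker : ∀ a, a ∈ Ψ.ker ↔ ∃ t : ℤ, ∀ j, ((t : ℤ) : ZMod (p j)) = a j := by
    intro a
    rw [AddMonoidHom.mem_ker]
    constructor
    · intro h
      have h1 : ∀ c, weight p c = 0 → ∃ k : ℤ, ∑ i, (a i : ℂ) * c i / p i = k := fun c hc => by
        rw [← expHom_eq_zero_iff, ← hΨ a c ((hmem c).2 hc), h]
        rfl
      -- evaluate at the projections of the basis vectors to the kernel of `weight p`
      refine ⟨weight p (fun i => a i * c₁ i), fun j => ?_⟩
      obtain ⟨k, hk⟩ := h1 _ (hproj (Pi.single j 1))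
      have h2 := sum_div_eq_weight (K := ℂ) hp (fun i => a i * c₁ i)
      have h3 : weight p (Pi.single j 1) = ((Finset.univ.lcm p / p j : ℕ) : ℤ) := by
        simp only [weight, AddMonoidHom.coe_mk, ZeroHom.coe_mk, Pi.single_apply, ite_mul, one_mul,
          zero_mul, Finset.sum_ite_eq', Finset.mem_univ, if_true]
      have h4 : ∑ i, (a i : ℂ) *
            ((Pi.single j 1 - weight p (Pi.single j 1) • c₁ : ι → ℤ) i : ℤ) / p i
          = a j / p j - ((Finset.univ.lcm p / p j : ℕ) : ℂ)
            * ∑ i, ((a i * c₁ i : ℤ) : ℂ) / p i := by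
        rw [h3, Finset.mul_sum]
        have h5 : (a j : ℂ) / p j = ∑ i, if i = j then (a i : ℂ) / p i else 0 := by simp
        rw [h5, ← Finset.sum_sub_distrib]
        refine Finset.sum_congr rfl fun i _ => ?_
        simp only [Pi.sub_apply, Pi.smul_apply, Pi.single_apply, smul_eq_mul]
        split_ifs <;>
          simp only [Int.cast_sub, Int.cast_one, Int.cast_zero, Int.cast_mul, Int.cast_natCast] <;>
          ring
      rw [h4, h2] at hk
      have h6 : a j - weight p (fun i => a i * c₁ i) = k * p j := by
        have h7 := hp' j
        have h8 := hpm j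
        have : (a j : ℂ) - weight p (fun i => a i * c₁ i) = k * p j := by
          rw [← hk, ← h8]
          have h9 : ((Finset.univ.lcm p / p j : ℕ) : ℂ) ≠ 0 := fun h0 => by
            rw [h0, zero_mul] at h8
            exact hm' h8.symm
          field_simp
        exact_mod_cast this
      rw [eq_comm, ← sub_eq_zero, ← Int.cast_sub, h6]
      simp
    · rintro ⟨t, ht⟩
      ext ⟨q, hq⟩ : 1
      obtain ⟨c, rfl⟩ := hφ q
      rw [hΨ, AddMonoidHom.zero_apply, expHom_eq_zero_iff]
      have h1 : ∀ j, ∃ k : ℤ, a j = t + p j * k := fun j => by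
        have h2 := (ZMod.intCast_eq_intCast_iff_dvd_sub t (a j) (p j)).1 (ht j)
        obtain ⟨k, hk⟩ := h2
        exact ⟨k, by linarith⟩
      choose k hk using h1
      have h3 := sum_div_eq_weight (K := ℂ) hp c
      rw [(hmem c).1 hq, Int.cast_zero, zero_div] at h3
      refine ⟨∑ i, k i * c i, ?_⟩
      have h4 : ∀ i, (a i : ℂ) * c i / p i = t * ((c i : ℂ) / p i) + k i * c i := fun i => by
        have := hp' i
        rw [hk i]
        push_cast
        field_simp
      rw [Finset.sum_congr rfl fun i _ => h4 i, Finset.sum_add_distrib, ← Finset.mul_sum, h3,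
        mul_zero, zero_add]
      push_cast
      rfl
  have hfg : AddGroup.FG deg.ker := by
    have h1 : Module.Finite ℤ Q := Module.Finite.of_surjective φ.toIntLinearMap hφ
    have h2 : Module.Finite ℤ (AddSubgroup.toIntSubmodule deg.ker) := inferInstance
    exact Module.Finite.iff_addGroup_fg.1 h2
  have hfin : Finite deg.ker := by
    refine AddCommGroup.finite_of_fg_isAddTorsion _ fun t => ?_
    have h1 : (t : Q) ∈ AddCommGroup.torsion Q := ker_degree hp hφ hker hdeg ▸ t.2
    exact AddSubmonoid.isOfFinAddOrder_coe.1 h1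
  obtain ⟨e⟩ := CommGroup.monoidHom_mulEquiv_of_hasEnoughRootsOfUnity (Multiplicative deg.ker) ℂ
  have e₁ : (deg.ker →+ Additive ℂˣ) ≃+ deg.ker :=
    { toFun := fun χ => (e (AddMonoidHom.toMultiplicativeLeft χ)).toAdd
      invFun := fun t => AddMonoidHom.toMultiplicativeLeft.symm (e.symm (Multiplicative.ofAdd t))
      left_inv := fun χ => by simp
      right_inv := fun t => by simp
      map_add' := fun χ χ' => by
        rw [← toAdd_mul, ← map_mul]
        rfl }
  exact ⟨e₁.symm.trans ((QuotientAddGroup.quotientKerEquivOfSurjective Ψ hΨs).symm.trans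
    ((QuotientAddGroup.quotientAddEquivOfEq (by ext a; rw [hΨker, hΘker])).trans
      (QuotientAddGroup.quotientKerEquivOfSurjective Θ hΘs)))⟩

end Presentation

/-! ### Divisors supported at finitely many given points -/

section PointDivisor

variable {X : Type*}

theorem finsum_eq_sum_of_injective {ι M : Type*} [Fintype ι] [AddCommMonoid M] {P : ι → X}
    (hP : Function.Injective P) {f : X → M} (hf : ∀ x, x ∉ Set.range P → f x = 0) :
    ∑ᶠ x, f x = ∑ i, f (P i) := by
  classical
  rw [finsum_eq_sum_of_support_subset (s := Finset.univ.image P) f,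
    Finset.sum_image fun _ _ _ _ h => hP h]
  intro x hx
  by_contra hxP
  exact hx (hf x fun ⟨i, hi⟩ => hxP (by simp [← hi]))

/-- The divisor `∑ i, c i • P i`. -/
def pointDivisor [DecidableEq X] {ι : Type*} [Fintype ι] (P : ι → X) (c : ι → ℤ) : X → ℤ :=
  ∑ i, c i • Pi.single (P i) 1

theorem pointDivisor_apply [DecidableEq X] {ι : Type*} [Fintype ι] {P : ι → X}
    (hP : Function.Injective P) (c : ι → ℤ) (i : ι) : pointDivisor P c (P i) = c i := by
  classical
  simp [pointDivisor, Finset.sum_apply, Pi.single_apply, hP.eq_iff]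

theorem pointDivisor_of_notMem [DecidableEq X] {ι : Type*} [Fintype ι] {P : ι → X}
    (c : ι → ℤ) {x : X} (hx : x ∉ Set.range P) : pointDivisor P c x = 0 := by
  simp only [pointDivisor, Finset.sum_apply, Pi.smul_apply, Pi.single_apply]
  refine Finset.sum_eq_zero fun i _ => ?_
  rw [if_neg fun h => hx ⟨i, h.symm⟩, smul_zero]

theorem finite_support_pointDivisor [DecidableEq X] {ι : Type*} [Fintype ι] (P : ι → X)
    (c : ι → ℤ) : (Function.support (pointDivisor P c)).Finite :=
  (Set.finite_range P).subset fun x hx => by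
    by_contra hxP
    exact hx (pointDivisor_of_notMem c hxP)

end PointDivisor

namespace OrbifoldAtlas

variable {X : Type*} [TopologicalSpace X] {A : OrbifoldAtlas X}

/-! ### Divisor classes -/

variable (A) in
/-- The pairs `(q, d)` such that a line bundle of class `q` has a rational section with orders
`d`. -/
noncomputable def divisorPairs : AddSubgroup (A.Pic × (X → ℤ)) where
  carrier := {a | ∃ (L : A.LineBundle) (s : RationalSection L), L.toPic = a.1 ∧ s.ord = a.2}
  zero_mem' := by
    refine ⟨LineBundle.trivial A,
      .ofFunction (fun _ => 1) fun _ _ _ => .of_analyticAt analyticAt_const one_ne_zero, rfl, ?_⟩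
    ext x
    exact intOrderAt_of_analyticAt (f := fun _ => 1) analyticAt_const one_ne_zero
  add_mem' := by
    rintro ⟨_, _⟩ ⟨_, _⟩ ⟨L, s, rfl, rfl⟩ ⟨L', s', rfl, rfl⟩
    exact ⟨L.tensor L', s.tensor s', rfl, s.ord_tensor s'⟩
  neg_mem' := by
    rintro ⟨_, _⟩ ⟨L, s, rfl, rfl⟩
    exact ⟨L.dual, s.dual, rfl, s.ord_dual⟩

theorem RationalSection.mem_divisorPairs {L : A.LineBundle} (s : RationalSection L) :
    (L.toPic, s.ord) ∈ A.divisorPairs := ⟨L, s, rfl, rfl⟩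

theorem eq_zero_of_mem_divisorPairs {q : A.Pic} (h : (q, 0) ∈ A.divisorPairs) : q = 0 := by
  obtain ⟨L, s, rfl, hs⟩ := h
  exact Quotient.sound (s.iso_trivial hs)

theorem finite_support_of_mem_divisorPairs [CompactSpace X] {q : A.Pic} {d : X → ℤ}
    (h : (q, d) ∈ A.divisorPairs) : (Function.support d).Finite := by
  obtain ⟨L, s, -, rfl⟩ := h
  exact s.finite_support_ord

theorem single_mem_divisorPairs [T2Space X] [DecidableEq X] (x : X) :
    ((A.pointBundle x).toPic, Pi.single x 1) ∈ A.divisorPairs :=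
  ⟨_, A.pointSection x, rfl, by
    rw [ord_pointSection]
    congr!⟩

variable {h : X ≃ₜ OnePoint ℂ}

/-- The divisors of rational functions are the `∑ x, D x • (stabOrder x) x` with `∑ x, D x = 0`. -/
theorem IsSphereIso.zero_mem_divisorPairs_iff (hh : A.IsSphereIso h) {d : X → ℤ} :
    (0, d) ∈ A.divisorPairs ↔ ∃ D : X → ℤ, (Function.support D).Finite ∧ ∑ᶠ x, D x = 0 ∧
      ∀ x, d x = D x * A.stabOrder x := by
  constructor
  · rintro ⟨L, s, hL, rfl⟩
    obtain ⟨L', s', hL', hs'⟩ := A.divisorPairs.zero_mem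
    obtain ⟨D, hD, hD0, hDs⟩ := hh.exists_ord_sub (Quotient.exact (hL.trans hL'.symm)) s s'
    refine ⟨D, hD, hD0, fun x => ?_⟩
    rw [hDs, hs']
    exact zero_add _
  · rintro ⟨D, hD, hD0, hd⟩
    obtain ⟨s, hs⟩ := hh.exists_section_trivial hD hD0
    exact ⟨_, s, rfl, funext fun x => (hs x).trans (hd x).symm⟩

variable (A) in
/-- The degree of the divisor `∑ x, (d x / stabOrder x) x`. -/
noncomputable def divisorDegree (d : X → ℤ) : ℚ := ∑ᶠ x, (d x : ℚ) / A.stabOrder x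

theorem divisorDegree_add {d d' : X → ℤ} (hd : (Function.support d).Finite)
    (hd' : (Function.support d').Finite) :
    A.divisorDegree (d + d') = A.divisorDegree d + A.divisorDegree d' := by
  unfold divisorDegree
  rw [← finsum_add_distrib]
  · exact finsum_congr fun x => by rw [Pi.add_apply, Int.cast_add, add_div]
  · exact hd.subset fun x hx h0 => hx (by simp [h0])
  · exact hd'.subset fun x hx h0 => hx (by simp [h0])

theorem IsSphereIso.divisorDegree_eq_zero (hh : A.IsSphereIso h) {d : X → ℤ}
    (hd : (0, d) ∈ A.divisorPairs) : A.divisorDegree d = 0 := by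
  obtain ⟨D, hD, hD0, hd⟩ := hh.zero_mem_divisorPairs_iff.1 hd
  have h1 : A.divisorDegree d = ∑ᶠ x, ((D x : ℤ) : ℚ) := finsum_congr fun x => by
    have := (A.stabOrder_pos x).ne'
    rw [hd]
    push_cast
    field_simp
  rw [h1, ← Int.cast_zero, ← hD0]
  exact ((Int.castAddHom ℚ).map_finsum hD).symm

/-- The degree homomorphism on the Picard group. -/
theorem IsSphereIso.exists_degree [CompactSpace X] (hh : A.IsSphereIso h) :
    ∃ deg : A.Pic →+ ℚ, ∀ q d, (q, d) ∈ A.divisorPairs → deg q = A.divisorDegree d := by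
  have hex : ∀ q : A.Pic, ∃ d, (q, d) ∈ A.divisorPairs := by
    rintro ⟨L⟩
    obtain ⟨s⟩ := hh.nonempty_rationalSection L
    exact ⟨s.ord, s.mem_divisorPairs⟩
  choose δ hδ using hex
  have huniq : ∀ q d, (q, d) ∈ A.divisorPairs → A.divisorDegree (δ q) = A.divisorDegree d := by
    intro q d hd
    have h1 : ((0 : A.Pic), δ q - d) ∈ A.divisorPairs := by
      simpa using A.divisorPairs.sub_mem (hδ q) hd
    have h2 := divisorDegree_add (A := A) (finite_support_of_mem_divisorPairs h1)
      (finite_support_of_mem_divisorPairs hd)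
    rw [hh.divisorDegree_eq_zero h1, zero_add, sub_add_cancel] at h2
    exact h2
  refine ⟨AddMonoidHom.mk' (fun q => A.divisorDegree (δ q)) fun q q' => ?_, huniq⟩
  rw [huniq (q + q') (δ q + δ q') (A.divisorPairs.add_mem (hδ q) (hδ q')),
    divisorDegree_add (finite_support_of_mem_divisorPairs (hδ q))
      (finite_support_of_mem_divisorPairs (hδ q'))]

/-! ### Generators and relations of the Picard group -/

section Generators

variable [T2Space X] {n : ℕ} {P : Fin (n + 1) → X} {p : Fin (n + 1) → ℕ}

variable (A P) in
/-- The class of `𝒪(∑ i, c i • P i)`. -/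
noncomputable def pointClass : (Fin (n + 1) → ℤ) →+ A.Pic where
  toFun c := ∑ i, c i • (A.pointBundle (P i)).toPic
  map_zero' := by simp
  map_add' c c' := by simp [add_smul, Finset.sum_add_distrib]

theorem pointClass_mem [DecidableEq X] (c : Fin (n + 1) → ℤ) :
    (A.pointClass P c, pointDivisor P c) ∈ A.divisorPairs := by
  have h1 := A.divisorPairs.sum_mem (t := Finset.univ)
    (f := fun i => c i • ((A.pointBundle (P i)).toPic, (Pi.single (P i) 1 : X → ℤ)))
    fun i _ => A.divisorPairs.zsmul_mem (single_mem_divisorPairs (P i)) (c i)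
  have h2 : (A.pointClass P c, pointDivisor P c)
      = ∑ i, c i • ((A.pointBundle (P i)).toPic, (Pi.single (P i) 1 : X → ℤ)) := by
    rw [Prod.ext_iff, Prod.fst_sum, Prod.snd_sum]
    exact ⟨rfl, rfl⟩
  rwa [h2]

theorem IsSphereIso.pointClass_eq_zero_iff (hh : A.IsSphereIso h) (hP : A.HasSignature P p)
    (c : Fin (n + 1) → ℤ) :
    A.pointClass P c = 0 ↔ ∃ k : Fin (n + 1) → ℤ, ∑ i, k i = 0 ∧ ∀ i, c i = k i * p i := by
  classical
  have h1 := pointClass_mem (A := A) (P := P) c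
  have h2 : A.pointClass P c = 0 ↔ (0, pointDivisor P c) ∈ A.divisorPairs := by
    refine ⟨fun h0 => h0 ▸ h1, fun h0 => eq_zero_of_mem_divisorPairs ?_⟩
    simpa using A.divisorPairs.sub_mem h1 h0
  rw [h2, hh.zero_mem_divisorPairs_iff]
  constructor
  · rintro ⟨D, -, hD0, hD⟩
    refine ⟨fun i => D (P i), ?_, fun i => ?_⟩
    · rw [← hD0, finsum_eq_sum_of_injective hP.injective]
      intro x hx
      have h3 := hD x
      rw [pointDivisor_of_notMem c hx, hP.order_eq_one x hx] at h3
      simpa using h3.symm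
    · rw [← hP.order_eq, ← hD, pointDivisor_apply hP.injective]
  · rintro ⟨k, hk, hck⟩
    refine ⟨pointDivisor P k, finite_support_pointDivisor P k, ?_, fun x => ?_⟩
    · rw [finsum_eq_sum_of_injective hP.injective fun x hx => pointDivisor_of_notMem k hx, ← hk]
      exact Finset.sum_congr rfl fun i _ => pointDivisor_apply hP.injective k i
    · by_cases hx : x ∈ Set.range P
      · obtain ⟨i, rfl⟩ := hx
        rw [pointDivisor_apply hP.injective, pointDivisor_apply hP.injective, hck, hP.order_eq]
      · rw [pointDivisor_of_notMem c hx, pointDivisor_of_notMem k hx, zero_mul]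

/-- A point with trivial stabilizer is equivalent to the divisor `p 0 • P 0`. -/
theorem IsSphereIso.exists_pointClass_single [DecidableEq X] (hh : A.IsSphereIso h)
    (hP : A.HasSignature P p) (x : X) :
    ∃ c, (A.pointClass P c, Pi.single x 1) ∈ A.divisorPairs := by
  by_cases hx : x ∈ Set.range P
  · obtain ⟨i, rfl⟩ := hx
    refine ⟨Pi.single i 1, ?_⟩
    have h1 : pointDivisor P (Pi.single i 1) = Pi.single (P i) 1 := by
      simp [pointDivisor, Pi.single_apply]
    rw [← h1]
    exact pointClass_mem _
  · refine ⟨Pi.single 0 (p 0 : ℤ), ?_⟩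
    have h1 : ((0 : A.Pic), (Pi.single x 1 - pointDivisor P (Pi.single 0 (p 0 : ℤ)) : X → ℤ))
        ∈ A.divisorPairs := by
      refine hh.zero_mem_divisorPairs_iff.2
        ⟨Pi.single x 1 - Pi.single (P 0) 1, ?_, ?_, fun y => ?_⟩
      · refine (Set.toFinite {x, P 0}).subset fun y hy => ?_
        by_contra hne
        simp only [Set.mem_insert_iff, Set.mem_singleton_iff, not_or] at hne
        exact hy (by simp [hne.1, hne.2])
      · rw [finsum_eq_sum_of_support_subset (s := {x, P 0})]
        · have hne : x ≠ P 0 := fun h0 => hx ⟨0, h0.symm⟩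
          rw [Finset.sum_pair hne]
          simp [hne, hne.symm]
        · intro y hy
          by_contra hne
          simp only [Finset.coe_insert, Finset.coe_singleton, Set.mem_insert_iff,
            Set.mem_singleton_iff, not_or] at hne
          exact hy (by simp [hne.1, hne.2])
      · have h2 : pointDivisor P (Pi.single 0 (p 0 : ℤ)) = (p 0 : ℤ) • Pi.single (P 0) 1 := by
          rw [pointDivisor, Finset.sum_eq_single 0]
          · simp
          · intro i _ hi
            simp [hi]
          · simp
        rw [h2]
        simp only [Pi.sub_apply, Pi.smul_apply, Pi.single_apply, smul_eq_mul]
        split_ifs with h3 h4 h4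
        · exact absurd ⟨0, h4.symm.trans h3⟩ hx
        · rw [h3, hP.order_eq_one x hx]
          simp
        · rw [h4, hP.order_eq]
          simp
        · simp
    have h2 := A.divisorPairs.add_mem (pointClass_mem (P := P) (Pi.single 0 (p 0 : ℤ))) h1
    simpa using h2

theorem IsSphereIso.pointClass_surjective [CompactSpace X] (hh : A.IsSphereIso h)
    (hP : A.HasSignature P p) : Function.Surjective (A.pointClass P) := by
  classical
  rintro ⟨L⟩
  obtain ⟨s⟩ := hh.nonempty_rationalSection L
  choose c hc using hh.exists_pointClass_single hP
  set S := s.finite_support_ord.toFinset with hS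
  have h1 := A.divisorPairs.sum_mem (t := S)
    (f := fun x => s.ord x • (A.pointClass P (c x), (Pi.single x 1 : X → ℤ)))
    fun x _ => A.divisorPairs.zsmul_mem (hc x) (s.ord x)
  have h2 : ∑ x ∈ S, s.ord x • (A.pointClass P (c x), (Pi.single x 1 : X → ℤ))
      = (A.pointClass P (∑ x ∈ S, s.ord x • c x), s.ord) := by
    rw [Prod.ext_iff, Prod.fst_sum, Prod.snd_sum]
    constructor
    · rw [map_sum]
      exact Finset.sum_congr rfl fun x _ => (map_zsmul _ _ _).symm
    · ext y
      simp [Finset.sum_apply, Pi.single_apply, hS]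
      tauto
  rw [h2] at h1
  have h3 := A.divisorPairs.sub_mem h1 s.mem_divisorPairs
  rw [Prod.mk_sub_mk, sub_self] at h3
  exact ⟨_, sub_eq_zero.1 (eq_zero_of_mem_divisorPairs h3)⟩

end Generators

end OrbifoldAtlas

/-! ### The Picard group of an orbifold line -/

theorem mainTheorem8 {X : Type*} [TopologicalSpace X] (A : OrbifoldAtlas X)
    (hA : A.IsOrbifoldLine) (n : ℕ) (P : Fin (n + 1) → X) (p : Fin (n + 1) → ℕ)
    (hP : A.HasSignature P p) :
    -- (a) rank one, and generated by the classes `x i` of `𝒪(P i)`, with the relations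
    -- `p 0 • x 0 = ⋯ = p n • x n`
    (Module.rank ℤ A.Pic = 1 ∧
      ∃ x : Fin (n + 1) → A.Pic,
        (∀ i, ∃ (L : A.LineBundle) (s : OrbifoldAtlas.RationalSection L),
          L.toPic = x i ∧ s.ord (P i) = 1 ∧ ∀ y, y ≠ P i → s.ord y = 0) ∧
        AddSubgroup.closure (Set.range x) = ⊤ ∧
        ∀ c : Fin (n + 1) → ℤ, ∑ i, c i • x i = 0 ↔
          c ∈ AddSubgroup.closure (Set.range fun ij : Fin (n + 1) × Fin (n + 1) =>
            (Pi.single ij.1 (p ij.1 : ℤ) - Pi.single ij.2 (p ij.2 : ℤ) : Fin (n + 1) → ℤ))) ∧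
    -- every line bundle has a rational section, and the divisors of these are finite sums
    (∀ L : A.LineBundle, Nonempty (OrbifoldAtlas.RationalSection L)) ∧
    (∀ (L : A.LineBundle) (s : OrbifoldAtlas.RationalSection L),
      (Function.support s.ord).Finite) ∧
    -- the degree homomorphism
    ∃ deg : A.Pic →+ ℚ,
      (∀ (L : A.LineBundle) (s : OrbifoldAtlas.RationalSection L),
        deg L.toPic = s.degree) ∧
      -- (b) its image is `(1/m)ℤ`, and its kernel `Pic₀` is the torsion subgroup
      deg.range = AddSubgroup.zmultiples (1 / (Finset.univ.lcm p : ℕ) : ℚ) ∧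
      deg.ker = AddCommGroup.torsion A.Pic ∧
      -- (c)
      Nonempty (deg.ker ≃+
        ((∀ j, ZMod (p j)) ⧸ AddSubgroup.zmultiples (1 : ∀ j, ZMod (p j)))) := by
  classical
  have := hA.t2
  have := hA.compact
  obtain ⟨h, hh⟩ := hA.genus_zero
  replace hh : A.IsSphereIso h := hh
  have hp : ∀ i, 0 < p i := fun i => hP.order_eq i ▸ A.stabOrder_pos (P i)
  obtain ⟨deg, hdeg⟩ := hh.exists_degree
  have hφ := hh.pointClass_surjective hP
  have hker := hh.pointClass_eq_zero_iff hP
  have hdegφ : ∀ c, deg (A.pointClass P c) = ∑ i, (c i : ℚ) / p i := fun c => by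
    rw [hdeg _ _ (OrbifoldAtlas.pointClass_mem c), OrbifoldAtlas.divisorDegree,
      finsum_eq_sum_of_injective hP.injective fun x hx => by
        rw [pointDivisor_of_notMem c hx, Int.cast_zero, zero_div]]
    exact Finset.sum_congr rfl fun i _ => by rw [pointDivisor_apply hP.injective, hP.order_eq]
  have hrange := range_degree hp hφ hdegφ
  have htors := ker_degree hp hφ hker hdegφ
  have hm : (1 / (Finset.univ.lcm p : ℕ) : ℚ) ≠ 0 :=
    one_div_ne_zero (Nat.cast_ne_zero.2 (lcm_pos_of_pos hp).ne')
  refine ⟨⟨rank_eq_one_of_degree hm hrange htors, fun i => (A.pointBundle (P i)).toPic,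
    fun i => ⟨_, A.pointSection (P i), rfl, ?_, fun y hy => ?_⟩, ?_,
    fun c => (hker c).trans mem_closure_relations_iff.symm⟩,
    fun L => hh.nonempty_rationalSection L, fun L s => s.finite_support_ord, deg,
    fun L s => hdeg _ _ s.mem_divisorPairs, hrange, htors,
    nonempty_ker_degree_equiv hp hφ hker hdegφ⟩
  · rw [OrbifoldAtlas.ord_pointSection, Pi.single_eq_same]
  · rw [OrbifoldAtlas.ord_pointSection, Pi.single_eq_of_ne hy]
  · refine eq_top_iff.2 fun q _ => ?_
    obtain ⟨c, rfl⟩ := hφ q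
    change ∑ i, c i • (A.pointBundle (P i)).toPic ∈ _
    exact AddSubgroup.sum_mem _ fun i _ =>
      AddSubgroup.zsmul_mem _ (AddSubgroup.subset_closure (Set.mem_range_self i)) _
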